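/- Let $\Phi\subset V$ be an irreducible, reduced, crystallographic finite root system spanning a Euclidean space $V$, not of type $A_n$ ($n\ge 1$), with simple roots $\alpha_1,\dots,\alpha_n$, simple coroots $\alpha_i^\vee=2\alpha_i/\langle\alpha_i,\alpha_i\rangle$, highest root $\xi$, finite Weyl group $W$ and coroot lattice $Q^\vee$. Let $\omega_1^\vee,\dots,\omega_n^\vee$ be the fundamental coweights, $\langle\alpha_i,\omega_j^\vee\rangle=\delta_{ij}$, and let $k_i$ be the least positive integer with $k_i\omega_i^\vee\in Q^\vee$. Let $\widetilde W$ be the associated affine Weyl group, i.e. the group of affine transformations of $V$ generated by the simple reflections $s_i(x)=x-\langle\alpha_i,x\rangle\alpha_i^\vee$ for $1\le i\le n$ and $s_0(x)=x-(\langle\xi,x\rangle-1)\xi^\vee$; for $\lambda\in Q^\vee$ let $t_\lambda\in\widetilde W$ be the translation by $\lambda$. (Thus $\widetilde W$ is an arbitrary affine Weyl group other than an affine symmetric group.) A word in $s_0,\dots,s_n$ is reduced if no shorter word represents the same element of $\widetilde W$; an infinite word $s_{i_1}s_{i_2}\cdots$ is reduced if all its finite prefixes are. Its inversion set is the set of reflections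 $s_{i_1}\cdots s_{i_{k-1}}s_{i_k}s_{i_{k-1}}\cdots s_{i_1}$, $k\ge1$, and $[\mathbf i]$ denotes the class of the infinite reduced words with the same inversion set as $\mathbf i$. For $g\in\widetilde W$, $[g^\infty]$ is the class of the infinite word obtained by repeating a reduced word of $g$ indefinitely, when this infinite word is reduced. A Coxeter element of $\widetilde W$ is a product of $s_0,\dots,s_n$, each occurring exactly once, in some order. In the Dynkin diagram of $\Phi$ there are $-2\langle\alpha_i,\alpha_j\rangle/\langle\alpha_j,\alpha_j\rangle$ directed edges from $\alpha_i$ to $\alpha_j$ ($i\ne j$), and nodes joined by an edge are adjacent. The heavy node is the node adjacent to three other nodes, if there is one, and otherwise the endpoint of the unique multiple edge whose root is longer. Then the Dynkin diagram of $\Phi$ is bipartite, and for every bipartition $F\sqcup U$ of its nodes (no two nodes in the same part being adjacent), with $s_F=\prod_{\alpha_i\in F}s_i$ and $s_U=\prod_{\alpha_i\in U}s_i$, and every node $\alpha_i$ ($1\le i\le n$), the following are equivalent: 1. $\alpha_i$ is a Coxeter node: for some Coxeter element $c$ of $\widetilde W$ and some $w\in W$, the infinite words $c^\infty$ and $t_{wk_i\omega_i^\vee}^\infty$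 are reduced and $[c^\infty]=[t_{wk_i\omega_i^\vee}^\infty]$; 2. $\alpha_i$ is the heavy node; 3. some finite alternating product $\cdots s_Us_Fs_Us_F$, with $s_F$ applied first, maps $\xi$ to $\alpha_i$. -/

import Mathlib

/-
Conventions.  `P` is a root pairing over `ℝ`: its roots span `M`, its coroots span the dual space
`N`, and `b` is a base, whose elements (`b.support`) index the simple roots.  Thus `N` plays the
role of the Euclidean space on which the affine Weyl group acts (a Euclidean structure would only
be used to identify `M` with `N`); coroots, coweights and translations live in `N`, and the pairing
of a root with a point `x : N` is `P.root' i x`.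
-/

namespace LimitWeakOrder

open RootPairing

noncomputable section

variable {ι M N : Type*} [Fintype ι] [AddCommGroup M] [Module ℝ M] [AddCommGroup N] [Module ℝ N]
  {P : RootPairing ι ℝ M N}

/-! ### The finite Dynkin diagram -/

/-- The Dynkin diagram has `-⟨α_i, α_j^∨⟩` directed edges from `α_i` to `α_j`, for `i ≠ j`. -/
def numEdges [P.IsCrystallographic] (b : P.Base) (i j : b.support) : ℤ :=
  -b.cartanMatrix i j

/-- The simple graph underlying the Dynkin diagram. -/
def dynkinGraph [P.IsCrystallographic] (b : P.Base) : SimpleGraph b.support where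
  Adj i j := i ≠ j ∧ numEdges b i j ≠ 0
  symm := ⟨fun i j h ↦ ⟨h.1.symm, by
    have h2 := h.2
    simp only [numEdges, ne_eq, neg_eq_zero] at h2 ⊢
    rwa [b.cartanMatrix_apply_eq_zero_iff_symm]⟩⟩
  loopless := ⟨fun _ h ↦ h.1 rfl⟩

/-- The root system has type `A_n` for some `n`; equivalently, the associated affine Weyl group is
an affine symmetric group. -/
def IsTypeA [P.IsCrystallographic] (b : P.Base) : Prop :=
  ∃ (n : ℕ) (e : b.support ≃ Fin n), ∀ i j, b.cartanMatrix i j = CartanMatrix.A n (e i) (e j)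

/-- Two nodes are joined by a multiple edge. -/
def IsMultipleEdge [P.IsCrystallographic] (b : P.Base) (i j : b.support) : Prop :=
  i ≠ j ∧ (1 < numEdges b i j ∨ 1 < numEdges b j i)

/-- The heavy node: the node with three neighbours, or the endpoint of the multiple edge whose root
is the longer one.  Lengths are taken for the canonical Weyl-invariant inner product; for an
irreducible system every Weyl-invariant inner product is a positive multiple of it. -/
def IsHeavyNode [P.IsCrystallographic] (b : P.Base) (i : b.support) : Prop :=
  ((dynkinGraph b).neighborSet i).ncard = 3 ∨
    ∃ j : b.support, IsMultipleEdge b i j ∧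
      P.RootForm (P.root j) (P.root j) < P.RootForm (P.root i) (P.root i)

/-! ### The highest root -/

theorem exists_forall_height_le [P.IsRootSystem] [P.IsIrreducible] (b : P.Base) :
    ∃ k : ι, ∀ j : ι, b.height j ≤ b.height k := by
  have : Nonempty ι := by
    by_contra h
    rw [not_nonempty_iff] at h
    have : Nontrivial M := IsIrreducible.nontrivial P
    have h1 := IsRootSystem.span_root_eq_top (P := P)
    rw [Set.range_eq_empty, Submodule.span_empty] at h1
    exact bot_ne_top h1
  exact Finite.exists_max b.height

/-- (The index of) the highest root `ξ`: the root of maximal height, unique as the system is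
irreducible. -/
def highestRoot [P.IsRootSystem] [P.IsIrreducible] (b : P.Base) : ι :=
  (exists_forall_height_le b).choose

theorem height_le_height_highestRoot [P.IsRootSystem] [P.IsIrreducible] (b : P.Base) (j : ι) :
    b.height j ≤ b.height (highestRoot b) :=
  (exists_forall_height_le b).choose_spec j

/-! ### Bipartitions of the Dynkin diagram and the elements `s_F`, `s_U` -/

/-- A bipartition `F ⊔ U` of the nodes of the Dynkin diagram. -/
structure Bipartition [P.IsCrystallographic] (b : P.Base) where
  F : Finset b.support
  U : Finset b.support
  disjoint : Disjoint F U
  cover : ∀ i, i ∈ F ∨ i ∈ U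
  indep_F : (dynkinGraph b).IsIndepSet (F : Set b.support)
  indep_U : (dynkinGraph b).IsIndepSet (U : Set b.support)

theorem commute_reflection [P.IsCrystallographic] (b : P.Base) (T : Finset b.support)
    (hT : (dynkinGraph b).IsIndepSet (T : Set b.support)) :
    (T : Set b.support).Pairwise
      (Function.onFun Commute fun i : b.support ↦ P.reflection (i : ι)) := by
  intro i hi j hj hij
  apply P.isOrthogonal_comm
  have key : ∀ i ∈ T, ∀ j ∈ T, i ≠ j → P.pairing i j = 0 := by
    intro i hi j hj hij
    have h := hT (Finset.mem_coe.2 hi) (Finset.mem_coe.2 hj) hij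
    simp only [dynkinGraph, numEdges, not_and, not_not, ne_eq, neg_eq_zero] at h
    exact b.cartanMatrix_apply_eq_zero_iff_pairing.1 (h hij)
  exact ⟨key i hi j hj hij, key j hj i hi hij.symm⟩

/-- The product of the pairwise commuting simple reflections `s_i`, `i ∈ T`, for a set `T` of
pairwise non-adjacent nodes, as a linear automorphism of the space of roots. -/
def reflectionProd [P.IsCrystallographic] (b : P.Base) (T : Finset b.support)
    (hT : (dynkinGraph b).IsIndepSet (T : Set b.support)) : M ≃ₗ[ℝ] M :=
  T.noncommProd (fun i : b.support ↦ P.reflection (i : ι)) (commute_reflection b T hT)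

/-- The element `s_F` of the Weyl group. -/
def Bipartition.sF [P.IsCrystallographic] {b : P.Base} (B : Bipartition b) : M ≃ₗ[ℝ] M :=
  reflectionProd b B.F B.indep_F

/-- The element `s_U` of the Weyl group. -/
def Bipartition.sU [P.IsCrystallographic] {b : P.Base} (B : Bipartition b) : M ≃ₗ[ℝ] M :=
  reflectionProd b B.U B.indep_U

/-- The alternating product `⋯ s_U s_F s_U s_F` with `m` factors, the rightmost one being `s_F`. -/
def Bipartition.alternatingProd [P.IsCrystallographic] {b : P.Base} (B : Bipartition b) :
    ℕ → (M ≃ₗ[ℝ] M)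
  | 0 => 1
  | m + 1 => (if Even m then B.sF else B.sU) * B.alternatingProd m

/-! ### Fundamental coweights -/

/-- The fundamental coweight `ω_i^∨`. -/
def fundamentalCoweight [P.IsRootSystem] (b : P.Base) (i : b.support) : N :=
  P.flip.toPerfPair.symm (b.toWeightBasis.coord i)

/-- The defining property `⟨α_j, ω_i^∨⟩ = δ_{ij}`. -/
theorem root'_fundamentalCoweight [P.IsRootSystem] [DecidableEq ι] (b : P.Base)
    (i j : b.support) :
    P.root' j (fundamentalCoweight b i) = if i = j then 1 else 0 := by
  have h : P.root' j (fundamentalCoweight b i) = b.toWeightBasis.coord i (P.root j) :=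
    P.toLinearMap.apply_toPerfPair_flip _ _
  rw [h, ← b.toWeightBasis_apply j, Module.Basis.coord_apply, Module.Basis.repr_self,
    Finsupp.single_apply]
  simp [eq_comm]

/-- The coroot lattice `Q^∨`. -/
def corootLattice (P : RootPairing ι ℝ M N) : AddSubgroup N :=
  AddSubgroup.closure (Set.range P.coroot)

theorem exists_smul_mem_corootLattice [P.IsRootSystem] [P.IsCrystallographic] (b : P.Base)
    (i : b.support) :
    ∃ k : ℕ, 0 < k ∧ k • fundamentalCoweight b i ∈ corootLattice P := by
  classical
  set A := b.cartanMatrix with hA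
  have hdet : A.det ≠ 0 :=
    Matrix.nondegenerate_iff_det_ne_zero.1 b.cartanMatrix_nondegenerate
  have hmem : A.det • fundamentalCoweight b i ∈ corootLattice P := by
    have : A.det • fundamentalCoweight b i = ∑ j : b.support, A.adjugate j i • P.coroot j := by
      apply P.flip.toPerfPair.injective
      apply b.toWeightBasis.ext
      intro k
      rw [b.toWeightBasis_apply]
      have h1 : ∀ x : N, P.flip.toPerfPair x (P.root k) = P.root' k x := fun x ↦ rfl
      rw [h1, h1, map_zsmul, map_sum, root'_fundamentalCoweight]
      have h2 := congr_fun (congr_fun A.mul_adjugate k) i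
      rw [Matrix.mul_apply] at h2
      have h3 : ∀ j : b.support, P.root' k (A.adjugate j i • P.coroot j)
          = ((A k j * A.adjugate j i : ℤ) : ℝ) := by
        intro j
        rw [map_zsmul, P.root'_coroot_eq_pairing, zsmul_eq_mul, mul_comm]
        have := b.algebraMap_cartanMatrixIn_apply ℤ k j
        simp only [algebraMap_int_eq, eq_intCast] at this
        rw [← this]
        push_cast
        rfl
      rw [Finset.sum_congr rfl fun j _ ↦ h3 j, ← Int.cast_sum, h2]
      by_cases hik : i = k
      · subst hik; simp
      · simp [hik, Ne.symm hik]
    rw [this]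
    exact sum_mem fun j _ ↦ zsmul_mem
      (AddSubgroup.subset_closure (Set.mem_range_self (f := P.coroot) (j : ι))) _
  refine ⟨A.det.natAbs, Int.natAbs_pos.2 hdet, ?_⟩
  rcases Int.natAbs_eq A.det with h | h
  · rw [h, natCast_zsmul] at hmem
    exact hmem
  · rw [h, neg_smul, natCast_zsmul, neg_mem_iff] at hmem
    exact hmem

open scoped Classical in
/-- `k_i`: the least positive integer with `k_i ω_i^∨ ∈ Q^∨`. -/
def coweightIndex [P.IsRootSystem] [P.IsCrystallographic] (b : P.Base) (i : b.support) : ℕ :=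
  Nat.find (exists_smul_mem_corootLattice b i)

/-! ### The affine Weyl group -/

/-- The finite Weyl group `W`, acting linearly on the space of coroots. -/
def finiteWeylGroup (P : RootPairing ι ℝ M N) : Subgroup (N ≃ₗ[ℝ] N) :=
  Subgroup.closure (Set.range P.coreflection)

/-- The nodes of the affine Dynkin diagram: `none` is the affine node `0`. -/
abbrev AffineNode (b : P.Base) : Type _ := Option b.support

/-- The simple affine reflections: `s_i` for `i` a finite node is the reflection
`x ↦ x - ⟨α_i, x⟩ α_i^∨`, and `s_0` is the reflection `x ↦ x - (⟨ξ, x⟩ - 1) ξ^∨` in the affine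
hyperplane `⟨ξ, x⟩ = 1`. -/
def simpleAffineReflection [P.IsRootSystem] [P.IsIrreducible] (b : P.Base) :
    AffineNode b → (N ≃ᵃ[ℝ] N)
  | some i => (P.coreflection i).toAffineEquiv
  | none => AffineEquiv.constVAdd ℝ N (P.coroot (highestRoot b)) *
      (P.coreflection (highestRoot b)).toAffineEquiv

/-- The affine Weyl group `W̃`. -/
def affineWeylGroup [P.IsRootSystem] [P.IsIrreducible] (b : P.Base) : Subgroup (N ≃ᵃ[ℝ] N) :=
  Subgroup.closure (Set.range (simpleAffineReflection b))

/-- The simple reflections as elements of the affine Weyl group. -/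
def simple [P.IsRootSystem] [P.IsIrreducible] (b : P.Base) (a : AffineNode b) :
    affineWeylGroup b :=
  ⟨simpleAffineReflection b a, Subgroup.subset_closure ⟨a, rfl⟩⟩

/-- The element `s_{i_1} ⋯ s_{i_k}` represented by a finite word. -/
def wordProd [P.IsRootSystem] [P.IsIrreducible] (b : P.Base) (l : List (AffineNode b)) :
    affineWeylGroup b :=
  (l.map (simple b)).prod

/-- A finite word is reduced if it is a shortest word for the element it represents. -/
def IsReducedWord [P.IsRootSystem] [P.IsIrreducible] (b : P.Base) (l : List (AffineNode b)) :
    Prop :=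
  ∀ l' : List (AffineNode b), wordProd b l' = wordProd b l → l.length ≤ l'.length

/-- Coxeter elements of the affine Weyl group: products of all the simple reflections, each taken
once, in some order. -/
def IsCoxeterElement [P.IsRootSystem] [P.IsIrreducible] (b : P.Base) (c : affineWeylGroup b) :
    Prop :=
  ∃ l : List (AffineNode b), l.Nodup ∧ (∀ a, a ∈ l) ∧ wordProd b l = c

/-! ### Infinite reduced words and limit elements -/

/-- The prefix of length `k` of an infinite word. -/
def wordPrefix {b : P.Base} (w : ℕ → AffineNode b) (k : ℕ) : List (AffineNode b) :=
  (List.range k).map w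

/-- Infinite reduced words: all finite prefixes are reduced. -/
def InfiniteReducedWord [P.IsRootSystem] [P.IsIrreducible] (b : P.Base) : Type _ :=
  {w : ℕ → AffineNode b // ∀ k, IsReducedWord b (wordPrefix w k)}

/-- The inversion set of an infinite reduced word `i_1 i_2 ⋯`, as a set of reflections: it consists
of the reflections `s_{i_1} ⋯ s_{i_{k-1}} s_{i_k} s_{i_{k-1}} ⋯ s_{i_1}`. -/
def inversionSet [P.IsRootSystem] [P.IsIrreducible] {b : P.Base} (w : InfiniteReducedWord b) :
    Set (affineWeylGroup b) :=
  Set.range fun k : ℕ ↦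
    wordProd b (wordPrefix w.1 k) * simple b (w.1 k) * (wordProd b (wordPrefix w.1 k))⁻¹

/-- Two infinite reduced words are equivalent if they have the same inversion set. -/
def wordSetoid [P.IsRootSystem] [P.IsIrreducible] (b : P.Base) :
    Setoid (InfiniteReducedWord b) :=
  Setoid.ker inversionSet

/-- Limit elements: equivalence classes of infinite reduced words. -/
def LimitElement [P.IsRootSystem] [P.IsIrreducible] (b : P.Base) : Type _ :=
  Quotient (wordSetoid b)

/-- The limit element `[w]` of an infinite reduced word. -/
def LimitElement.mk [P.IsRootSystem] [P.IsIrreducible] {b : P.Base} (w : InfiniteReducedWord b) :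
    LimitElement b :=
  Quotient.mk (wordSetoid b) w

/-- `L = [g^∞]`: `L` is the class of an infinite reduced word obtained by repeating indefinitely a
(necessarily non-empty) reduced word `l` of `g`. -/
def IsInfinitePower [P.IsRootSystem] [P.IsIrreducible] {b : P.Base} (g : affineWeylGroup b)
    (L : LimitElement b) : Prop :=
  ∃ (l : List (AffineNode b)) (w : InfiniteReducedWord b), IsReducedWord b l ∧ wordProd b l = g ∧
    (∀ m : ℕ, l[m % l.length]? = some (w.1 m)) ∧ LimitElement.mk w = L

/-- `α_i` is a Coxeter node: `[c^∞] = [t_{w k_i ω_i^∨}^∞]` for some Coxeter element `c` of the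
affine Weyl group and some element `w` of the finite Weyl group, where `t_λ` is the element acting
as the translation by `λ`. -/
def IsCoxeterNode [P.IsRootSystem] [P.IsCrystallographic] [P.IsIrreducible] (b : P.Base)
    (i : b.support) : Prop :=
  ∃ c : affineWeylGroup b, IsCoxeterElement b c ∧ ∃ w ∈ finiteWeylGroup P,
    ∃ t : affineWeylGroup b,
      (t : N ≃ᵃ[ℝ] N) =
        AffineEquiv.constVAdd ℝ N (w (coweightIndex b i • fundamentalCoweight b i)) ∧
      ∃ L : LimitElement b, IsInfinitePower c L ∧ IsInfinitePower t L

end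

end LimitWeakOrder

/-! ### Root coordinates, the highest root and its coroot. -/

namespace LimitWeakOrder

open RootPairing

noncomputable section

set_option linter.unusedSectionVars false

variable {ι M N : Type*} [AddCommGroup M] [Module ℝ M] [AddCommGroup N] [Module ℝ N]
  {P : RootPairing ι ℝ M N}

/-! ### Coordinates of roots and coroots with respect to a base -/

/-! Suppose an element of the affine Weyl group has a power equal to the translation by `μ`. If its
infinite power is reduced, the inversions are exactly the positive affine roots whose finite part is
negative on `μ` (`mem_range_stepRoot_iff`). So comparing `c^∞` with `t_λ^∞` amounts to comparing the
sets of roots negative on two vectors (`isInfinitePower_eq_iff`), and the question becomes: in which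
direction does a Coxeter element translate?

Outside type A the affine diagram is a tree, so all Coxeter elements are conjugate
(`IsCoxeterElement.isConj`) and one of them suffices. Let `z` be an alternating product with `z ξ =
α_i`. Conjugation by `z` fixes or inverts `s_F s_U`, so for a suitable order of the finite factors
it turns the Coxeter element `s_0 ⋯` into `x ↦ v x + α_i^∨`, where `v` is the product of all simple
reflections except `s_i`. If `v^n = 1`, the `n`-th power is the translation by the `v`-orbit sum of
`α_i^∨`. This sum is fixed by `v`, hence killed by every `α_k` with `k ≠ i`, and so is a multiple of
`ω_i^∨`; invariance of the form makes the multiple positive (`exists_orbit_sum_eq`,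
`exists_pow_coxeterElement`). Conjugates of positive multiples of different fundamental coweights
have different sign patterns (`eq_of_root'_neg_iff`), so `α_i` is the only Coxeter node. That some
`c^∞` is reduced follows from straightness: a bipartite Coxeter element moves a well-chosen point of
the alcove by a vector fixed by its linear part (`exists_straight_of_bipartition`).

Such a `z` exists because `s_U s_F` has finite order and no nonzero fixed vector. The orbit of `ξ`
therefore sums to zero and must meet a negative root, and a positive root made negative by `s_F` or
`s_U` is simple (`exists_alternatingProd_highestRoot_eq`).

The node so reached is heavy. The pairings of `s_F s_U β` and of `s_U s_F β` with `β^∨` are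
exchanged along the alternating orbit. If the affine node is attached by a simple edge, both equal 1
at `β = ξ`, while at `β = α_i` one of them is the weighted degree of `α_i` minus 2; so that degree
is 3. In the remaining case `ξ` pairs evenly with all coroots, which forces a multiple edge at `α_i`
(`isHeavyNode_of_alternatingProd`). Two heavy nodes would contradict positive definiteness
(`IsHeavyNode.unique`), so the three conditions single out the same node. -/

theorem exists_root_eq_sum (b : P.Base) (i : ι) :
    ∃ f : b.support → ℤ, P.root i = ∑ k, (f k : ℝ) • P.root k ∧
      ((∀ k, 0 ≤ f k) ∨ ∀ k, f k ≤ 0) ∧ b.height i = ∑ k, f k := by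
  obtain ⟨f, -, hf, h⟩ := b.exists_root_eq_sum_int i
  refine ⟨fun k ↦ f k, ?_, ?_, ?_⟩
  · rw [h, ← Finset.sum_coe_sort]
    exact Finset.sum_congr rfl fun k _ ↦ (Int.cast_smul_eq_zsmul ℝ _ _).symm
  · rcases hf with hf | hf
    · exact Or.inl fun k ↦ hf.le k
    · exact Or.inr fun k ↦ hf.le k
  · rw [Base.height_eq_sum h, ← Finset.sum_coe_sort]

theorem exists_coroot_eq_sum (b : P.Base) (i : ι) :
    ∃ f : b.support → ℤ, P.coroot i = ∑ k, (f k : ℝ) • P.coroot k ∧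
      ((∀ k, 0 ≤ f k) ∨ ∀ k, f k ≤ 0) := by
  obtain ⟨f, h, hf, -⟩ := exists_root_eq_sum b.flip i
  exact ⟨f, h, hf⟩

/-- The coefficients of a root in terms of the simple roots. -/
def rootCoeff (b : P.Base) (i : ι) : b.support → ℤ :=
  (exists_root_eq_sum b i).choose

theorem root_eq_sum (b : P.Base) (i : ι) :
    P.root i = ∑ k, (rootCoeff b i k : ℝ) • P.root k :=
  (exists_root_eq_sum b i).choose_spec.1

theorem rootCoeff_nonneg_or_nonpos (b : P.Base) (i : ι) :
    (∀ k, 0 ≤ rootCoeff b i k) ∨ ∀ k, rootCoeff b i k ≤ 0 :=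
  (exists_root_eq_sum b i).choose_spec.2.1

theorem height_eq_sum_rootCoeff (b : P.Base) (i : ι) :
    b.height i = ∑ k, rootCoeff b i k :=
  (exists_root_eq_sum b i).choose_spec.2.2

theorem rootCoeff_nonneg {b : P.Base} {i : ι} (h : b.IsPos i) (k : b.support) :
    0 ≤ rootCoeff b i k := by
  rcases rootCoeff_nonneg_or_nonpos b i with h' | h'
  · exact h' k
  · have : b.height i ≤ 0 := by
      rw [height_eq_sum_rootCoeff]
      exact Finset.sum_nonpos fun k _ ↦ h' k
    exact absurd h (by rw [Base.isPos_iff]; lia)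

theorem rootCoeff_nonpos {b : P.Base} {i : ι} (h : ¬ b.IsPos i) (k : b.support) :
    rootCoeff b i k ≤ 0 := by
  rcases rootCoeff_nonneg_or_nonpos b i with h' | h'
  · have : 0 ≤ b.height i := by
      rw [height_eq_sum_rootCoeff]
      exact Finset.sum_nonneg fun k _ ↦ h' k
    exact absurd (Base.isPos_iff' b |>.2 this) h
  · exact h' k

theorem pairing_eq_sum_rootCoeff (b : P.Base) (i j : ι) :
    P.pairing i j = ∑ k, (rootCoeff b i k : ℝ) * P.pairing k j := by
  rw [← P.root_coroot_eq_pairing, root_eq_sum b i]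
  simp

variable [P.IsRootSystem]

theorem rootCoeff_unique (b : P.Base) (i : ι) (f : b.support → ℝ)
    (h : P.root i = ∑ k, f k • P.root k) (k : b.support) : (rootCoeff b i k : ℝ) = f k := by
  have h1 : ∀ g : b.support → ℝ, P.root i = ∑ k, g k • P.root k →
      b.toWeightBasis.repr (P.root i) k = g k := by
    intro g hg
    have h2 : P.root i = ∑ k, g k • b.toWeightBasis k := by simpa using hg
    rw [h2, Module.Basis.repr_sum_self]
  rw [← h1 f h, h1 _ (root_eq_sum b i)]

theorem rootCoeff_of_root_eq_add {b : P.Base} {i j l : ι} {z : ℝ}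
    (h : P.root l = P.root i + z • P.root j) (k : b.support) :
    (rootCoeff b l k : ℝ) = rootCoeff b i k + z * rootCoeff b j k := by
  apply rootCoeff_unique
  rw [h]
  simp only [add_smul, Finset.sum_add_distrib, mul_smul, ← Finset.smul_sum, ← root_eq_sum]

theorem rootCoeff_simple (b : P.Base) [DecidableEq b.support] (k l : b.support) :
    rootCoeff b k l = if k = l then 1 else 0 := by
  have := rootCoeff_unique b k (fun l ↦ if k = l then 1 else 0) (by simp) l
  split_ifs at this ⊢ <;> exact_mod_cast this

theorem eq_of_rootCoeff_eq {b : P.Base} {i j : ι} (h : ∀ k, rootCoeff b i k = rootCoeff b j k) :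
    i = j := by
  apply P.root.injective
  rw [root_eq_sum b i, root_eq_sum b j]
  simp [h]

theorem rootCoeff_neg {b : P.Base} {i j : ι} (h : P.root j = - P.root i) (k : b.support) :
    rootCoeff b j k = - rootCoeff b i k := by
  have := rootCoeff_unique b j (fun k ↦ - rootCoeff b i k)
    (by rw [h, root_eq_sum b i]; simp) k
  exact_mod_cast this

theorem exists_rootCoeff_ne_zero (b : P.Base) (i : ι) : ∃ k, rootCoeff b i k ≠ 0 := by
  by_contra! h
  apply P.ne_zero i
  rw [root_eq_sum b i]
  simp [h]

/-! ### Signs of pairings -/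

variable [Fintype ι] [P.IsCrystallographic]

theorem exists_pairing_eq_int (i j : ι) : ∃ z : ℤ, P.pairing i j = z :=
  ⟨P.pairingIn ℤ i j, (P.algebraMap_pairingIn ℤ i j).symm⟩

theorem pairing_pos_symm {i j : ι} (h : 0 < P.pairing i j) : 0 < P.pairing j i := by
  have h1 := P.zero_lt_pairingIn_iff' ℤ (i := i) (j := j)
  rw [← P.algebraMap_pairingIn ℤ] at h ⊢
  simp only [algebraMap_int_eq, eq_intCast, Int.cast_pos] at h ⊢
  exact h1.1 h

theorem pairing_nonneg_symm {i j : ι} (h : 0 ≤ P.pairing i j) : 0 ≤ P.pairing j i := by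
  by_contra! h'
  have h1 := P.pairingIn_lt_zero_iff ℤ (i := i) (j := j)
  rw [← P.algebraMap_pairingIn ℤ] at h h'
  simp only [algebraMap_int_eq, eq_intCast, Int.cast_nonneg_iff, Int.cast_lt_zero] at h h'
  lia

theorem pairing_zero_symm {i j : ι} (h : P.pairing i j = 0) : P.pairing j i = 0 :=
  P.pairing_eq_zero_iff'.1 h

theorem cartanMatrix_cast (b : P.Base) (k l : b.support) :
    (b.cartanMatrix k l : ℝ) = P.pairing k l := by
  have := b.algebraMap_cartanMatrixIn_apply ℤ k l
  simpa using this

theorem pairing_nonpos (b : P.Base) {k l : b.support} (h : k ≠ l) : P.pairing k l ≤ 0 := by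
  rw [← cartanMatrix_cast]
  exact_mod_cast b.cartanMatrix_le_zero_of_ne k l h

theorem dynkinGraph_adj (b : P.Base) {k l : b.support} :
    (dynkinGraph b).Adj k l ↔ k ≠ l ∧ P.pairing k l ≠ 0 := by
  simp only [dynkinGraph, numEdges, ne_eq, neg_eq_zero]
  rw [b.cartanMatrix_apply_eq_zero_iff_pairing]

theorem pairing_le_neg_one (b : P.Base) {k l : b.support} (h : (dynkinGraph b).Adj k l) :
    P.pairing k l ≤ -1 := by
  rw [dynkinGraph_adj] at h
  have h1 := pairing_nonpos b h.1
  have h2 := h.2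
  rw [← cartanMatrix_cast] at h1 h2 ⊢
  have h3 : b.cartanMatrix k l ≤ 0 := by exact_mod_cast h1
  have h4 : b.cartanMatrix k l ≠ 0 := by exact_mod_cast h2
  have : b.cartanMatrix k l ≤ -1 := by lia
  exact_mod_cast this

variable [P.IsReduced] [P.IsIrreducible]

/-- Connectedness of the Dynkin diagram. -/
theorem dynkinGraph_induction (b : P.Base) (p : b.support → Prop) {i : b.support} (hi : p i)
    (hp : ∀ k l, p k → (dynkinGraph b).Adj k l → p l) (j : b.support) : p j := by
  apply b.induction_on_cartanMatrix p hi
  intro k l hk hl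
  by_cases h : k = l
  · exact h ▸ hk
  · refine hp k l hk ?_
    rw [dynkinGraph_adj]
    refine ⟨h, fun hlk ↦ hl ?_⟩
    rw [b.cartanMatrix_apply_eq_zero_iff_pairing]
    exact pairing_zero_symm hlk

/-! ### The highest root -/

theorem support_nonempty' (b : P.Base) : Nonempty b.support := by
  have : Nonempty ι := ⟨highestRoot b⟩
  obtain ⟨k, hk⟩ := b.support_nonempty
  exact ⟨⟨k, hk⟩⟩

theorem isPos_highestRoot (b : P.Base) : b.IsPos (highestRoot b) := by
  obtain ⟨k⟩ := support_nonempty' b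
  have := height_le_height_highestRoot b k
  rw [Base.height_one_of_mem_support k.2] at this
  rw [Base.isPos_iff]
  lia

/-- The reflection adds a positive multiple of `α_k`. Consequently roots that are maximal, for
height or coefficientwise, are dominant. -/
theorem height_le_of_pairing_neg (b : P.Base) {i : ι} {k : b.support} (h : P.pairing i k < 0) :
    b.height i < b.height (P.reflectionPerm k i) ∧
      ∀ l, rootCoeff b i l ≤ rootCoeff b (P.reflectionPerm k i) l := by
  classical
  have h1 : P.root (P.reflectionPerm k i) = P.root i + (-P.pairing i k) • P.root k := by
    rw [P.root_reflectionPerm, P.reflection_apply_root, neg_smul, sub_eq_add_neg]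
  have h2 := fun l ↦ rootCoeff_of_root_eq_add (b := b) h1 l
  have h3 : ∀ l, rootCoeff b i l ≤ rootCoeff b (P.reflectionPerm k i) l := by
    intro l
    have := h2 l
    rw [rootCoeff_simple] at this
    have h4 : (rootCoeff b i l : ℝ) ≤ rootCoeff b (P.reflectionPerm k i) l := by
      rw [this]
      split_ifs <;> simp [h.le]
    exact_mod_cast h4
  refine ⟨?_, h3⟩
  rw [height_eq_sum_rootCoeff, height_eq_sum_rootCoeff]
  refine Finset.sum_lt_sum (fun l _ ↦ h3 l) ⟨k, Finset.mem_univ _, ?_⟩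
  have := h2 k
  rw [rootCoeff_simple] at this
  have h4 : (rootCoeff b i k : ℝ) < rootCoeff b (P.reflectionPerm k i) k := by
    rw [this]
    simp [h]
  exact_mod_cast h4

theorem pairing_highestRoot_nonneg (b : P.Base) (k : b.support) :
    0 ≤ P.pairing (highestRoot b) k := by
  by_contra! h
  have := (height_le_of_pairing_neg b h).1
  have := height_le_height_highestRoot b (P.reflectionPerm k (highestRoot b))
  lia

theorem pairing_highestRoot_nonneg' (b : P.Base) (k : b.support) :
    0 ≤ P.pairing k (highestRoot b) :=
  pairing_nonneg_symm (pairing_highestRoot_nonneg b k)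

/-- A nonzero nonnegative function on the nodes which is superharmonic for the (transposed) Cartan
matrix is positive. -/
theorem pos_of_superharmonic (b : P.Base) (a : b.support → b.support → ℝ) (f : b.support → ℝ)
    (ha : ∀ k l, k ≠ l → a k l ≤ 0) (ha' : ∀ k l, (dynkinGraph b).Adj k l → a k l < 0)
    (h0 : ∀ k, 0 ≤ f k) (h : ∀ k, 0 ≤ ∑ l, f l * a k l) (hf : ∃ k, f k ≠ 0) (k : b.support) :
    0 < f k := by
  classical
  by_contra! hk
  obtain ⟨l, hl⟩ := hf
  apply hl
  -- The zero set is closed under adjacency: at a zero every term of the sum is nonpositive while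
  -- the sum is nonnegative, so each term vanishes.
  refine dynkinGraph_induction b (fun k ↦ f k = 0) (le_antisymm hk (h0 k)) ?_ l
  intro k l hk hkl
  have h1 := h k
  have h2 : ∀ l ∈ Finset.univ, f l * a k l ≤ 0 := by
    intro l _
    by_cases hlk : k = l
    · rw [← hlk, hk, zero_mul]
    · exact mul_nonpos_of_nonneg_of_nonpos (h0 l) (ha k l hlk)
  have h3 := (Finset.sum_eq_zero_iff_of_nonpos h2).1
    (le_antisymm (Finset.sum_nonpos h2) h1) l (Finset.mem_univ _)
  rcases mul_eq_zero.1 h3 with h4 | h4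
  · exact h4
  · exact absurd h4 (ha' k l hkl).ne

theorem rootCoeff_highestRoot_pos (b : P.Base) (k : b.support) :
    0 < rootCoeff b (highestRoot b) k := by
  have := pos_of_superharmonic b (fun k l ↦ P.pairing l k)
    (fun k ↦ (rootCoeff b (highestRoot b) k : ℝ))
    (fun k l h ↦ pairing_nonpos b (Ne.symm h))
    (fun k l h ↦ by linarith [pairing_le_neg_one b h.symm])
    (fun k ↦ by exact_mod_cast rootCoeff_nonneg (isPos_highestRoot b) k)
    (fun k ↦ by rw [← pairing_eq_sum_rootCoeff]; exact pairing_highestRoot_nonneg b k)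
    (by obtain ⟨k, hk⟩ := exists_rootCoeff_ne_zero b (highestRoot b)
        exact ⟨k, by exact_mod_cast hk⟩) k
  exact_mod_cast this

/-- Among the roots dominating the given one coefficientwise, one of maximal height is dominant. If
it differed from `ξ`, two dominant roots would pair positively and their difference would be a root;
either sign of that root contradicts one of the two maximalities. -/
theorem rootCoeff_le_highestRoot (b : P.Base) (i : ι) (k : b.support) :
    rootCoeff b i k ≤ rootCoeff b (highestRoot b) k := by
  classical
  obtain ⟨j, hj, hmax⟩ := Finset.exists_max_image
    (Finset.univ.filter fun j ↦ ∀ k, rootCoeff b i k ≤ rootCoeff b j k) b.height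
    ⟨i, by simp⟩
  simp only [Finset.mem_filter, Finset.mem_univ, true_and] at hj hmax
  have hdom : ∀ k : b.support, 0 ≤ P.pairing j k := by
    intro k
    by_contra! h
    have := height_le_of_pairing_neg b h
    have := hmax (P.reflectionPerm k j) fun l ↦ (hj l).trans (this.2 l)
    lia
  by_cases heq : highestRoot b = j
  · rw [heq]; exact hj k
  exfalso
  have hpos : 0 < P.pairing (highestRoot b) j := by
    rw [pairing_eq_sum_rootCoeff b]
    have h1 : ∀ k ∈ Finset.univ, 0 ≤ (rootCoeff b (highestRoot b) k : ℝ) * P.pairing k j :=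
      fun k _ ↦ mul_nonneg (by exact_mod_cast (rootCoeff_highestRoot_pos b k).le)
        (pairing_nonneg_symm (hdom k))
    refine lt_of_le_of_ne (Finset.sum_nonneg h1) fun h ↦ ?_
    have h2 := (Finset.sum_eq_zero_iff_of_nonneg h1).1 h.symm
    have h3 : ∀ k : b.support, P.pairing k j = 0 := fun k ↦
      (mul_eq_zero.1 (h2 k (Finset.mem_univ _))).resolve_left
        (by exact_mod_cast (rootCoeff_highestRoot_pos b k).ne')
    have h4 := pairing_eq_sum_rootCoeff b j j
    simp [h3] at h4
  rw [← P.algebraMap_pairingIn ℤ] at hpos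
  obtain ⟨l, hl⟩ := P.root_sub_root_mem_of_pairingIn_pos (by simpa using hpos) heq
  have hht := b.height_sub hl
  by_cases hlp : b.IsPos l
  · have h5 : P.root (highestRoot b) = P.root j + (1 : ℝ) • P.root l := by rw [hl]; module
    have h6 : ∀ k, rootCoeff b j k ≤ rootCoeff b (highestRoot b) k := by
      intro k
      have h7 := rootCoeff_of_root_eq_add (b := b) h5 k
      have h8 := rootCoeff_nonneg hlp k
      have : rootCoeff b (highestRoot b) k = rootCoeff b j k + rootCoeff b l k := by
        have : (rootCoeff b (highestRoot b) k : ℝ) = rootCoeff b j k + rootCoeff b l k := by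
          rw [h7, one_mul]
        exact_mod_cast this
      lia
    have := hmax (highestRoot b) fun k ↦ (hj k).trans (h6 k)
    rw [Base.isPos_iff] at hlp
    lia
  · rw [Base.isPos_iff'] at hlp
    have := height_le_height_highestRoot b j
    lia

theorem neg_highestRoot_le_rootCoeff (b : P.Base) (i : ι) (k : b.support) :
    -rootCoeff b (highestRoot b) k ≤ rootCoeff b i k := by
  have h1 : P.root (P.reflectionPerm i i) = - P.root i := by
    rw [P.root_reflectionPerm, P.reflection_apply_self]
  have h2 := rootCoeff_neg (b := b) h1 k
  have h3 := rootCoeff_le_highestRoot b (P.reflectionPerm i i) k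
  lia

/-- If the pairing is `z ≥ 2`, the reflected root has coefficients `i_k - z ξ_k ≥ -ξ_k`, so `i_k ≥
ξ_k` for all `k`, and maximality of `ξ` gives equality. -/
theorem pairing_highestRoot_le_one (b : P.Base) {i : ι} (h : i ≠ highestRoot b) :
    P.pairing i (highestRoot b) ≤ 1 := by
  by_contra! h1
  obtain ⟨z, hz⟩ := exists_pairing_eq_int (P := P) i (highestRoot b)
  rw [hz] at h1
  have h2 : 2 ≤ z := by
    have : 1 < z := by exact_mod_cast h1
    lia
  apply h
  apply eq_of_rootCoeff_eq (b := b)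
  intro k
  have h3 : P.root (P.reflectionPerm (highestRoot b) i)
      = P.root i + (-z : ℝ) • P.root (highestRoot b) := by
    rw [P.root_reflectionPerm, P.reflection_apply_root, neg_smul, sub_eq_add_neg, hz]
  have h4 := rootCoeff_of_root_eq_add (b := b) h3 k
  have h5 : rootCoeff b (P.reflectionPerm (highestRoot b) i) k
      = rootCoeff b i k - z * rootCoeff b (highestRoot b) k := by
    have : (rootCoeff b (P.reflectionPerm (highestRoot b) i) k : ℝ)
      = rootCoeff b i k - z * rootCoeff b (highestRoot b) k := by rw [h4]; ring
    exact_mod_cast this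
  have h6 := neg_highestRoot_le_rootCoeff b (P.reflectionPerm (highestRoot b) i) k
  have h7 := rootCoeff_le_highestRoot b i k
  have h8 := rootCoeff_highestRoot_pos b k
  nlinarith

theorem neg_one_le_pairing_highestRoot (b : P.Base) {i : ι}
    (h : P.root i ≠ - P.root (highestRoot b)) : -1 ≤ P.pairing i (highestRoot b) := by
  have h1 : P.root (P.reflectionPerm i i) = - P.root i := by
    rw [P.root_reflectionPerm, P.reflection_apply_self]
  have h2 := pairing_highestRoot_le_one b (i := P.reflectionPerm i i) (by
    intro h2
    rw [h2] at h1
    exact h (by rw [h1, neg_neg]))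
  rw [← P.root_coroot_eq_pairing, h1] at h2
  simp at h2
  linarith

/-! ### The coefficients of the highest coroot -/

/-- The coefficients of the coroot of the highest root in terms of the simple coroots. -/
def comark (b : P.Base) : b.support → ℤ :=
  (exists_coroot_eq_sum b (highestRoot b)).choose

theorem coroot_highestRoot_eq_sum (b : P.Base) :
    P.coroot (highestRoot b) = ∑ k, (comark b k : ℝ) • P.coroot k :=
  (exists_coroot_eq_sum b (highestRoot b)).choose_spec.1

theorem pairing_highestRoot_eq_sum (b : P.Base) (i : ι) :
    P.pairing i (highestRoot b) = ∑ k, (comark b k : ℝ) * P.pairing i k := by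
  rw [← P.root_coroot_eq_pairing, coroot_highestRoot_eq_sum b]
  simp

/-- Dominance of `ξ` makes the comarks superharmonic; the nonpositive sign is excluded because they
average the nonnegative `⟨ξ, α_k^∨⟩` to `⟨ξ, ξ^∨⟩ = 2`. -/
theorem comark_pos (b : P.Base) (k : b.support) : 0 < comark b k := by
  have h2 := pairing_highestRoot_eq_sum b (highestRoot b)
  rw [P.pairing_same] at h2
  have h3 : ∀ k, 0 ≤ comark b k := by
    rcases (exists_coroot_eq_sum b (highestRoot b)).choose_spec.2 with h | h
    · exact h
    · exfalso
      have : ∑ k, (comark b k : ℝ) * P.pairing (highestRoot b) k ≤ 0 :=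
        Finset.sum_nonpos fun k _ ↦ mul_nonpos_of_nonpos_of_nonneg (by exact_mod_cast h k)
          (pairing_highestRoot_nonneg b k)
      linarith
  have := pos_of_superharmonic b (fun k l ↦ P.pairing k l)
    (fun k ↦ (comark b k : ℝ))
    (fun k l h ↦ pairing_nonpos b h)
    (fun k l h ↦ by linarith [pairing_le_neg_one b h])
    (fun k ↦ by exact_mod_cast h3 k)
    (fun k ↦ by rw [← pairing_highestRoot_eq_sum]; exact pairing_highestRoot_nonneg' b k)
    (by by_contra! h
        simp [h] at h2) k
  exact_mod_cast this

/-! ### The invariant form on the coroot space -/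

theorem corootForm_pos {x : N} (h : x ≠ 0) : 0 < P.CorootForm x x :=
  P.flip.rootForm_pos_of_ne_zero (x := x) (by simp) h

theorem corootForm_coreflection (i : ι) (x y : N) :
    P.CorootForm (P.coreflection i x) (P.coreflection i y) = P.CorootForm x y :=
  P.flip.rootForm_reflection_reflection_apply i x y

theorem two_mul_corootForm_coroot (i : ι) (x : N) :
    2 * P.CorootForm (P.coroot i) x =
      P.root' i x * P.CorootForm (P.coroot i) (P.coroot i) := by
  have h := corootForm_coreflection (P := P) i (P.coroot i) x
  rw [P.coreflection_apply_self, P.coreflection_apply, map_neg, LinearMap.neg_apply, map_sub,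
    map_smul, smul_eq_mul] at h
  linarith

end

end LimitWeakOrder

/-! ### Shape of the Dynkin diagram: forests, type A, heavy nodes. -/

namespace LimitWeakOrder

open RootPairing

noncomputable section

set_option linter.unusedSectionVars false

variable {ι M N : Type*} [AddCommGroup M] [Module ℝ M] [AddCommGroup N] [Module ℝ N]
  {P : RootPairing ι ℝ M N} [P.IsRootSystem] [Fintype ι] [P.IsCrystallographic]

/-! ### The Dynkin diagram is a forest -/

theorem sum_mul_pairing_le (b : P.Base) (u : b.support → ℝ) (hu : ∀ k, 0 ≤ u k) (k : b.support)
    (T : Finset b.support) (hT : k ∉ T) :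
    ∑ l, u l * P.pairing k l ≤ 2 * u k + ∑ l ∈ T, u l * P.pairing k l := by
  classical
  have h1 : 2 * u k + ∑ l ∈ T, u l * P.pairing k l
      = ∑ l ∈ insert k T, u l * P.pairing k l := by
    rw [Finset.sum_insert hT, P.pairing_same]
    ring
  rw [h1, ← Finset.sum_add_sum_compl (insert k T)]
  have : ∑ l ∈ (insert k T)ᶜ, u l * P.pairing k l ≤ 0 := by
    refine Finset.sum_nonpos fun l hl ↦ mul_nonpos_of_nonneg_of_nonpos (hu l) (pairing_nonpos b ?_)
    rintro rfl
    simp at hl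
  linarith

variable [P.IsReduced] [P.IsIrreducible]

/-- The main tool for bounding degrees. The left side is nonnegative for every node, so twice a
comark is at least the sum of the neighbouring comarks. -/
theorem pairing_highestRoot_le (b : P.Base) (k : b.support) (T : Finset b.support)
    (hT : ∀ l ∈ T, (dynkinGraph b).Adj k l) :
    P.pairing k (highestRoot b) ≤ 2 * comark b k - ∑ l ∈ T, (comark b l : ℝ) := by
  rw [pairing_highestRoot_eq_sum]
  refine (sum_mul_pairing_le b (fun l ↦ (comark b l : ℝ))
    (fun l ↦ by exact_mod_cast (comark_pos b l).le) k T fun h ↦ (hT k h).ne rfl).trans ?_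
  rw [sub_eq_add_neg, ← Finset.sum_neg_distrib]
  refine add_le_add_right (Finset.sum_le_sum fun l hl ↦ ?_) _
  have h1 := pairing_le_neg_one b (hT l hl)
  have h2 : (0 : ℝ) < comark b l := by exact_mod_cast comark_pos b l
  nlinarith

/-- Suppose every node of `S` has two neighbours in `S`. At a node with minimal comark these have
the same comark and there is no third neighbour, so by connectedness `S` is everything and the
comarks are constant. Then `ξ^∨` is nonpositive on all simple roots, against `⟨ξ, ξ^∨⟩ = 2`. -/
theorem exists_leaf (b : P.Base) (S : Finset b.support) (hS : S.Nonempty) :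
    ∃ v ∈ S, ∃ u, ∀ x ∈ S, (dynkinGraph b).Adj v x → x = u := by
  classical
  by_contra! h
  obtain ⟨v, hv, hmin⟩ := S.exists_min_image (comark b) hS
  have h2 : ∀ k ∈ S, ∃ x ∈ S, ∃ y ∈ S, x ≠ y ∧ (dynkinGraph b).Adj k x ∧
      (dynkinGraph b).Adj k y := by
    intro k hk
    -- Excluding `k` itself excludes nothing and yields a first neighbour; excluding that one yields
    -- a second.
    obtain ⟨x, hx, hkx, -⟩ := h k hk k
    obtain ⟨y, hy, hky, hne⟩ := h k hk x
    exact ⟨x, hx, y, hy, hne.symm, hkx, hky⟩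
  have hall : ∀ k, k ∈ S ∧ comark b k = comark b v := by
    refine dynkinGraph_induction b _ (i := v) ⟨hv, rfl⟩ ?_
    rintro k l ⟨hk, hkv⟩ hkl
    obtain ⟨x, hx, y, hy, hxy, hkx, hky⟩ := h2 k hk
    have h0 := pairing_highestRoot_nonneg' b k
    have hx' := hmin x hx
    have hy' := hmin y hy
    have h3 := pairing_highestRoot_le b k {x, y} (by simp [hkx, hky])
    rw [Finset.sum_pair hxy] at h3
    have h4 : comark b x + comark b y ≤ 2 * comark b k := by
      have : (comark b x + comark b y : ℝ) ≤ 2 * comark b k := by linarith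
      exact_mod_cast this
    by_cases hlx : l = x
    · subst hlx; exact ⟨hx, by lia⟩
    by_cases hly : l = y
    · subst hly; exact ⟨hy, by lia⟩
    exfalso
    have h5 := pairing_highestRoot_le b k {l, x, y} (by simp [hkx, hky, hkl])
    rw [Finset.sum_insert (by simp [hlx, hly]), Finset.sum_pair hxy] at h5
    have h6 : comark b l + (comark b x + comark b y) ≤ 2 * comark b k := by
      have : (comark b l + (comark b x + comark b y) : ℝ) ≤ 2 * comark b k := by linarith
      exact_mod_cast this
    have := comark_pos b l
    lia
  have hz : ∀ k : b.support, P.pairing k (highestRoot b) ≤ 0 := by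
    intro k
    obtain ⟨x, hx, y, hy, hxy, hkx, hky⟩ := h2 k (hall k).1
    have h3 := pairing_highestRoot_le b k {x, y} (by simp [hkx, hky])
    rw [Finset.sum_pair hxy, (hall x).2, (hall y).2, (hall k).2] at h3
    linarith
  have h7 := pairing_eq_sum_rootCoeff b (highestRoot b) (highestRoot b)
  rw [P.pairing_same] at h7
  have : ∑ k, (rootCoeff b (highestRoot b) k : ℝ) * P.pairing k (highestRoot b) ≤ 0 :=
    Finset.sum_nonpos fun k _ ↦ mul_nonpos_of_nonneg_of_nonpos
      (by exact_mod_cast (rootCoeff_highestRoot_pos b k).le) (hz k)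
  linarith

/-- Remove a leaf, colour the rest, and give the leaf the colour opposite to that of its only
possible neighbour. -/
theorem exists_two_coloring (b : P.Base) :
    ∃ col : b.support → Bool, ∀ k l, (dynkinGraph b).Adj k l → col k ≠ col l := by
  classical
  suffices h : ∀ (n : ℕ) (S : Finset b.support), S.card = n →
      ∃ col : b.support → Bool, ∀ k ∈ S, ∀ l ∈ S, (dynkinGraph b).Adj k l → col k ≠ col l by
    obtain ⟨col, hcol⟩ := h _ Finset.univ rfl
    exact ⟨col, fun k l ↦ hcol k (Finset.mem_univ _) l (Finset.mem_univ _)⟩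
  intro n
  induction n with
  | zero =>
    intro S hS
    rw [Finset.card_eq_zero] at hS
    subst hS
    exact ⟨fun _ ↦ true, by simp⟩
  | succ n ih =>
    intro S hS
    obtain ⟨v, hv, u, hu⟩ := exists_leaf b S (Finset.card_pos.1 (by lia))
    obtain ⟨col, hcol⟩ := ih (S.erase v) (by rw [Finset.card_erase_of_mem hv]; lia)
    refine ⟨Function.update col v (!col u), fun k hk l hl hkl ↦ ?_⟩
    by_cases hkv : k = v
    · subst hkv
      have hlk : l ≠ k := hkl.ne'
      obtain rfl := hu l hl hkl
      simp [Function.update_of_ne hlk]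
    by_cases hlv : l = v
    · subst hlv
      obtain rfl := hu k hk hkl.symm
      simp [Function.update_of_ne hkv]
    · rw [Function.update_of_ne hkv, Function.update_of_ne hlv]
      exact hcol k (by simp [hkv, hk]) l (by simp [hlv, hl]) hkl

theorem nonempty_bipartition (b : P.Base) : Nonempty (Bipartition b) := by
  classical
  obtain ⟨col, hcol⟩ := exists_two_coloring b
  exact ⟨{
    F := Finset.univ.filter fun k ↦ col k = true
    U := Finset.univ.filter fun k ↦ col k = false
    disjoint := by
      rw [Finset.disjoint_filter]
      intro k _ h
      simp [h]
    cover := fun k ↦ by cases h : col k <;> simp [h]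
    indep_F := by
      intro k hk l hl _ h
      simp only [Finset.coe_filter, Finset.mem_univ, true_and, Set.mem_ofPred_eq] at hk hl
      exact hcol k l h (hk.trans hl.symm)
    indep_U := by
      intro k hk l hl _ h
      simp only [Finset.coe_filter, Finset.mem_univ, true_and, Set.mem_ofPred_eq] at hk hl
      exact hcol k l h (hk.trans hl.symm) }⟩

/-! ### Recognizing type `A` -/

theorem isTypeA_of_forall_not_adj (b : P.Base) (k : b.support)
    (h : ∀ l, ¬ (dynkinGraph b).Adj k l) : IsTypeA b := by
  have h1 : ∀ l, l = k := dynkinGraph_induction b (· = k) rfl fun x y hx hxy ↦ by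
    subst hx; exact absurd hxy (h y)
  have : Unique b.support := ⟨⟨k⟩, h1⟩
  refine ⟨1, Equiv.ofUnique _ _, fun i j ↦ ?_⟩
  rw [h1 i, h1 j, b.cartanMatrix_apply_same]
  simp [CartanMatrix.A]

theorem one_le_pairing_of_pos {i j : ι} (h : 0 < P.pairing i j) : 1 ≤ P.pairing i j := by
  obtain ⟨z, hz⟩ := exists_pairing_eq_int (P := P) i j
  rw [hz] at h ⊢
  have : 0 < z := by exact_mod_cast h
  exact_mod_cast this

theorem pairing_le_neg_two_or_eq (b : P.Base) {k l : b.support} (h : (dynkinGraph b).Adj k l) :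
    P.pairing k l ≤ -2 ∨ P.pairing k l = -1 := by
  have h1 := pairing_le_neg_one b h
  rw [← cartanMatrix_cast] at h1 ⊢
  have h2 : b.cartanMatrix k l ≤ -1 := by exact_mod_cast h1
  have h3 : b.cartanMatrix k l ≤ -2 ∨ b.cartanMatrix k l = -1 := by lia
  rcases h3 with h3 | h3
  · left; exact_mod_cast h3
  · right; exact_mod_cast h3

/-- A connected graph in which all degrees are at most two and some node `k` has degree at most
one is a path starting at `k`. -/
theorem exists_list_of_degree_le_two {V : Type*} [Fintype V] (G : SimpleGraph V) (k : V)
    (hconn : ∀ p : V → Prop, p k → (∀ x y, p x → G.Adj x y → p y) → ∀ y, p y)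
    (hk : ∀ x y, G.Adj k x → G.Adj k y → x = y)
    (h2 : ∀ v x y z, G.Adj v x → G.Adj v y → G.Adj v z → x = y ∨ y = z ∨ x = z) :
    ∃ l : List V, ∃ h0 : 0 < l.length, l[0] = k ∧ l.Nodup ∧ (∀ v, v ∈ l) ∧
      ∀ (i j : ℕ) (hi : i < l.length) (hj : j < l.length), i < j →
        (G.Adj l[i] l[j] ↔ i + 1 = j) := by
  classical
  let Q : List V → Prop := fun l ↦ ∃ h0 : 0 < l.length, l[0] = k ∧ l.Nodup ∧
    ∀ i (hi : i + 1 < l.length), G.Adj l[i] l[i + 1]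
  have hex : ∃ n, ∃ l, Q l ∧ l.length = n := ⟨1, [k], ⟨by simp, by simp, by simp, by simp⟩, rfl⟩
  have hbd : ∀ n, (∃ l, Q l ∧ l.length = n) → n ≤ Fintype.card V := by
    rintro n ⟨l, ⟨-, -, hl, -⟩, rfl⟩
    exact hl.length_le_card
  obtain ⟨l, ⟨h0, hl0, hnd, hch⟩, hlen⟩ := Nat.findGreatest_spec
    (P := fun n ↦ ∃ l, Q l ∧ l.length = n) (hbd _ hex.choose_spec) hex.choose_spec
  have hmax : ∀ l', Q l' → l'.length ≤ l.length := by
    intro l' hl'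
    rw [hlen]
    exact Nat.le_findGreatest (hbd _ ⟨l', hl', rfl⟩) ⟨l', hl', rfl⟩
  have hne : ∀ i j (hi : i < l.length) (hj : j < l.length), i ≠ j → l[i] ≠ l[j] := by
    intro i j hi hj hij h
    exact hij ((hnd.getElem_inj_iff).1 h)
  -- Along a maximal path, a vertex other than the last has already spent its allowed degree on its
  -- path neighbours.
  have hchord : ∀ (i : ℕ) (hi : i + 1 < l.length) (w : V), G.Adj l[i] w → w ≠ l[i + 1] →
      0 < i ∧ w = l[i - 1] := by
    intro i hi w hw hwne
    rcases Nat.eq_zero_or_pos i with rfl | hpos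
    · exfalso
      have h3 := hch 0 hi
      rw [hl0] at hw h3
      exact hwne (hk _ _ hw h3)
    · refine ⟨hpos, ?_⟩
      have h4 := hch i hi
      have h5 := (hch (i - 1) (by lia)).symm
      have h6 : i - 1 + 1 = i := by lia
      simp only [h6] at h5
      rcases h2 _ _ _ _ hw h4 h5 with h7 | h7 | h7
      · exact absurd h7 hwne
      · exact absurd h7 (hne _ _ _ _ (by lia))
      · exact h7
  refine ⟨l, h0, hl0, hnd, ?_, ?_⟩
  · refine hconn _ (hl0 ▸ List.getElem_mem h0) ?_
    intro x y hx hxy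
    obtain ⟨i, hi, rfl⟩ := List.getElem_of_mem hx
    by_contra hy
    by_cases hlast : i + 1 < l.length
    · by_cases h8 : y = l[i + 1]
      · exact hy (h8 ▸ List.getElem_mem _)
      · exact hy ((hchord i hlast y hxy h8).2 ▸ List.getElem_mem _)
    -- A neighbour of the last vertex outside the list would prolong the path.
    · have := hmax (l ++ [y]) ⟨by simp, by rw [List.getElem_append_left h0, hl0], ?_, ?_⟩
      · simp at this
      · rw [List.nodup_append]
        refine ⟨hnd, by simp, ?_⟩
        rintro a ha c hc rfl
        rw [List.mem_singleton] at hc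
        exact hy (hc ▸ ha)
      · intro j hj
        rw [List.length_append, List.length_singleton] at hj
        by_cases h9 : j + 1 < l.length
        · rw [List.getElem_append_left (by lia), List.getElem_append_left h9]
          exact hch j h9
        · have h10 : j = i := by lia
          subst h10
          rw [List.getElem_append_left hi, List.getElem_append_right (by lia)]
          simpa using hxy
  · intro i j hi hj hij
    refine ⟨fun h ↦ ?_, fun h ↦ by subst h; exact hch i hj⟩
    by_contra hij'
    have := (hchord i (by lia) l[j] h (hne _ _ _ _ (by lia))).2
    exact hne _ _ _ _ (by lia) this

/-- In `2 = ⟨ξ, ξ^∨⟩ = ∑ comark · ⟨ξ, α^∨⟩` the two nodes already contribute 2, so their comarks are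
1. The comark inequality spreads the value 1 over the diagram and then bounds the degrees: the
diagram is a path with ends `k` and `k'`, and all edges are simple. -/
theorem isTypeA_of_two_neighbors (b : P.Base) {k k' : b.support} (hkk : k ≠ k')
    (hk : 0 < P.pairing (highestRoot b) k) (hk' : 0 < P.pairing (highestRoot b) k') :
    IsTypeA b := by
  classical
  have hsum := pairing_highestRoot_eq_sum b (highestRoot b)
  rw [P.pairing_same] at hsum
  have hcpos : ∀ l, (1 : ℝ) ≤ comark b l := fun l ↦ by exact_mod_cast comark_pos b l
  have hpair : comark b k * P.pairing (highestRoot b) k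
      + comark b k' * P.pairing (highestRoot b) k' ≤ 2 := by
    rw [hsum, ← Finset.sum_pair hkk (f := fun l ↦ (comark b l : ℝ) * P.pairing (highestRoot b) l)]
    exact Finset.sum_le_sum_of_subset_of_nonneg (Finset.subset_univ _) fun l _ _ ↦
      mul_nonneg (by linarith [hcpos l]) (pairing_highestRoot_nonneg b l)
  have hm := one_le_pairing_of_pos hk
  have hm' := one_le_pairing_of_pos hk'
  have hck : comark b k = 1 := by
    have : (comark b k : ℝ) ≤ 1 := by nlinarith [hcpos k, hcpos k']
    exact le_antisymm (by exact_mod_cast this) (comark_pos b k)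
  have hck' : comark b k' = 1 := by
    have : (comark b k' : ℝ) ≤ 1 := by nlinarith [hcpos k, hcpos k']
    exact le_antisymm (by exact_mod_cast this) (comark_pos b k')
  have hxk := one_le_pairing_of_pos (pairing_pos_symm hk)
  have hxk' := one_le_pairing_of_pos (pairing_pos_symm hk')
  -- The induction carries the neighbours along: if two adjacent nodes have comark 1, the inequality
  -- at the second gives comark 1 to each of its other neighbours.
  have hc1 : ∀ l, comark b l = 1 := by
    suffices h : ∀ l, comark b l = 1 ∧ ∀ x, (dynkinGraph b).Adj l x → comark b x = 1 from
      fun l ↦ (h l).1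
    refine dynkinGraph_induction b _ (i := k) ⟨hck, fun x hx ↦ ?_⟩ ?_
    · have h1 := pairing_highestRoot_le b k {x} (by simpa using hx)
      rw [hck, Finset.sum_singleton] at h1
      have : (comark b x : ℝ) ≤ 1 := by push_cast at h1; linarith
      exact le_antisymm (by exact_mod_cast this) (comark_pos b x)
    · rintro l y ⟨hl, hlx⟩ hly
      refine ⟨hlx y hly, fun x hx ↦ ?_⟩
      by_cases hxl : x = l
      · rw [hxl, hl]
      have h1 := pairing_highestRoot_le b y {x, l} (by simp [hx, hly.symm])
      rw [Finset.sum_pair hxl, hlx y hly, hl] at h1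
      have h2 := pairing_highestRoot_nonneg' b y
      have : (comark b x : ℝ) ≤ 1 := by push_cast at h1; linarith
      exact le_antisymm (by exact_mod_cast this) (comark_pos b x)
  have hend : ∀ v : b.support, 1 ≤ P.pairing v (highestRoot b) →
      ∀ x y, (dynkinGraph b).Adj v x → (dynkinGraph b).Adj v y → x = y := by
    intro v hv x y hx hy
    by_contra hxy
    have h1 := pairing_highestRoot_le b v {x, y} (by simp [hx, hy])
    rw [Finset.sum_pair hxy] at h1
    simp only [hc1] at h1
    push_cast at h1
    linarith
  have hdeg : ∀ v x y z, (dynkinGraph b).Adj v x → (dynkinGraph b).Adj v y →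
      (dynkinGraph b).Adj v z → x = y ∨ y = z ∨ x = z := by
    intro v x y z hx hy hz
    by_contra! hne
    have h1 := pairing_highestRoot_le b v {x, y, z} (by simp [hx, hy, hz])
    rw [Finset.sum_insert (by simp [hne]), Finset.sum_pair hne.2.1] at h1
    simp only [hc1] at h1
    push_cast at h1
    linarith [pairing_highestRoot_nonneg' b v]
  obtain ⟨l, h0, hl0, hnd, hall, hadj⟩ := exists_list_of_degree_le_two (dynkinGraph b) k
    (fun p hp h ↦ dynkinGraph_induction b p hp h) (hend k hxk) hdeg
  -- An entry `≤ -2` uses up the whole `2 * comark b v = 2`, leaving no room for another neighbour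
  -- or for the affine node.
  have hmult : ∀ v w : b.support, P.pairing v w ≤ -2 → v ≠ w →
      P.pairing v (highestRoot b) ≤ 0 ∧ ∀ x, (dynkinGraph b).Adj v x → x = w := by
    intro v w hvw hne
    constructor
    · rw [pairing_highestRoot_eq_sum]
      have := sum_mul_pairing_le b (fun l ↦ (comark b l : ℝ))
        (fun l ↦ by linarith [hcpos l]) v {w} (by simpa using hne)
      simp only [hc1, Finset.sum_singleton] at this ⊢
      push_cast at this ⊢
      linarith
    · intro x hx
      by_contra hxw
      have := sum_mul_pairing_le b (fun l ↦ (comark b l : ℝ))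
        (fun l ↦ by linarith [hcpos l]) v {w, x} (by simpa using ⟨hne, hx.ne⟩)
      rw [← pairing_highestRoot_eq_sum] at this
      simp only [hc1, Finset.sum_pair (Ne.symm hxw)] at this
      push_cast at this
      linarith [pairing_highestRoot_nonneg' b v, pairing_le_neg_one b hx]
  -- By `hmult` such a `v` is an end of the path orthogonal to `ξ^∨`, but the ends are `k` and `k'`,
  -- which pair positively with `ξ^∨`.
  have hval : ∀ v w, (dynkinGraph b).Adj v w → P.pairing v w = -1 := by
    intro v w hvw
    refine (pairing_le_neg_two_or_eq b hvw).resolve_left fun h ↦ ?_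
    obtain ⟨hv0, huniq⟩ := hmult v w h hvw.ne
    obtain ⟨i, hi, rfl⟩ := List.getElem_of_mem (hall v)
    obtain ⟨j, hj, hjk⟩ := List.getElem_of_mem (hall k')
    have hmid : ∀ (m : ℕ) (hm : m + 1 < l.length), 0 < m →
        ∃ x y, x ≠ y ∧ (dynkinGraph b).Adj l[m] x ∧ (dynkinGraph b).Adj l[m] y := by
      intro m hm hpos
      refine ⟨l[m - 1], l[m + 1], fun h ↦ ?_, ?_, ?_⟩
      · have := (hnd.getElem_inj_iff).1 h
        lia
      · exact ((hadj (m - 1) m (by lia) (by lia) (by lia)).2 (by lia)).symm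
      · exact (hadj m (m + 1) (by lia) hm (by lia)).2 rfl
    rcases Nat.eq_zero_or_pos i with rfl | hpos
    · rw [hl0] at hv0
      linarith
    by_cases hlast : i + 1 < l.length
    · obtain ⟨x, y, hxy, hx, hy⟩ := hmid i hlast hpos
      exact hxy ((huniq x hx).trans (huniq y hy).symm)
    · have hj0 : 0 < j := by
        rcases Nat.eq_zero_or_pos j with rfl | h'
        · exact absurd (hl0.symm.trans hjk) hkk
        · exact h'
      have hji : j ≠ i := by
        rintro rfl
        rw [hjk] at hv0
        linarith
      obtain ⟨x, y, hxy, hx, hy⟩ := hmid j (by lia) hj0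
      rw [hjk] at hx hy
      exact hxy (hend k' hxk' x y hx hy)
  refine ⟨l.length, (hnd.getEquivOfForallMemList l hall).symm, ?_⟩
  suffices h : ∀ i j : Fin l.length, b.cartanMatrix l[i] l[j] = CartanMatrix.A l.length i j by
    intro v w
    have := h ((hnd.getEquivOfForallMemList l hall).symm v)
      ((hnd.getEquivOfForallMemList l hall).symm w)
    rw [← this]
    congr 1
    · exact ((hnd.getEquivOfForallMemList l hall).apply_symm_apply v).symm
    · exact ((hnd.getEquivOfForallMemList l hall).apply_symm_apply w).symm
  intro i j
  simp only [CartanMatrix.A, Matrix.of_apply]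
  have hA : ∀ (v w : b.support), (dynkinGraph b).Adj v w → b.cartanMatrix v w = -1 := by
    intro v w h
    have := hval v w h
    rw [← cartanMatrix_cast] at this
    exact_mod_cast this
  have hN : ∀ (v w : b.support), v ≠ w → ¬ (dynkinGraph b).Adj v w → b.cartanMatrix v w = 0 := by
    intro v w hne h
    rw [dynkinGraph_adj] at h
    rw [b.cartanMatrix_apply_eq_zero_iff_pairing]
    by_contra h'
    exact h ⟨hne, h'⟩
  split_ifs with h1 h2
  · subst h1
    exact b.cartanMatrix_apply_same _
  · apply hA
    rcases h2 with h2 | h2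
    · exact (hadj i j i.2 j.2 (by lia)).2 h2
    · exact ((hadj j i j.2 i.2 (by lia)).2 h2).symm
  · apply hN
    · intro h
      exact h1 (Fin.ext ((hnd.getElem_inj_iff).1 h))
    · intro h
      push Not at h2
      rcases lt_trichotomy (i : ℕ) j with h3 | h3 | h3
      · exact h2.1 ((hadj i j i.2 j.2 h3).1 h)
      · exact h1 (Fin.ext h3)
      · exact h2.2 ((hadj j i j.2 i.2 h3).1 h.symm)

/-- Outside type `A`, the affine node has exactly one neighbour. -/
theorem exists_unique_affine_neighbor (b : P.Base) (hA : ¬ IsTypeA b) :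
    ∃ j : b.support, (∀ k, k ≠ j → P.pairing (highestRoot b) k = 0) ∧
      ((P.pairing (highestRoot b) j = 1 ∧ P.pairing j (highestRoot b) = 1) ∨
        P.pairing (highestRoot b) j = 2) := by
  have hsum := pairing_highestRoot_eq_sum b (highestRoot b)
  rw [P.pairing_same] at hsum
  obtain ⟨j, hj⟩ : ∃ j : b.support, P.pairing (highestRoot b) j ≠ 0 := by
    by_contra! h
    simp [h] at hsum
  have hjpos := lt_of_le_of_ne (pairing_highestRoot_nonneg b j) hj.symm
  have h0 : ∀ k, k ≠ j → P.pairing (highestRoot b) k = 0 := by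
    intro k hk
    by_contra h
    exact hA (isTypeA_of_two_neighbors b hk
      (lt_of_le_of_ne (pairing_highestRoot_nonneg b k) (Ne.symm h)) hjpos)
  refine ⟨j, h0, ?_⟩
  rw [Finset.sum_eq_single_of_mem j (Finset.mem_univ _) fun k _ hk ↦ by rw [h0 k hk, mul_zero]]
    at hsum
  obtain ⟨z, hz⟩ := exists_pairing_eq_int (P := P) (highestRoot b) j
  -- Only `j` contributes to `⟨ξ, ξ^∨⟩ = 2`, so the integer `⟨ξ, α_j^∨⟩` divides 2.
  have hz' : (2 : ℤ) = comark b j * z := by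
    rw [hz] at hsum
    exact_mod_cast hsum
  have hzpos : 0 < z := by rw [hz] at hjpos; exact_mod_cast hjpos
  have hc := comark_pos b j
  have hz2 : z = 1 ∨ z = 2 := by
    have : z ≤ 2 := by nlinarith
    lia
  rcases hz2 with rfl | rfl
  · left
    have h1 : P.pairing (highestRoot b) j = 1 := by rw [hz]; simp
    refine ⟨h1, le_antisymm (pairing_highestRoot_le_one b ?_)
      (one_le_pairing_of_pos (pairing_pos_symm hjpos))⟩
    intro h
    rw [← h, P.pairing_same] at h1
    norm_num at h1
  · right
    rw [hz]; simp

/-! ### Uniqueness of the heavy node -/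

/-- For `x = ∑ u_k α_k^∨` the hypothesis gives `(x, x) = ∑ u_k (α_k^∨, x) ≤ 0`, so `x = 0` by
positive definiteness. -/
theorem eq_zero_of_subharmonic (b : P.Base) (u : b.support → ℝ) (hu : ∀ k, 0 ≤ u k)
    (h : ∀ k, 0 < u k → ∑ l, u l * P.pairing k l ≤ 0) (k : b.support) : u k = 0 := by
  set x : N := ∑ l, u l • P.coroot l with hx
  have hroot : ∀ k : b.support, P.root' k x = ∑ l, u l * P.pairing k l := by
    intro k
    simp [hx]
  have hxx : P.CorootForm x x ≤ 0 := by
    have : P.CorootForm x x = ∑ k, u k * P.CorootForm (P.coroot k) x := by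
      nth_rw 1 [hx]
      simp
    rw [this]
    refine Finset.sum_nonpos fun k _ ↦ ?_
    rcases (hu k).eq_or_lt with h0 | h0
    · simp [← h0]
    · refine mul_nonpos_of_nonneg_of_nonpos (hu k) ?_
      have h1 := two_mul_corootForm_coroot (P := P) k x
      have h2 := corootForm_pos (P := P) (P.ne_zero' (k : ι))
      have h3 := h k h0
      rw [← hroot] at h3
      nlinarith
  have hx0 : x = 0 := by
    by_contra h0
    exact absurd hxx (not_le.2 (corootForm_pos (P := P) h0))
  have h1 : ∑ l, u l • b.toCoweightBasis l = 0 := by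
    rw [← hx0, hx]
    simp
  exact Fintype.linearIndependent_iff.1 b.toCoweightBasis.linearIndependent u h1 k

theorem IsHeavyNode.neighbors {b : P.Base} {i : b.support} (h : IsHeavyNode b i) :
    (∃ x y z, x ≠ y ∧ x ≠ z ∧ y ≠ z ∧ (dynkinGraph b).Adj i x ∧ (dynkinGraph b).Adj i y ∧
      (dynkinGraph b).Adj i z) ∨ ∃ j, (dynkinGraph b).Adj i j ∧ P.pairing i j ≤ -2 := by
  rcases h with h | ⟨j, ⟨hij, hm⟩, hl⟩
  · left
    obtain ⟨x, y, z, hxy, hxz, hyz, hs⟩ := Set.ncard_eq_three.1 h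
    have hmem : ∀ w, w ∈ ({x, y, z} : Set b.support) → (dynkinGraph b).Adj i w := by
      intro w hw
      rw [← hs] at hw
      exact hw
    exact ⟨x, y, z, hxy, hxz, hyz, hmem x (by simp), hmem y (by simp), hmem z (by simp)⟩
  · right
    have hle : P.pairing i j ≤ -2 := by
      rcases hm with hm | hm
      · have : b.cartanMatrix i j ≤ -2 := by rw [numEdges] at hm; lia
        rw [← cartanMatrix_cast]
        exact_mod_cast this
      -- If the multiplicity is recorded from `j` to `i`, the length comparison transfers it to the
      -- entry from `i` to `j`.
      · have h1 : b.cartanMatrix j i ≤ -2 := by rw [numEdges] at hm; lia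
        have h2 : P.pairing j i ≤ -2 := by
          rw [← cartanMatrix_cast]
          exact_mod_cast h1
        have h3 : P.pairing j i * P.RootForm (P.root i) (P.root i)
            = P.pairing i j * P.RootForm (P.root j) (P.root j) :=
          P.toInvariantForm.pairing_mul_eq_pairing_mul_swap (i : ι) (j : ι)
        have h4 : 0 < P.RootForm (P.root j) (P.root j) :=
          P.rootForm_pos_of_ne_zero (by simp) (P.ne_zero (j : ι))
        by_contra! h5
        nlinarith
    refine ⟨j, (dynkinGraph_adj b).2 ⟨hij, by linarith⟩, hle⟩

/-- Two heavy nodes joined by a path span a diagram of affine type; its null vector gives a test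
function contradicting positive definiteness. -/
theorem IsHeavyNode.unique {b : P.Base} {i j : b.support} (hi : IsHeavyNode b i)
    (hj : IsHeavyNode b j) : i = j := by
  classical
  by_contra hij
  have hreach : (dynkinGraph b).Reachable i j :=
    dynkinGraph_induction b (fun x ↦ (dynkinGraph b).Reachable i x)
      (SimpleGraph.Reachable.refl _) (fun k l hk hkl ↦ hk.trans hkl.reachable) j
  obtain ⟨p, hp⟩ := hreach.exists_isPath
  have hlen : 0 < p.length := by
    rw [Nat.pos_iff_ne_zero]
    intro h
    exact hij (SimpleGraph.Walk.eq_of_length_eq_zero h)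
  -- The value is 2 on the path and 1 on the remaining neighbours of its ends. Inside the path this
  -- balances as `4 - 2 - 2`, at an outer neighbour as `2 - 2`, and at a heavy end the extra
  -- neighbours or the multiple edge absorb the 4.
  let u : b.support → ℝ := fun l ↦ if l ∈ p.support then 2
    else if (dynkinGraph b).Adj i l ∨ (dynkinGraph b).Adj j l then 1 else 0
  have hu0 : ∀ l, 0 ≤ u l := by
    intro l
    simp only [u]
    split_ifs <;> norm_num
  have hu2 : ∀ l ∈ p.support, u l = 2 := fun l hl ↦ by simp [u, hl]
  have hu1 : ∀ l, (dynkinGraph b).Adj i l ∨ (dynkinGraph b).Adj j l → 1 ≤ u l := by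
    intro l hl
    simp only [u, if_pos hl]
    split_ifs <;> norm_num
  have hheavy : ∀ k w, IsHeavyNode b k → k ∈ p.support → w ∈ p.support →
      (dynkinGraph b).Adj k w → (∀ l, (dynkinGraph b).Adj k l → 1 ≤ u l) →
      ∑ l, u l * P.pairing k l ≤ 0 := by
    intro k w hk hkp hwp hkw hk1
    have huk := hu2 k hkp
    have huw := hu2 w hwp
    have hterm : ∀ l, (dynkinGraph b).Adj k l → u l * P.pairing k l ≤ -u l := by
      intro l hl
      nlinarith [hu0 l, pairing_le_neg_one b hl]
    rcases hk.neighbors with ⟨x, y, z, hxy, hxz, hyz, hx, hy, hz⟩ | ⟨x, hx, hx2⟩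
    · have hsum : 4 ≤ u x + u y + u z ∨ (w ≠ x ∧ w ≠ y ∧ w ≠ z) := by
        by_cases h1 : w = x
        · left; subst h1; linarith [hk1 y hy, hk1 z hz]
        by_cases h2 : w = y
        · left; subst h2; linarith [hk1 x hx, hk1 z hz]
        by_cases h3 : w = z
        · left; subst h3; linarith [hk1 x hx, hk1 y hy]
        exact Or.inr ⟨h1, h2, h3⟩
      rcases hsum with hsum | ⟨h1, h2, h3⟩
      · refine (sum_mul_pairing_le b u hu0 k {x, y, z} ?_).trans ?_
        · simp [hx.ne, hy.ne, hz.ne]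
        · rw [Finset.sum_insert (by simp [hxy, hxz]), Finset.sum_pair hyz]
          linarith [hterm x hx, hterm y hy, hterm z hz]
      · refine (sum_mul_pairing_le b u hu0 k {w, x, y} ?_).trans ?_
        · simp [hx.ne, hy.ne, hkw.ne]
        · rw [Finset.sum_insert (by simp [h1, h2]), Finset.sum_pair hxy]
          linarith [hterm x hx, hterm y hy, hterm w hkw, hk1 x hx, hk1 y hy]
    · by_cases hxw : x = w
      · subst hxw
        refine (sum_mul_pairing_le b u hu0 k {x} (by simp [hx.ne])).trans ?_
        rw [Finset.sum_singleton]
        nlinarith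
      · refine (sum_mul_pairing_le b u hu0 k {x, w} (by simp [hx.ne, hkw.ne])).trans ?_
        rw [Finset.sum_pair hxw]
        nlinarith [hterm w hkw, hk1 x hx]
  have hkey : ∀ k, 0 < u k → ∑ l, u l * P.pairing k l ≤ 0 := by
    intro k hk
    by_cases hkp : k ∈ p.support
    · obtain ⟨n, rfl, hn⟩ := SimpleGraph.Walk.mem_support_iff_exists_getVert.1 hkp
      rcases Nat.eq_zero_or_pos n with rfl | hpos
      · have hadj := p.adj_getVert_succ (i := 0) hlen
        rw [p.getVert_zero] at hadj hkp ⊢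
        exact hheavy _ _ hi hkp (p.getVert_mem_support _) hadj fun l hl ↦ hu1 l (Or.inl hl)
      have hadj' := (p.adj_getVert_succ (i := n - 1) (by lia)).symm
      rw [Nat.sub_add_cancel hpos] at hadj'
      by_cases hnl : n = p.length
      · subst hnl
        rw [p.getVert_length] at hadj' hkp ⊢
        exact hheavy _ _ hj hkp (p.getVert_mem_support _) hadj' fun l hl ↦ hu1 l (Or.inr hl)
      have hadj := p.adj_getVert_succ (i := n) (by lia)
      have hne : p.getVert (n - 1) ≠ p.getVert (n + 1) := by
        intro h
        have := hp.getVert_injOn (by simp; lia) (by simp; lia) h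
        lia
      refine (sum_mul_pairing_le b u hu0 _ {p.getVert (n - 1), p.getVert (n + 1)} ?_).trans ?_
      · simp [hadj.ne, hadj'.ne]
      · rw [Finset.sum_pair hne, hu2 _ hkp, hu2 _ (p.getVert_mem_support _),
          hu2 _ (p.getVert_mem_support _)]
        linarith [pairing_le_neg_one b hadj, pairing_le_neg_one b hadj']
    · have hadj : (dynkinGraph b).Adj i k ∨ (dynkinGraph b).Adj j k := by
        by_contra h
        simp [u, hkp, h] at hk
      have huk : u k = 1 := by simp [u, hkp, hadj]
      rcases hadj with hadj | hadj
      · refine (sum_mul_pairing_le b u hu0 k {i} (by simp [hadj.ne'])).trans ?_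
        rw [Finset.sum_singleton, huk, hu2 i p.start_mem_support]
        linarith [pairing_le_neg_one b hadj.symm]
      · refine (sum_mul_pairing_le b u hu0 k {j} (by simp [hadj.ne'])).trans ?_
        rw [Finset.sum_singleton, huk, hu2 j p.end_mem_support]
        linarith [pairing_le_neg_one b hadj.symm]
  have h1 := eq_zero_of_subharmonic b u hu0 hkey i
  rw [hu2 i p.start_mem_support] at h1
  norm_num at h1

end

end LimitWeakOrder

/-! ### The alternating orbit of the highest root. -/

namespace LimitWeakOrder

open RootPairing

noncomputable section

set_option linter.unusedSectionVars false

variable {ι M N : Type*} [AddCommGroup M] [Module ℝ M] [AddCommGroup N] [Module ℝ N]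
  {P : RootPairing ι ℝ M N} [P.IsRootSystem] [Fintype ι]

/-! ### Pairs of automorphisms of the root space and of the coroot space -/

/-- A linear automorphism `f` of the root space and a linear automorphism `g` of the coroot space
are compatible if they respect the pairing and permute roots and coroots in the same way. -/
structure Compatible (P : RootPairing ι ℝ M N) (f : M ≃ₗ[ℝ] M) (g : N ≃ₗ[ℝ] N) : Prop where
  pairing_eq : ∀ x y, P.toLinearMap (f x) (g y) = P.toLinearMap x y
  exists_image : ∀ i, ∃ j, f (P.root i) = P.root j ∧ g (P.coroot i) = P.coroot j
  exists_preimage : ∀ i, ∃ j, f (P.root j) = P.root i ∧ g (P.coroot j) = P.coroot i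

theorem Compatible.one : Compatible P 1 1 :=
  ⟨fun _ _ ↦ rfl, fun i ↦ ⟨i, rfl, rfl⟩, fun i ↦ ⟨i, rfl, rfl⟩⟩

theorem Compatible.mul {f f' : M ≃ₗ[ℝ] M} {g g' : N ≃ₗ[ℝ] N} (h : Compatible P f g)
    (h' : Compatible P f' g') : Compatible P (f * f') (g * g') := by
  refine ⟨fun x y ↦ ?_, fun i ↦ ?_, fun i ↦ ?_⟩
  · rw [LinearEquiv.mul_apply, LinearEquiv.mul_apply, h.pairing_eq, h'.pairing_eq]
  · obtain ⟨j, h1, h2⟩ := h'.exists_image i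
    obtain ⟨k, h3, h4⟩ := h.exists_image j
    exact ⟨k, by rw [LinearEquiv.mul_apply, h1, h3], by rw [LinearEquiv.mul_apply, h2, h4]⟩
  · obtain ⟨j, h1, h2⟩ := h.exists_preimage i
    obtain ⟨k, h3, h4⟩ := h'.exists_preimage j
    exact ⟨k, by rw [LinearEquiv.mul_apply, h3, h1], by rw [LinearEquiv.mul_apply, h4, h2]⟩

theorem Compatible.reflection (i : ι) : Compatible P (P.reflection i) (P.coreflection i) := by
  refine ⟨fun x y ↦ ?_, fun j ↦ ⟨P.reflectionPerm i j, ?_, ?_⟩,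
    fun j ↦ ⟨P.reflectionPerm i j, ?_, ?_⟩⟩
  · have h2 : P.toLinearMap (P.root i) (P.coroot i) = 2 := P.root_coroot_two i
    rw [P.reflection_apply, P.coreflection_apply]
    simp only [map_sub, map_smul, LinearMap.sub_apply, LinearMap.smul_apply, smul_eq_mul, h2,
      LinearMap.flip_apply]
    ring
  · exact (P.root_reflectionPerm i j).symm
  · exact (P.coroot_reflectionPerm i j).symm
  · rw [P.root_reflectionPerm, P.reflection_same]
  · rw [P.coroot_reflectionPerm, P.coreflection_same]

/-- The product of the coreflections along a list of simple roots. -/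
def coreflectionProd (b : P.Base) (l : List b.support) : N ≃ₗ[ℝ] N :=
  (l.map fun k : b.support ↦ P.coreflection k).prod

theorem coreflectionProd_cons (b : P.Base) (k : b.support) (l : List b.support) :
    coreflectionProd b (k :: l) = P.coreflection k * coreflectionProd b l := rfl

theorem coreflectionProd_append (b : P.Base) (l l' : List b.support) :
    coreflectionProd b (l ++ l') = coreflectionProd b l * coreflectionProd b l' := by
  simp [coreflectionProd]

theorem coreflectionProd_mem (b : P.Base) (l : List b.support) :
    coreflectionProd b l ∈ finiteWeylGroup P :=
  Subgroup.list_prod_mem _ fun x hx ↦ by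
    obtain ⟨k, -, rfl⟩ := List.mem_map.1 hx
    exact Subgroup.subset_closure ⟨k, rfl⟩

theorem compatible_list (b : P.Base) (l : List b.support) :
    Compatible P (l.map fun k : b.support ↦ P.reflection k).prod (coreflectionProd b l) := by
  induction l with
  | nil => exact Compatible.one
  | cons k l ih => exact (Compatible.reflection (k : ι)).mul ih

theorem coreflectionProd_apply (b : P.Base) (l : List b.support) (hl : l.Nodup)
    (h : ∀ k ∈ l, ∀ k' ∈ l, k ≠ k' → P.pairing k k' = 0) (y : N) :
    coreflectionProd b l y = y - (l.map fun k : b.support ↦ P.root' k y • P.coroot k).sum := by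
  induction l with
  | nil => simp [coreflectionProd]
  | cons k l ih =>
    rw [List.nodup_cons] at hl
    have h1 : P.root' k (l.map fun k : b.support ↦ P.root' k y • P.coroot k).sum = 0 := by
      rw [map_list_sum, List.map_map]
      apply List.sum_eq_zero
      intro x hx
      obtain ⟨k', hk', rfl⟩ := List.mem_map.1 hx
      have hne : k ≠ k' := by
        rintro rfl
        exact hl.1 hk'
      have := h k (by simp) k' (by simp [hk']) hne
      simp [this]
    rw [coreflectionProd_cons, LinearEquiv.mul_apply,
      ih hl.2 fun k hk k' hk' ↦ h k (by simp [hk]) k' (by simp [hk']),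
      P.coreflection_apply, map_sub, h1, List.map_cons, List.sum_cons]
    module

theorem reflection_list_prod_apply (b : P.Base) (l : List b.support) (hl : l.Nodup)
    (h : ∀ k ∈ l, ∀ k' ∈ l, k ≠ k' → P.pairing k k' = 0) (x : M) :
    (l.map fun k : b.support ↦ P.reflection k).prod x
      = x - (l.map fun k : b.support ↦ P.coroot' k x • P.root k).sum := by
  induction l with
  | nil => simp
  | cons k l ih =>
    rw [List.nodup_cons] at hl
    have h1 : P.coroot' k (l.map fun k : b.support ↦ P.coroot' k x • P.root k).sum = 0 := by
      rw [map_list_sum, List.map_map]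
      apply List.sum_eq_zero
      intro x hx
      obtain ⟨k', hk', rfl⟩ := List.mem_map.1 hx
      have hne : k' ≠ k := by
        rintro rfl
        exact hl.1 hk'
      have := h k' (by simp [hk']) k (by simp) hne
      simp [this]
    rw [List.map_cons, List.prod_cons, LinearEquiv.mul_apply,
      ih hl.2 fun k hk k' hk' ↦ h k (by simp [hk]) k' (by simp [hk']),
      P.reflection_apply, map_sub, h1, List.map_cons, List.sum_cons]
    module

/-- An injective endomorphism permuting a finite spanning set has finite order. -/
theorem exists_pow_eq_one {V : Type*} [AddCommGroup V] [Module ℝ V] (r : ι ↪ V)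
    (hr : Submodule.span ℝ (Set.range r) = ⊤) (f : V ≃ₗ[ℝ] V) (hf : ∀ i, ∃ j, f (r i) = r j) :
    ∃ n : ℕ, 0 < n ∧ f ^ n = 1 := by
  choose σ hσ using hf
  have hinj : Function.Injective σ := by
    intro i j hij
    apply r.injective
    apply f.injective
    rw [hσ, hσ, hij]
  let τ : Equiv.Perm ι := Equiv.ofBijective σ (Finite.injective_iff_bijective.1 hinj)
  have hτ : ∀ (n : ℕ) i, (f ^ n) (r i) = r ((τ ^ n) i) := by
    intro n
    induction n with
    | zero => simp
    | succ n ih =>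
      intro i
      rw [pow_succ', pow_succ', LinearEquiv.mul_apply, ih, hσ]
      rfl
  refine ⟨orderOf τ, orderOf_pos τ, ?_⟩
  apply LinearEquiv.toLinearMap_injective
  apply LinearMap.ext_on_range hr
  intro i
  change (f ^ orderOf τ) (r i) = r i
  rw [hτ, pow_orderOf_eq_one]
  rfl

theorem Compatible.exists_pow_eq_one_left {f : M ≃ₗ[ℝ] M} {g : N ≃ₗ[ℝ] N}
    (h : Compatible P f g) : ∃ n : ℕ, 0 < n ∧ f ^ n = 1 :=
  exists_pow_eq_one P.root IsRootSystem.span_root_eq_top f fun i ↦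
    let ⟨j, hj, _⟩ := h.exists_image i; ⟨j, hj⟩

variable [P.IsCrystallographic]

/-! ### The elements `s_F` and `s_U` on roots and coroots -/

theorem pairing_eq_zero_of_isIndepSet {b : P.Base} {T : Finset b.support}
    (hT : (dynkinGraph b).IsIndepSet (T : Set b.support)) {k k' : b.support} (hk : k ∈ T)
    (hk' : k' ∈ T) (h : k ≠ k') : P.pairing k k' = 0 := by
  by_contra h'
  exact hT (Finset.mem_coe.2 hk) (Finset.mem_coe.2 hk') h ((dynkinGraph_adj b).2 ⟨h, h'⟩)

theorem reflectionProd_eq_list (b : P.Base) (T : Finset b.support)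
    (hT : (dynkinGraph b).IsIndepSet (T : Set b.support)) :
    reflectionProd b T hT = (T.toList.map fun k : b.support ↦ P.reflection k).prod := by
  classical
  rw [← Finset.noncommProd_toFinset T.toList (fun k : b.support ↦ P.reflection k)
    (by simpa using commute_reflection b T hT) T.nodup_toList]
  exact Finset.noncommProd_congr (by simp) (fun _ _ ↦ rfl) _

theorem reflectionProd_apply (b : P.Base) (T : Finset b.support)
    (hT : (dynkinGraph b).IsIndepSet (T : Set b.support)) (x : M) :
    reflectionProd b T hT x = x - ∑ k ∈ T, P.coroot' k x • P.root k := by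
  rw [reflectionProd_eq_list, reflection_list_prod_apply b _ T.nodup_toList, Finset.sum_map_toList]
  intro k hk k' hk'
  exact pairing_eq_zero_of_isIndepSet hT (by simpa using hk) (by simpa using hk')

theorem coreflectionProd_toList_apply (b : P.Base) (T : Finset b.support)
    (hT : (dynkinGraph b).IsIndepSet (T : Set b.support)) (y : N) :
    coreflectionProd b T.toList y = y - ∑ k ∈ T, P.root' k y • P.coroot k := by
  rw [coreflectionProd_apply b _ T.nodup_toList, Finset.sum_map_toList]
  intro k hk k' hk'
  exact pairing_eq_zero_of_isIndepSet hT (by simpa using hk) (by simpa using hk')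

theorem compatible_reflectionProd (b : P.Base) (T : Finset b.support)
    (hT : (dynkinGraph b).IsIndepSet (T : Set b.support)) :
    Compatible P (reflectionProd b T hT) (coreflectionProd b T.toList) := by
  rw [reflectionProd_eq_list]
  exact compatible_list b _

theorem sum_pairing_indep {b : P.Base} {T : Finset b.support}
    (hT : (dynkinGraph b).IsIndepSet (T : Set b.support)) (a : b.support → ℝ) {k : b.support}
    (hk : k ∈ T) : ∑ l ∈ T, a l * P.pairing k l = 2 * a k := by
  rw [Finset.sum_eq_single_of_mem k hk, P.pairing_same, mul_comm]
  intro l hl hlk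
  rw [pairing_eq_zero_of_isIndepSet hT hk hl hlk.symm, mul_zero]

theorem coreflectionProd_toList_mul_self (b : P.Base) (T : Finset b.support)
    (hT : (dynkinGraph b).IsIndepSet (T : Set b.support)) :
    coreflectionProd b T.toList * coreflectionProd b T.toList = 1 := by
  ext y
  rw [LinearEquiv.mul_apply, coreflectionProd_toList_apply b T hT (coreflectionProd b T.toList y)]
  have h : ∀ k ∈ T, P.root' k (coreflectionProd b T.toList y) = - P.root' k y := by
    intro k hk
    rw [coreflectionProd_toList_apply b T hT, map_sub, map_sum]
    simp only [map_smul, smul_eq_mul, P.root'_coroot_eq_pairing]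
    rw [sum_pairing_indep hT (fun l ↦ P.root' l y) hk]
    ring
  rw [Finset.sum_congr rfl fun k hk ↦ by rw [h k hk], coreflectionProd_toList_apply b T hT]
  simp

theorem reflectionProd_mul_self (b : P.Base) (T : Finset b.support)
    (hT : (dynkinGraph b).IsIndepSet (T : Set b.support)) :
    reflectionProd b T hT * reflectionProd b T hT = 1 := by
  ext x
  apply P.toPerfPair.injective
  ext y
  have h := compatible_reflectionProd b T hT
  have h1 := coreflectionProd_toList_mul_self b T hT
  change P.toLinearMap (reflectionProd b T hT (reflectionProd b T hT x)) y = P.toLinearMap x y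
  have h2 : y = coreflectionProd b T.toList (coreflectionProd b T.toList y) := by
    rw [← LinearEquiv.mul_apply, h1, LinearEquiv.coe_one, id]
  conv_lhs => rw [h2]
  rw [h.pairing_eq, h.pairing_eq]

/-- The element `s_F` acting on the coroot space. -/
def Bipartition.coF {b : P.Base} (B : Bipartition b) : N ≃ₗ[ℝ] N :=
  coreflectionProd b B.F.toList

/-- The element `s_U` acting on the coroot space. -/
def Bipartition.coU {b : P.Base} (B : Bipartition b) : N ≃ₗ[ℝ] N :=
  coreflectionProd b B.U.toList

/-- The alternating products acting on the coroot space. -/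
def Bipartition.coAlternatingProd {b : P.Base} (B : Bipartition b) : ℕ → (N ≃ₗ[ℝ] N)
  | 0 => 1
  | m + 1 => (if Even m then B.coF else B.coU) * B.coAlternatingProd m

namespace Bipartition

variable {b : P.Base} (B : Bipartition b)

theorem compatible_F : Compatible P B.sF B.coF := compatible_reflectionProd b B.F B.indep_F

theorem compatible_U : Compatible P B.sU B.coU := compatible_reflectionProd b B.U B.indep_U

theorem compatible_alternatingProd (m : ℕ) :
    Compatible P (B.alternatingProd m) (B.coAlternatingProd m) := by
  induction m with
  | zero => exact Compatible.one
  | succ m ih =>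
    simp only [alternatingProd, coAlternatingProd]
    split_ifs
    · exact B.compatible_F.mul ih
    · exact B.compatible_U.mul ih

theorem coF_mul_self : B.coF * B.coF = 1 := coreflectionProd_toList_mul_self b B.F B.indep_F

theorem coU_mul_self : B.coU * B.coU = 1 := coreflectionProd_toList_mul_self b B.U B.indep_U

theorem sF_mul_self : B.sF * B.sF = 1 := reflectionProd_mul_self b B.F B.indep_F

theorem sU_mul_self : B.sU * B.sU = 1 := reflectionProd_mul_self b B.U B.indep_U

theorem coAlternatingProd_mem (m : ℕ) : B.coAlternatingProd m ∈ finiteWeylGroup P := by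
  induction m with
  | zero => exact one_mem _
  | succ m ih =>
    simp only [coAlternatingProd]
    split_ifs
    · exact mul_mem (coreflectionProd_mem b _) ih
    · exact mul_mem (coreflectionProd_mem b _) ih

/-- Alternating products normalize the Coxeter element `s_F s_U` up to inversion. -/
theorem coAlternatingProd_conj (m : ℕ) :
    B.coAlternatingProd m * (B.coF * B.coU) =
      (if Even m then B.coF * B.coU else B.coU * B.coF) * B.coAlternatingProd m ∧
    B.coAlternatingProd m * (B.coU * B.coF) =
      (if Even m then B.coU * B.coF else B.coF * B.coU) * B.coAlternatingProd m := by
  have hF := B.coF_mul_self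
  have hU := B.coU_mul_self
  induction m with
  | zero => simp [coAlternatingProd]
  | succ m ih =>
    by_cases hm : Even m
    · have hm' : ¬ Even (m + 1) := by simpa [Nat.even_add_one] using hm
      simp only [coAlternatingProd, hm, hm', if_true, if_false] at ih ⊢
      constructor
      · rw [mul_assoc, ih.1]
        simp only [← mul_assoc]
        rw [hF, one_mul, mul_assoc B.coU, hF, mul_one]
      · rw [mul_assoc, ih.2]
        simp only [mul_assoc]
    · have hm' : Even (m + 1) := by simpa [Nat.even_add_one] using hm
      simp only [coAlternatingProd, hm, hm', if_true, if_false] at ih ⊢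
      constructor
      · rw [mul_assoc, ih.1]
        simp only [← mul_assoc]
        rw [hU, one_mul, mul_assoc B.coF, hU, mul_one]
      · rw [mul_assoc, ih.2]
        simp only [mul_assoc]

theorem mem_U_iff (k : b.support) : k ∈ B.U ↔ k ∉ B.F :=
  ⟨fun h h' ↦ Finset.disjoint_left.1 B.disjoint h' h, fun h ↦ (B.cover k).resolve_left h⟩

end Bipartition

variable [P.IsReduced] [P.IsIrreducible]

/-! ### The orbit of the highest root -/

/-- Coefficients outside `T` do not change, so they are both nonnegative and nonpositive, hence
zero. The root is thus supported on pairwise orthogonal simple roots, where `s_k` negates the `k`-th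
coefficient; but `s_k` keeps every positive root other than `α_k` positive. -/
theorem eq_of_pos_of_neg {b : P.Base} {T : Finset b.support}
    (hT : (dynkinGraph b).IsIndepSet (T : Set b.support)) {i j : ι} (hi : b.IsPos i)
    (hj : ¬ b.IsPos j) (hij : reflectionProd b T hT (P.root i) = P.root j) :
    ∃ k ∈ T, i = k := by
  classical
  have hcoeff : ∀ k ∉ T, rootCoeff b i k = 0 := by
    intro k hk
    have h1 : (rootCoeff b j k : ℝ) = rootCoeff b i k -
        if k ∈ T then P.pairing i k else 0 := by
      refine rootCoeff_unique b j
        (fun k ↦ (rootCoeff b i k : ℝ) - if k ∈ T then P.pairing i k else 0) ?_ k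
      rw [← hij, reflectionProd_apply]
      simp only [sub_smul, Finset.sum_sub_distrib, ← root_eq_sum, ite_smul, zero_smul]
      rw [← Finset.sum_filter, Finset.filter_mem_eq_inter, Finset.univ_inter]
      simp only [P.root_coroot'_eq_pairing]
    rw [if_neg hk, sub_zero] at h1
    have h2 : rootCoeff b j k = rootCoeff b i k := by exact_mod_cast h1
    have := rootCoeff_nonneg hi k
    have := rootCoeff_nonpos hj k
    lia
  obtain ⟨k, hk⟩ := exists_rootCoeff_ne_zero b i
  have hkT : k ∈ T := by
    by_contra h
    exact hk (hcoeff k h)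
  refine ⟨k, hkT, ?_⟩
  by_contra hne
  have hpos := hi.reflectionPerm k.2 hne
  have h1 : P.root (P.reflectionPerm k i) = P.root i + (-P.pairing i k) • P.root k := by
    rw [P.root_reflectionPerm, P.reflection_apply_root, neg_smul, sub_eq_add_neg]
  have h2 := rootCoeff_of_root_eq_add (b := b) h1 k
  have h3 : P.pairing i k = 2 * rootCoeff b i k := by
    rw [pairing_eq_sum_rootCoeff b, Finset.sum_eq_single_of_mem k (Finset.mem_univ _),
      P.pairing_same, mul_comm]
    intro l _ hl
    by_cases hlT : l ∈ T
    · rw [pairing_eq_zero_of_isIndepSet hT hlT hkT hl, mul_zero]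
    · rw [hcoeff l hlT]
      simp
  rw [rootCoeff_simple, if_pos rfl, h3] at h2
  have h4 : rootCoeff b (P.reflectionPerm k i) k = - rootCoeff b i k := by
    have : (rootCoeff b (P.reflectionPerm k i) k : ℝ) = - rootCoeff b i k := by
      rw [h2]; push_cast; ring
    exact_mod_cast this
  have := rootCoeff_nonneg hpos k
  have := rootCoeff_nonneg hi k
  lia

namespace Bipartition

variable {b : P.Base} (B : Bipartition b)

/-- A fixed vector has `s_F x = s_U x`, so a combination of roots in `F` equals one of roots in `U`.
By independence all `⟨x, α_k^∨⟩` vanish. -/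
theorem eq_zero_of_fixed {x : M} (h : (B.sU * B.sF) x = x) : x = 0 := by
  classical
  have h1 : B.sF x = B.sU x := by
    have : B.sU ((B.sU * B.sF) x) = B.sF x := by
      rw [LinearEquiv.mul_apply, ← LinearEquiv.mul_apply, B.sU_mul_self]
      rfl
    rw [← this, h]
  rw [sF, sU, reflectionProd_apply, reflectionProd_apply, sub_right_inj] at h1
  have h2 : ∑ k, (if k ∈ B.F then P.coroot' k x else - P.coroot' k x) • b.toWeightBasis k = 0 := by
    have h3 : ∑ k ∈ B.F, P.coroot' k x • P.root k = ∑ k,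
        (if k ∈ B.F then P.coroot' k x else 0) • b.toWeightBasis k := by
      simp only [ite_smul, zero_smul, b.toWeightBasis_apply]
      rw [← Finset.sum_filter, Finset.filter_mem_eq_inter, Finset.univ_inter]
    have h4 : ∑ k ∈ B.U, P.coroot' k x • P.root k = ∑ k,
        (if k ∈ B.U then P.coroot' k x else 0) • b.toWeightBasis k := by
      simp only [ite_smul, zero_smul, b.toWeightBasis_apply]
      rw [← Finset.sum_filter, Finset.filter_mem_eq_inter, Finset.univ_inter]
    rw [h3, h4, ← sub_eq_zero, ← Finset.sum_sub_distrib] at h1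
    rw [← h1]
    refine Finset.sum_congr rfl fun k _ ↦ ?_
    rw [← sub_smul]
    congr 1
    by_cases hk : k ∈ B.F
    · simp [hk, B.mem_U_iff]
    · simp [hk, B.mem_U_iff]
  have h5 := Fintype.linearIndependent_iff.1 b.toWeightBasis.linearIndependent _ h2
  have h6 : ∀ k : b.support, P.coroot' k x = 0 := by
    intro k
    have := h5 k
    split_ifs at this
    · exact this
    · exact neg_eq_zero.1 this
  apply P.toPerfPair.injective
  apply b.toCoweightBasis.ext
  intro k
  rw [b.toCoweightBasis_apply, map_zero]
  exact h6 k

/-- The alternating orbit of the highest root contains a simple root. -/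
theorem exists_alternatingProd_highestRoot_eq :
    ∃ (m : ℕ) (i : b.support),
      B.alternatingProd m (P.root (highestRoot b)) = P.root i := by
  classical
  have hθ : ∀ m, ∃ j, B.alternatingProd m (P.root (highestRoot b)) = P.root j := fun m ↦
    let ⟨j, hj, _⟩ := (B.compatible_alternatingProd m).exists_image (highestRoot b)
    ⟨j, hj⟩
  choose θ hθ using hθ
  have hθ0 : θ 0 = highestRoot b := P.root.injective (by rw [← hθ]; rfl)
  -- The sum over one period of `s_U s_F` is fixed, hence zero. If all terms were positive roots,
  -- each coefficient would vanish, including those of `ξ`, the term of index 0.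
  have hneg : ∃ m, ¬ b.IsPos (θ m) := by
    by_contra! hall
    obtain ⟨n, hn, hpow⟩ := (B.compatible_U.mul B.compatible_F).exists_pow_eq_one_left
    have heven : ∀ k, B.alternatingProd (2 * k) = (B.sU * B.sF) ^ k := by
      intro k
      induction k with
      | zero => rfl
      | succ k ih =>
        rw [Nat.mul_succ, pow_succ', ← ih]
        simp [alternatingProd, mul_assoc]
    set S : M := ∑ k ∈ Finset.range n, P.root (θ (2 * k)) with hS
    have hfix : (B.sU * B.sF) S = S := by
      have h1 : ∀ k, (B.sU * B.sF) (P.root (θ (2 * k))) = P.root (θ (2 * (k + 1))) := by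
        intro k
        rw [← hθ, ← hθ, heven, heven, pow_succ', LinearEquiv.mul_apply (B.sU * B.sF)]
      have h2 : P.root (θ (2 * n)) = P.root (θ (2 * 0)) := by
        rw [← hθ, ← hθ, heven, heven, hpow, pow_zero]
      rw [hS, map_sum, Finset.sum_congr rfl fun k _ ↦ h1 k]
      have h3 := Finset.sum_range_succ (fun k ↦ P.root (θ (2 * k))) n
      rw [Finset.sum_range_succ', h2] at h3
      exact add_right_cancel h3
    have hS0 := B.eq_zero_of_fixed hfix
    obtain ⟨k0⟩ := support_nonempty' b
    have h4 : ∑ m ∈ Finset.range n, (rootCoeff b (θ (2 * m)) k0 : ℝ) = 0 := by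
      have h5 : ∑ k, (∑ m ∈ Finset.range n, (rootCoeff b (θ (2 * m)) k : ℝ)) •
          b.toWeightBasis k = 0 := by
        rw [← hS0, hS]
        simp only [Finset.sum_smul, b.toWeightBasis_apply]
        rw [Finset.sum_comm]
        exact Finset.sum_congr rfl fun m _ ↦ (root_eq_sum b _).symm
      exact Fintype.linearIndependent_iff.1 b.toWeightBasis.linearIndependent _ h5 k0
    have h6 := (Finset.sum_eq_zero_iff_of_nonneg fun m _ ↦ by
      exact_mod_cast rootCoeff_nonneg (hall (2 * m)) k0).1 h4 0 (Finset.mem_range.2 hn)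
    rw [Nat.mul_zero, hθ0] at h6
    have h7 := rootCoeff_highestRoot_pos b k0
    have : rootCoeff b (highestRoot b) k0 = 0 := by exact_mod_cast h6
    lia
  -- At the first negative root, the preceding positive one is made negative by `s_F` or `s_U`,
  -- hence is simple.
  have hm := Nat.find_spec hneg
  have hmin := fun m (h : m < Nat.find hneg) ↦ not_not.1 (Nat.find_min hneg h)
  generalize Nat.find hneg = m at hm hmin
  rcases m with _ | m
  · exact absurd (hθ0 ▸ isPos_highestRoot b) hm
  have hpos := hmin m (Nat.lt_succ_self m)
  have hstep := hθ (m + 1)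
  simp only [alternatingProd] at hstep
  split_ifs at hstep
  · rw [LinearEquiv.mul_apply, hθ] at hstep
    obtain ⟨k, -, hk⟩ := eq_of_pos_of_neg B.indep_F hpos hm hstep
    exact ⟨m, k, by rw [hθ, hk]⟩
  · rw [LinearEquiv.mul_apply, hθ] at hstep
    obtain ⟨k, -, hk⟩ := eq_of_pos_of_neg B.indep_U hpos hm hstep
    exact ⟨m, k, by rw [hθ, hk]⟩

end Bipartition

/-- If `T` contains all nodes adjacent to `k`, then the pairing of `s_T α_k` with `α_k^∨`. -/
theorem toLinearMap_reflectionProd (b : P.Base) (T : Finset b.support)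
    (hT : (dynkinGraph b).IsIndepSet (T : Set b.support)) (i : ι) :
    P.toLinearMap (reflectionProd b T hT (P.root i)) (P.coroot i) =
      2 - ∑ k ∈ T, P.pairing i k * P.pairing k i := by
  rw [reflectionProd_apply]
  simp

theorem isHeavyNode_of_multiple (b : P.Base) {i k : b.support} (h : P.pairing i k ≤ -2)
    (h' : P.pairing k i = -1) : IsHeavyNode b i := by
  have hne : i ≠ k := by
    rintro rfl
    rw [P.pairing_same] at h
    norm_num at h
  have h3 : P.pairing k i * P.RootForm (P.root i) (P.root i)
      = P.pairing i k * P.RootForm (P.root k) (P.root k) :=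
    P.toInvariantForm.pairing_mul_eq_pairing_mul_swap (i : ι) (k : ι)
  have h4 : 0 < P.RootForm (P.root k) (P.root k) :=
    P.rootForm_pos_of_ne_zero (by simp) (P.ne_zero (k : ι))
  refine Or.inr ⟨k, ⟨hne, Or.inl ?_⟩, ?_⟩
  · rw [numEdges]
    have : b.cartanMatrix i k ≤ -2 := by
      rw [← cartanMatrix_cast] at h
      exact_mod_cast h
    lia
  · rw [h'] at h3
    nlinarith

/-- A node which is conjugate to the highest root and has weighted degree three is heavy. -/
theorem isHeavyNode_of_weightedDegree (b : P.Base) {i : b.support} (T : Finset b.support)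
    (hT : ∀ k, (dynkinGraph b).Adj i k → k ∈ T) (hiT : i ∉ T)
    (hlong : ∀ k, (dynkinGraph b).Adj i k → P.pairing k i = -1)
    (hdeg : ∑ k ∈ T, P.pairing i k * P.pairing k i = 3) : IsHeavyNode b i := by
  classical
  by_cases hm : ∃ k, (dynkinGraph b).Adj i k ∧ P.pairing i k ≤ -2
  · obtain ⟨k, hk, hk2⟩ := hm
    exact isHeavyNode_of_multiple b hk2 (hlong k hk)
  push Not at hm
  have hval : ∀ k, (dynkinGraph b).Adj i k → P.pairing i k = -1 := fun k hk ↦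
    (pairing_le_neg_two_or_eq b hk).resolve_left (not_le.2 (hm k hk))
  left
  have hset : (dynkinGraph b).neighborSet i = (T.filter fun k ↦ (dynkinGraph b).Adj i k : Finset _)
      := by
    ext k
    simp only [SimpleGraph.mem_neighborSet, Finset.coe_filter, Set.mem_ofPred_eq]
    exact ⟨fun h ↦ ⟨hT k h, h⟩, fun h ↦ h.2⟩
  rw [hset, Set.ncard_coe_finset]
  have h1 : ∑ k ∈ T, P.pairing i k * P.pairing k i
      = ∑ k ∈ T, if (dynkinGraph b).Adj i k then (1 : ℝ) else 0 := by
    refine Finset.sum_congr rfl fun k hk ↦ ?_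
    split_ifs with h
    · rw [hval k h, hlong k h]
      norm_num
    · have hne : i ≠ k := by
        rintro rfl
        exact hiT hk
      rw [dynkinGraph_adj] at h
      push Not at h
      rw [h hne, zero_mul]
  rw [h1, Finset.sum_boole] at hdeg
  exact_mod_cast hdeg

/-- Serves the case `⟨ξ, α_j^∨⟩ = 2`, where the degree count is not used: a nonzero even Cartan
entry is at most `-2`, and outside type A there is a neighbour to apply this to. -/
theorem isHeavyNode_of_even (b : P.Base) (hA : ¬ IsTypeA b) {i : b.support}
    (hlong : ∀ k, (dynkinGraph b).Adj i k → P.pairing k i = -1)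
    (heven : ∀ k : b.support, ∃ z : ℤ, P.pairing i k = 2 * z) : IsHeavyNode b i := by
  obtain ⟨k, hk⟩ : ∃ k, (dynkinGraph b).Adj i k := by
    by_contra! h
    exact hA (isTypeA_of_forall_not_adj b i h)
  refine isHeavyNode_of_multiple b (k := k) ?_ (hlong k hk)
  refine (pairing_le_neg_two_or_eq b hk).resolve_right fun h ↦ ?_
  obtain ⟨z, hz⟩ := heven k
  rw [h] at hz
  have : (-1 : ℤ) = 2 * z := by exact_mod_cast hz
  lia

namespace Bipartition

variable {b : P.Base} (B : Bipartition b)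

theorem toLinearMap_sF (x : M) (y : N) :
    P.toLinearMap (B.sF x) y = P.toLinearMap x (B.coF y) := by
  rw [← B.compatible_F.pairing_eq x, ← LinearEquiv.mul_apply, B.coF_mul_self]
  rfl

theorem toLinearMap_sU (x : M) (y : N) :
    P.toLinearMap (B.sU x) y = P.toLinearMap x (B.coU y) := by
  rw [← B.compatible_U.pairing_eq x, ← LinearEquiv.mul_apply, B.coU_mul_self]
  rfl

theorem sF_apply_sF (x : M) : B.sF (B.sF x) = x := by
  rw [← LinearEquiv.mul_apply, B.sF_mul_self]
  rfl

theorem sU_apply_sU (x : M) : B.sU (B.sU x) = x := by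
  rw [← LinearEquiv.mul_apply, B.sU_mul_self]
  rfl

/-- Applying `s_F` or `s_U` to both arguments conjugates `s_F s_U` into `s_U s_F`, so each step
exchanges the two pairings; hence both are carried through the induction. -/
theorem toLinearMap_coxeter_alternatingProd (x : M) (y : N) (m : ℕ) (a : ℝ)
    (h1 : P.toLinearMap (B.sF (B.sU x)) y = a) (h2 : P.toLinearMap (B.sU (B.sF x)) y = a) :
    P.toLinearMap (B.sF (B.sU (B.alternatingProd m x))) (B.coAlternatingProd m y) = a ∧
      P.toLinearMap (B.sU (B.sF (B.alternatingProd m x))) (B.coAlternatingProd m y) = a := by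
  induction m with
  | zero => exact ⟨h1, h2⟩
  | succ m ih =>
    simp only [alternatingProd, coAlternatingProd]
    split_ifs
    · rw [LinearEquiv.mul_apply, LinearEquiv.mul_apply, B.compatible_F.pairing_eq, B.sF_apply_sF,
        ← B.toLinearMap_sF]
      exact ⟨ih.2, ih.1⟩
    · rw [LinearEquiv.mul_apply, LinearEquiv.mul_apply, B.compatible_U.pairing_eq, B.sU_apply_sU,
        ← B.toLinearMap_sU]
      exact ⟨ih.2, ih.1⟩

theorem sF_root_of_mem {i : b.support} (hi : i ∈ B.F) : B.sF (P.root i) = - P.root i := by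
  rw [sF, reflectionProd_apply, Finset.sum_eq_single_of_mem i hi]
  · rw [P.root_coroot'_eq_pairing, P.pairing_same]
    module
  · intro k hk hki
    rw [P.root_coroot'_eq_pairing, pairing_eq_zero_of_isIndepSet B.indep_F hi hk hki.symm,
      zero_smul]

theorem sU_root_of_mem {i : b.support} (hi : i ∈ B.U) : B.sU (P.root i) = - P.root i := by
  rw [sU, reflectionProd_apply, Finset.sum_eq_single_of_mem i hi]
  · rw [P.root_coroot'_eq_pairing, P.pairing_same]
    module
  · intro k hk hki
    rw [P.root_coroot'_eq_pairing, pairing_eq_zero_of_isIndepSet B.indep_U hi hk hki.symm,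
      zero_smul]

theorem coroot_of_root {m : ℕ} {i j : ι} (h : B.alternatingProd m (P.root i) = P.root j) :
    B.coAlternatingProd m (P.coroot i) = P.coroot j := by
  obtain ⟨k, h1, h2⟩ := (B.compatible_alternatingProd m).exists_image i
  rw [h2, P.root.injective (h1.symm.trans h)]

/-- The alternating product transports the position of `ξ` in the root system to `α_i`: the bound on
pairings with `ξ^∨` makes all entries `⟨α_k, α_i^∨⟩` at neighbours equal to `-1`, and the Coxeter
pairing, or the parity of pairings, gives the shape of the diagram at `α_i`. -/
theorem isHeavyNode_of_alternatingProd (hA : ¬ IsTypeA b) {m : ℕ} {i : b.support}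
    (h : B.alternatingProd m (P.root (highestRoot b)) = P.root i) : IsHeavyNode b i := by
  classical
  have hco := B.coroot_of_root h
  have hcompat := B.compatible_alternatingProd m
  have hlong : ∀ k, (dynkinGraph b).Adj i k → P.pairing k i = -1 := by
    intro k hk
    refine le_antisymm (pairing_le_neg_one b hk.symm) ?_
    obtain ⟨j, hj, -⟩ := hcompat.exists_preimage k
    have h1 : P.pairing k i = P.pairing j (highestRoot b) := by
      rw [← P.root_coroot_eq_pairing, ← P.root_coroot_eq_pairing, ← hj, ← hco,
        hcompat.pairing_eq]
    rw [h1]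
    apply neg_one_le_pairing_highestRoot
    intro h2
    rw [h2, map_neg, h] at hj
    exact b.root_ne_neg_of_ne i.2 k.2 (fun h3 ↦ hk.ne (Subtype.ext h3))
      (by rw [← hj, neg_neg])
  obtain ⟨j, hj0, hj⟩ := exists_unique_affine_neighbor b hA
  rcases hj with ⟨hj1, hj2⟩ | hj2
  · have hsum : ∀ T : Finset b.support,
        ∑ k ∈ T, P.pairing (highestRoot b) k * P.pairing k (highestRoot b)
          = if j ∈ T then 1 else 0 := by
      intro T
      split_ifs with hjT
      · rw [Finset.sum_eq_single_of_mem j hjT fun k _ hk ↦ by rw [hj0 k hk, zero_mul], hj1, hj2,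
          mul_one]
      · refine Finset.sum_eq_zero fun k hk ↦ ?_
        have : k ≠ j := by
          rintro rfl
          exact hjT hk
        rw [hj0 k this, zero_mul]
    have hfix : ∀ (T : Finset b.support) (hT : (dynkinGraph b).IsIndepSet (T : Set b.support)),
        j ∉ T → reflectionProd b T hT (P.root (highestRoot b)) = P.root (highestRoot b) := by
      intro T hT hjT
      rw [reflectionProd_apply, Finset.sum_eq_zero, sub_zero]
      intro k hk
      have : k ≠ j := by
        rintro rfl
        exact hjT hk
      rw [P.root_coroot'_eq_pairing, hj0 k this, zero_smul]
    -- The part not containing `j` fixes `ξ` and `ξ^∨`; the other part contributes `2 - 1`.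
    have hbase : P.toLinearMap (B.sF (B.sU (P.root (highestRoot b)))) (P.coroot (highestRoot b)) = 1
        ∧ P.toLinearMap (B.sU (B.sF (P.root (highestRoot b)))) (P.coroot (highestRoot b)) = 1 := by
      have hF := toLinearMap_reflectionProd b B.F B.indep_F (highestRoot b)
      have hU := toLinearMap_reflectionProd b B.U B.indep_U (highestRoot b)
      rw [hsum] at hF hU
      change P.toLinearMap (B.sF _) _ = _ at hF
      change P.toLinearMap (B.sU _) _ = _ at hU
      rcases B.cover j with hjF | hjU
      · have hjU : j ∉ B.U := fun h ↦ (B.mem_U_iff j).1 h hjF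
        have hUξ : B.sU (P.root (highestRoot b)) = P.root (highestRoot b) := hfix B.U B.indep_U hjU
        have hUξ' : B.coU (P.coroot (highestRoot b)) = P.coroot (highestRoot b) := by
          obtain ⟨l, h1, h2⟩ := B.compatible_U.exists_image (highestRoot b)
          rw [h2, P.root.injective (h1.symm.trans hUξ)]
        rw [if_pos hjF] at hF
        rw [B.toLinearMap_sU, hUξ', hUξ, hF]
        norm_num
      · have hjF : j ∉ B.F := (B.mem_U_iff j).1 hjU
        have hFξ : B.sF (P.root (highestRoot b)) = P.root (highestRoot b) := hfix B.F B.indep_F hjF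
        have hFξ' : B.coF (P.coroot (highestRoot b)) = P.coroot (highestRoot b) := by
          obtain ⟨l, h1, h2⟩ := B.compatible_F.exists_image (highestRoot b)
          rw [h2, P.root.injective (h1.symm.trans hFξ)]
        rw [if_pos hjU] at hU
        rw [B.toLinearMap_sF, hFξ', hFξ, hU]
        norm_num
    have hinv := B.toLinearMap_coxeter_alternatingProd _ _ m 1 hbase.1 hbase.2
    rw [h, hco] at hinv
    -- The part containing `i` sends `α_i` to `-α_i`, so the invariant 1 equals minus `2 - ∑`, and
    -- the weighted degree is 3.
    rcases B.cover i with hi | hi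
    · refine isHeavyNode_of_weightedDegree b B.U ?_ (fun h ↦ (B.mem_U_iff i).1 h hi) hlong ?_
      · intro k hk
        rw [B.mem_U_iff]
        exact fun hkF ↦ B.indep_F hi hkF hk.ne hk
      · have h1 := hinv.2
        rw [B.sF_root_of_mem hi, map_neg, map_neg, LinearMap.neg_apply] at h1
        have h2 := toLinearMap_reflectionProd b B.U B.indep_U i
        change P.toLinearMap (B.sU _) _ = _ at h2
        linarith
    · refine isHeavyNode_of_weightedDegree b B.F ?_ ((B.mem_U_iff i).1 hi) hlong ?_
      · intro k hk
        by_contra hkF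
        exact B.indep_U hi ((B.mem_U_iff k).2 hkF) hk.ne hk
      · have h1 := hinv.1
        rw [B.sU_root_of_mem hi, map_neg, map_neg, LinearMap.neg_apply] at h1
        have h2 := toLinearMap_reflectionProd b B.F B.indep_F i
        change P.toLinearMap (B.sF _) _ = _ at h2
        linarith
  -- Here `ξ` pairs to 2 with `α_j^∨` and to 0 with the other simple coroots, hence evenly with
  -- every coroot.
  · refine isHeavyNode_of_even b hA hlong fun k ↦ ?_
    obtain ⟨l, -, hl⟩ := hcompat.exists_preimage k
    obtain ⟨f, hf, -⟩ := exists_coroot_eq_sum b l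
    refine ⟨f j, ?_⟩
    have h1 : P.pairing i k = P.pairing (highestRoot b) l := by
      rw [← P.root_coroot_eq_pairing, ← P.root_coroot_eq_pairing, ← hl, ← h, hcompat.pairing_eq]
    rw [h1, ← P.root_coroot_eq_pairing, hf, map_sum, Finset.sum_eq_single_of_mem j
      (Finset.mem_univ _)]
    · rw [map_smul, P.root_coroot_eq_pairing, hj2, smul_eq_mul, mul_comm]
    · intro k' _ hk'
      rw [map_smul, P.root_coroot_eq_pairing, hj0 k' hk', smul_zero]

end Bipartition

end

end LimitWeakOrder

/-! ### Affine roots and their signs at a base point of the alcove. -/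

namespace LimitWeakOrder

open RootPairing

noncomputable section

set_option linter.unusedSectionVars false

variable {ι M N : Type*} [AddCommGroup M] [Module ℝ M] [AddCommGroup N] [Module ℝ N]
  {P : RootPairing ι ℝ M N} [P.IsRootSystem] [Fintype ι]

/-! ### Affine roots -/

/-- The affine function `x ↦ ⟨α_i, x⟩ + k` attached to an affine root `(i, k)`. -/
def affineEval (P : RootPairing ι ℝ M N) (p : ι × ℤ) (x : N) : ℝ :=
  P.root' p.1 x + p.2

theorem affineEval_add (p : ι × ℤ) (x y : N) :
    affineEval P p (x + y) = affineEval P p x + P.root' p.1 y := by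
  simp only [affineEval, map_add]
  ring

theorem affineEval_sub (p : ι × ℤ) (x y : N) :
    affineEval P p (x - y) = affineEval P p x - P.root' p.1 y := by
  simp only [affineEval, map_sub]
  ring

/-- This makes the chosen value of `affineAct` canonical, so that it is a genuine action. -/
theorem eq_of_affineEval_eq {p q : ι × ℤ} (h : ∀ x, affineEval P p x = affineEval P q x) :
    p = q := by
  have h0 : p.2 = q.2 := by
    have := h 0
    simpa [affineEval] using this
  refine Prod.ext ?_ h0
  apply P.root.injective
  apply P.toPerfPair.injective
  ext x
  have := h x
  simp only [affineEval, h0, add_left_inj] at this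
  exact this

/-- The negative of an affine root. -/
def affineNeg (P : RootPairing ι ℝ M N) (p : ι × ℤ) : ι × ℤ :=
  (P.reflectionPerm p.1 p.1, -p.2)

theorem root'_reflectionPerm_self (i : ι) (x : N) :
    P.root' (P.reflectionPerm i i) x = - P.root' i x := by
  simp [RootPairing.root', P.root_reflectionPerm, P.reflection_apply_self]

theorem coroot_reflectionPerm_self (i : ι) :
    P.coroot (P.reflectionPerm i i) = - P.coroot i := by
  rw [P.coroot_reflectionPerm, P.coreflection_apply_self]

theorem affineEval_neg (p : ι × ℤ) (x : N) :
    affineEval P (affineNeg P p) x = - affineEval P p x := by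
  simp only [affineEval, affineNeg, root'_reflectionPerm_self]
  push_cast
  ring

variable [P.IsIrreducible]

/-- The simple affine roots: the simple roots `α_k` and `1 - ξ`. -/
def affineNodeRoot (b : P.Base) : AffineNode b → ι × ℤ
  | some k => (k, 0)
  | none => (P.reflectionPerm (highestRoot b) (highestRoot b), 1)

@[simp] theorem affineEval_some (b : P.Base) (k : b.support) (x : N) :
    affineEval P (affineNodeRoot b (some k)) x = P.root' k x := by
  simp [affineEval, affineNodeRoot]

@[simp] theorem affineEval_none (b : P.Base) (x : N) :
    affineEval P (affineNodeRoot b none) x = 1 - P.root' (highestRoot b) x := by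
  simp only [affineEval, affineNodeRoot, root'_reflectionPerm_self]
  push_cast
  ring

theorem simpleAffineReflection_apply (b : P.Base) (a : AffineNode b) (x : N) :
    simpleAffineReflection b a x =
      x - affineEval P (affineNodeRoot b a) x • P.coroot (affineNodeRoot b a).1 := by
  rcases a with _ | k
  · have : simpleAffineReflection b none x =
        P.coroot (highestRoot b) + P.coreflection (highestRoot b) x := rfl
    rw [this, affineEval_none, P.coreflection_apply]
    simp only [affineNodeRoot, coroot_reflectionPerm_self]
    module
  · have : simpleAffineReflection b (some k) x = P.coreflection k x := rfl
    rw [this, affineEval_some, P.coreflection_apply]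
    rfl

theorem simpleAffineReflection_linear (b : P.Base) (a : AffineNode b) (x : N) :
    (simpleAffineReflection b a).linear x = P.coreflection (affineNodeRoot b a).1 x := by
  rcases a with _ | k
  · have : (simpleAffineReflection b none).linear x = P.coreflection (highestRoot b) x := rfl
    rw [this]
    simp only [affineNodeRoot, P.coreflection_apply, coroot_reflectionPerm_self]
    have := root'_reflectionPerm_self (P := P) (highestRoot b) x
    simp only [RootPairing.root'] at this ⊢
    simp
  · rfl

/-! ### The affine Weyl group and words -/

theorem simple_mul_self (b : P.Base) (a : AffineNode b) : simple b a * simple b a = 1 := by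
  apply Subtype.ext
  apply AffineEquiv.ext
  intro x
  change simpleAffineReflection b a (simpleAffineReflection b a x) = x
  rw [simpleAffineReflection_apply b a (simpleAffineReflection b a x),
    simpleAffineReflection_apply, affineEval_sub]
  simp only [map_smul, P.root'_coroot_eq_pairing, P.pairing_same, smul_eq_mul]
  module

theorem simple_inv (b : P.Base) (a : AffineNode b) : (simple b a)⁻¹ = simple b a :=
  inv_eq_of_mul_eq_one_left (simple_mul_self b a)

theorem wordProd_cons (b : P.Base) (a : AffineNode b) (l : List (AffineNode b)) :
    wordProd b (a :: l) = simple b a * wordProd b l := by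
  simp [wordProd]

theorem wordProd_append (b : P.Base) (l l' : List (AffineNode b)) :
    wordProd b (l ++ l') = wordProd b l * wordProd b l' := by
  simp [wordProd]

theorem wordProd_singleton (b : P.Base) (a : AffineNode b) :
    wordProd b [a] = simple b a := by
  simp [wordProd]

theorem wordProd_reverse (b : P.Base) (l : List (AffineNode b)) :
    wordProd b l.reverse = (wordProd b l)⁻¹ := by
  induction l with
  | nil => simp [wordProd]
  | cons a l ih =>
    rw [List.reverse_cons, wordProd_append, ih, wordProd_singleton, wordProd_cons, mul_inv_rev,
      simple_inv]

theorem exists_wordProd (b : P.Base) (g : affineWeylGroup b) : ∃ l, wordProd b l = g := by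
  obtain ⟨g, hg⟩ := g
  suffices h : ∃ l, (wordProd b l : N ≃ᵃ[ℝ] N) = g by
    obtain ⟨l, hl⟩ := h
    exact ⟨l, Subtype.ext hl⟩
  induction hg using Subgroup.closure_induction with
  | mem x hx =>
    obtain ⟨a, rfl⟩ := hx
    exact ⟨[a], by rw [wordProd_singleton]; rfl⟩
  | one => exact ⟨[], rfl⟩
  | mul x y _ _ hx hy =>
    obtain ⟨l, hl⟩ := hx
    obtain ⟨l', hl'⟩ := hy
    exact ⟨l ++ l', by rw [wordProd_append, Subgroup.coe_mul, hl, hl']⟩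
  | inv x _ hx =>
    obtain ⟨l, hl⟩ := hx
    exact ⟨l.reverse, by rw [wordProd_reverse, Subgroup.coe_inv, hl]⟩

theorem exists_reducedWord (b : P.Base) (g : affineWeylGroup b) :
    ∃ l, IsReducedWord b l ∧ wordProd b l = g := by
  classical
  have h : ∃ n, ∃ l, l.length = n ∧ wordProd b l = g := by
    obtain ⟨l, hl⟩ := exists_wordProd b g
    exact ⟨_, l, rfl, hl⟩
  obtain ⟨l, hl, hg⟩ := Nat.find_spec h
  refine ⟨l, fun l' hl' ↦ ?_, hg⟩
  rw [hl]
  exact Nat.find_min' h ⟨l', rfl, hl'.trans hg⟩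

theorem coe_mul_apply {b : P.Base} (g h : affineWeylGroup b) (x : N) :
    (g * h).1 x = g.1 (h.1 x) := rfl

theorem inv_apply_apply {b : P.Base} (g : affineWeylGroup b) (x : N) :
    (g⁻¹).1 (g.1 x) = x := by
  rw [← coe_mul_apply, inv_mul_cancel]
  rfl

theorem apply_inv_apply {b : P.Base} (g : affineWeylGroup b) (x : N) :
    g.1 ((g⁻¹).1 x) = x := by
  rw [← coe_mul_apply, mul_inv_cancel]
  rfl

/-! ### The action on affine roots -/

section Action

variable [P.IsCrystallographic]

/-- The clause about coroots is needed because a reflection depends on both an affine function and a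
coroot; it enters the conjugation formula for reflections. -/
theorem exists_affineAct_simple (b : P.Base) (a : AffineNode b) (p : ι × ℤ) :
    ∃ q : ι × ℤ, (∀ x, affineEval P q ((simple b a).1 x) = affineEval P p x) ∧
      (simple b a).1.linear (P.coroot p.1) = P.coroot q.1 := by
  set r := affineNodeRoot b a with hr
  obtain ⟨z, hz⟩ := exists_pairing_eq_int (P := P) p.1 r.1
  have h1 : ∀ x, P.root' (P.reflectionPerm r.1 p.1) x
      = P.root' p.1 x - P.pairing p.1 r.1 * P.root' r.1 x := by
    intro x
    simp [RootPairing.root', P.root_reflectionPerm, P.reflection_apply, P.root_coroot_eq_pairing]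
  refine ⟨(P.reflectionPerm r.1 p.1, p.2 - z * r.2), fun x ↦ ?_, ?_⟩
  · change affineEval P _ (simpleAffineReflection b a x) = _
    rw [simpleAffineReflection_apply, affineEval_sub, ← hr]
    simp only [affineEval, map_smul, h1, P.root'_coroot_eq_pairing, P.pairing_same, hz,
      smul_eq_mul]
    push_cast
    ring
  · change (simpleAffineReflection b a).linear _ = _
    rw [simpleAffineReflection_linear, P.coroot_reflectionPerm]

theorem exists_affineAct (b : P.Base) (g : affineWeylGroup b) (p : ι × ℤ) :
    ∃ q : ι × ℤ, (∀ x, affineEval P q (g.1 x) = affineEval P p x) ∧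
      g.1.linear (P.coroot p.1) = P.coroot q.1 := by
  obtain ⟨l, rfl⟩ := exists_wordProd b g
  induction l with
  | nil => exact ⟨p, fun x ↦ rfl, rfl⟩
  | cons a l ih =>
    obtain ⟨q, hq, hq'⟩ := ih
    obtain ⟨r, hr, hr'⟩ := exists_affineAct_simple b a q
    refine ⟨r, fun x ↦ ?_, ?_⟩
    · rw [wordProd_cons, coe_mul_apply, hr, hq]
    · rw [wordProd_cons, ← hr', ← hq']
      rfl

/-- The action of the affine Weyl group on affine roots. -/
def affineAct (b : P.Base) (g : affineWeylGroup b) (p : ι × ℤ) : ι × ℤ :=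
  (exists_affineAct b g p).choose

theorem affineEval_affineAct (b : P.Base) (g : affineWeylGroup b) (p : ι × ℤ) (x : N) :
    affineEval P (affineAct b g p) (g.1 x) = affineEval P p x :=
  (exists_affineAct b g p).choose_spec.1 x

theorem affineEval_affineAct' (b : P.Base) (g : affineWeylGroup b) (p : ι × ℤ) (x : N) :
    affineEval P (affineAct b g p) x = affineEval P p ((g⁻¹).1 x) := by
  have := affineEval_affineAct b g p ((g⁻¹).1 x)
  rwa [apply_inv_apply] at this

theorem linear_coroot (b : P.Base) (g : affineWeylGroup b) (p : ι × ℤ) :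
    g.1.linear (P.coroot p.1) = P.coroot (affineAct b g p).1 :=
  (exists_affineAct b g p).choose_spec.2

theorem affineAct_mul (b : P.Base) (g h : affineWeylGroup b) (p : ι × ℤ) :
    affineAct b (g * h) p = affineAct b g (affineAct b h p) := by
  apply eq_of_affineEval_eq (P := P)
  intro x
  simp only [affineEval_affineAct', mul_inv_rev, coe_mul_apply]

theorem affineAct_one (b : P.Base) (p : ι × ℤ) : affineAct b 1 p = p := by
  apply eq_of_affineEval_eq (P := P)
  intro x
  rw [affineEval_affineAct', inv_one]
  rfl

theorem affineAct_affineAct_inv (b : P.Base) (g : affineWeylGroup b) (p : ι × ℤ) :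
    affineAct b g (affineAct b g⁻¹ p) = p := by
  rw [← affineAct_mul, mul_inv_cancel, affineAct_one]

/-- `t` is the reflection in the zero set of the affine root `p`. -/
def IsReflectionIn {b : P.Base} (t : affineWeylGroup b) (p : ι × ℤ) : Prop :=
  ∀ x, t.1 x = x - affineEval P p x • P.coroot p.1

theorem isReflectionIn_simple (b : P.Base) (a : AffineNode b) :
    IsReflectionIn (simple b a) (affineNodeRoot b a) :=
  simpleAffineReflection_apply b a

theorem IsReflectionIn.conj {b : P.Base} {t : affineWeylGroup b} {p : ι × ℤ}
    (h : IsReflectionIn t p) (g : affineWeylGroup b) :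
    IsReflectionIn (g * t * g⁻¹) (affineAct b g p) := by
  intro x
  rw [coe_mul_apply, coe_mul_apply, h, affineEval_affineAct', ← linear_coroot]
  have h1 : ∀ y v : N, g.1 (y - v) = g.1 y - g.1.linear v := by
    intro y v
    have := g.1.map_vadd y (-v)
    simp only [vadd_eq_add, map_neg] at this
    rw [sub_eq_neg_add, this]
    abel
  rw [h1, map_smul, apply_inv_apply]

theorem IsReflectionIn.neg {b : P.Base} {t : affineWeylGroup b} {p : ι × ℤ}
    (h : IsReflectionIn t p) : IsReflectionIn t (affineNeg P p) := by
  intro x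
  rw [h, affineEval_neg]
  simp only [affineNeg, coroot_reflectionPerm_self]
  module

theorem IsReflectionIn.unique {b : P.Base} {t t' : affineWeylGroup b} {p : ι × ℤ}
    (h : IsReflectionIn t p) (h' : IsReflectionIn t' p) : t = t' :=
  Subtype.ext (AffineEquiv.ext fun x ↦ (h x).trans (h' x).symm)

end Action

/-! ### The base point -/

variable [P.IsCrystallographic] [P.IsReduced]

/-- The comarks of the affine diagram. -/
def affineComark (b : P.Base) : AffineNode b → ℝ
  | some k => comark b k
  | none => 1

theorem affineComark_pos (b : P.Base) (a : AffineNode b) : 0 < affineComark b a := by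
  rcases a with _ | k
  · exact one_pos
  · exact Int.cast_pos.2 (comark_pos b k)

theorem root'_eq_sum (b : P.Base) (i : ι) (x : N) :
    P.root' i x = ∑ k : b.support, (rootCoeff b i k : ℝ) * P.root' k x := by
  simp only [RootPairing.root']
  rw [root_eq_sum b i]
  simp

/-- A common multiple of the affine comarks, normalized by the equation `α_0 + ξ = 1`. -/
def baseScale (b : P.Base) : ℝ :=
  (1 + ∑ k : b.support, (rootCoeff b (highestRoot b) k : ℝ) * comark b k)⁻¹

theorem one_add_sum_marks_pos (b : P.Base) :
    0 < 1 + ∑ k : b.support, (rootCoeff b (highestRoot b) k : ℝ) * comark b k := by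
  have : 0 ≤ ∑ k : b.support, (rootCoeff b (highestRoot b) k : ℝ) * comark b k :=
    Finset.sum_nonneg fun k _ ↦ mul_nonneg
      (by exact_mod_cast (rootCoeff_highestRoot_pos b k).le) (by exact_mod_cast (comark_pos b k).le)
  linarith

theorem baseScale_pos (b : P.Base) : 0 < baseScale b :=
  inv_pos.2 (one_add_sum_marks_pos b)

/-- The base point of the fundamental alcove, at which the simple affine roots take values
proportional to the comarks. -/
def basePoint (b : P.Base) : N :=
  baseScale b • ∑ k : b.support, (comark b k : ℝ) • fundamentalCoweight b k

theorem root'_basePoint (b : P.Base) (k : b.support) :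
    P.root' k (basePoint b) = baseScale b * comark b k := by
  classical
  simp only [basePoint, map_smul, map_sum, root'_fundamentalCoweight, smul_eq_mul]
  simp

theorem affineEval_basePoint (b : P.Base) (a : AffineNode b) :
    affineEval P (affineNodeRoot b a) (basePoint b) = baseScale b * affineComark b a := by
  rcases a with _ | k
  · rw [affineEval_none, root'_eq_sum b]
    simp only [root'_basePoint, affineComark]
    have h1 : baseScale b * (1 + ∑ k : b.support, (rootCoeff b (highestRoot b) k : ℝ) * comark b k)
        = 1 :=
      inv_mul_cancel₀ (one_add_sum_marks_pos b).ne'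
    have h2 : ∑ k : b.support, (rootCoeff b (highestRoot b) k : ℝ) * (baseScale b * comark b k)
        = baseScale b * ∑ k : b.support, (rootCoeff b (highestRoot b) k : ℝ) * comark b k := by
      rw [Finset.mul_sum]
      exact Finset.sum_congr rfl fun k _ ↦ by ring
    rw [h2]
    linarith
  · rw [affineEval_some, root'_basePoint]
    rfl

theorem affineEval_basePoint_pos (b : P.Base) (a : AffineNode b) :
    0 < affineEval P (affineNodeRoot b a) (basePoint b) := by
  rw [affineEval_basePoint]
  exact mul_pos (baseScale_pos b) (affineComark_pos b a)

/-- The coefficients of an affine root with respect to the simple affine roots. -/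
def affineCoeff (b : P.Base) (p : ι × ℤ) : AffineNode b → ℤ
  | some k => p.2 * rootCoeff b (highestRoot b) k + rootCoeff b p.1 k
  | none => p.2

theorem affineEval_eq_sum (b : P.Base) (p : ι × ℤ) (x : N) :
    affineEval P p x = ∑ a, (affineCoeff b p a : ℝ) * affineEval P (affineNodeRoot b a) x := by
  rw [Fintype.sum_option]
  simp only [affineEval_some, affineEval_none, affineCoeff]
  rw [root'_eq_sum b (highestRoot b), affineEval, root'_eq_sum b p.1]
  have : ∑ k : b.support, (((p.2 * rootCoeff b (highestRoot b) k + rootCoeff b p.1 k : ℤ) : ℝ) *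
      P.root' k x) = p.2 * ∑ k : b.support, (rootCoeff b (highestRoot b) k : ℝ) * P.root' k x +
      ∑ k : b.support, (rootCoeff b p.1 k : ℝ) * P.root' k x := by
    rw [Finset.mul_sum, ← Finset.sum_add_distrib]
    refine Finset.sum_congr rfl fun k _ ↦ ?_
    push_cast
    ring
  rw [this]
  ring

/-- A nonzero constant term decides the sign, since finite coefficients are bounded in absolute
value by those of `ξ`. With constant term zero this is the dichotomy for finite roots. -/
theorem affineCoeff_nonneg_or_nonpos (b : P.Base) (p : ι × ℤ) :
    (∀ a, 0 ≤ affineCoeff b p a) ∨ ∀ a, affineCoeff b p a ≤ 0 := by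
  rcases lt_trichotomy p.2 0 with h | h | h
  · right
    rintro (_ | k)
    · exact h.le
    · have h1 := rootCoeff_le_highestRoot b p.1 k
      have h2 := rootCoeff_highestRoot_pos b k
      simp only [affineCoeff]
      nlinarith
  · rcases rootCoeff_nonneg_or_nonpos b p.1 with h1 | h1
    · left
      rintro (_ | k)
      · exact h.ge
      · simpa [affineCoeff, h] using h1 k
    · right
      rintro (_ | k)
      · exact h.le
      · simpa [affineCoeff, h] using h1 k
  · left
    rintro (_ | k)
    · exact h.le
    · have h1 := neg_highestRoot_le_rootCoeff b p.1 k
      have h2 := rootCoeff_highestRoot_pos b k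
      simp only [affineCoeff]
      nlinarith

theorem exists_affineCoeff_ne_zero (b : P.Base) (p : ι × ℤ) : ∃ a, affineCoeff b p a ≠ 0 := by
  by_cases h : p.2 = 0
  · obtain ⟨k, hk⟩ := exists_rootCoeff_ne_zero b p.1
    exact ⟨some k, by simpa [affineCoeff, h] using hk⟩
  · exact ⟨none, h⟩

theorem affineEval_pos_of_coeff {b : P.Base} {p : ι × ℤ} {x : N}
    (hp : ∀ a, 0 ≤ affineCoeff b p a) (hx : ∀ a, 0 ≤ affineEval P (affineNodeRoot b a) x)
    (h : ∃ a, affineCoeff b p a ≠ 0 ∧ affineEval P (affineNodeRoot b a) x ≠ 0) :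
    0 < affineEval P p x := by
  rw [affineEval_eq_sum b]
  obtain ⟨a, ha, ha'⟩ := h
  refine Finset.sum_pos' (fun a _ ↦ mul_nonneg (by exact_mod_cast hp a) (hx a))
    ⟨a, Finset.mem_univ a, mul_pos ?_ (lt_of_le_of_ne (hx a) ha'.symm)⟩
  exact_mod_cast lt_of_le_of_ne (hp a) ha.symm

theorem affineEval_nonpos_of_coeff {b : P.Base} {p : ι × ℤ} {x : N}
    (hp : ∀ a, affineCoeff b p a ≤ 0) (hx : ∀ a, 0 ≤ affineEval P (affineNodeRoot b a) x) :
    affineEval P p x ≤ 0 := by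
  rw [affineEval_eq_sum b]
  exact Finset.sum_nonpos fun a _ ↦ mul_nonpos_of_nonpos_of_nonneg (by exact_mod_cast hp a) (hx a)

/-- An affine root is positive if it is positive at the base point. -/
def IsPosAffine (b : P.Base) (p : ι × ℤ) : Prop := 0 < affineEval P p (basePoint b)

theorem IsPosAffine.coeff_nonneg {b : P.Base} {p : ι × ℤ} (h : IsPosAffine b p) (a : AffineNode b) :
    0 ≤ affineCoeff b p a := by
  rcases affineCoeff_nonneg_or_nonpos b p with h' | h'
  · exact h' a
  · exact absurd (affineEval_nonpos_of_coeff h' fun a ↦ (affineEval_basePoint_pos b a).le)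
      (not_le.2 h)

theorem isPosAffine_of_coeff_nonneg {b : P.Base} {p : ι × ℤ} (h : ∀ a, 0 ≤ affineCoeff b p a) :
    IsPosAffine b p := by
  obtain ⟨a, ha⟩ := exists_affineCoeff_ne_zero b p
  exact affineEval_pos_of_coeff h (fun a ↦ (affineEval_basePoint_pos b a).le)
    ⟨a, ha, (affineEval_basePoint_pos b a).ne'⟩

theorem not_isPosAffine_iff {b : P.Base} {p : ι × ℤ} :
    ¬ IsPosAffine b p ↔ affineEval P p (basePoint b) < 0 := by
  refine ⟨fun h ↦ ?_, fun h h' ↦ lt_asymm h h'⟩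
  rcases affineCoeff_nonneg_or_nonpos b p with h' | h'
  · exact absurd (isPosAffine_of_coeff_nonneg h') h
  · refine lt_of_le_of_ne (affineEval_nonpos_of_coeff h' fun a ↦ (affineEval_basePoint_pos b a).le)
      fun h0 ↦ ?_
    rw [affineEval_eq_sum b, Finset.sum_eq_zero_iff_of_nonpos fun a _ ↦
      mul_nonpos_of_nonpos_of_nonneg (by exact_mod_cast h' a) (affineEval_basePoint_pos b a).le]
      at h0
    obtain ⟨a, ha⟩ := exists_affineCoeff_ne_zero b p
    have := h0 a (Finset.mem_univ a)
    rw [mul_eq_zero] at this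
    rcases this with h1 | h1
    · exact ha (by exact_mod_cast h1)
    · exact (affineEval_basePoint_pos b a).ne' h1

theorem isPosAffine_affineNeg {b : P.Base} {p : ι × ℤ} :
    IsPosAffine b (affineNeg P p) ↔ ¬ IsPosAffine b p := by
  rw [not_isPosAffine_iff, IsPosAffine, affineEval_neg, Left.neg_pos_iff]

theorem coroot_eq_or_eq_neg {i j : ι} {c : ℝ} (h : P.coroot i = c • P.coroot j) :
    i = j ∨ P.coroot i = - P.coroot j := by
  have : Module.IsReflexive ℝ N := .of_isPerfPair P.flip.toLinearMap
  have h1 : ¬ LinearIndependent ℝ ![P.flip.root i, P.flip.root j] := by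
    simp only [LinearIndependent.pair_iff, not_forall]
    exact ⟨1, -c, by simp [h], by simp⟩
  rcases IsReduced.eq_or_eq_neg (P := P.flip) i j h1 with h2 | h2
  · exact Or.inl (P.coroot.injective h2)
  · exact Or.inr h2

theorem root_eq_or_eq_neg {i j : ι} {c : ℝ} (h : P.root i = c • P.root j) :
    i = j ∨ P.root i = - P.root j := by
  have h1 : ¬ LinearIndependent ℝ ![P.root i, P.root j] := by
    simp only [LinearIndependent.pair_iff, not_forall]
    exact ⟨1, -c, by simp [h], by simp⟩
  rcases IsReduced.eq_or_eq_neg (P := P) i j h1 with h2 | h2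
  · exact Or.inl (P.root.injective h2)
  · exact Or.inr h2

/-- Lets inversion sets, defined as sets of reflections, be replaced by sets of positive affine
roots. -/
theorem IsReflectionIn.unique_root {b : P.Base} {t : affineWeylGroup b} {p q : ι × ℤ}
    (hp : IsReflectionIn t p) (hq : IsReflectionIn t q) (h : IsPosAffine b p)
    (h' : IsPosAffine b q) : p = q := by
  have key : ∀ x, affineEval P p x • P.coroot p.1 = affineEval P q x • P.coroot q.1 := fun x ↦
    sub_right_injective ((hp x).symm.trans (hq x))
  have h0 := key (basePoint b)
  have h1 : p.1 = q.1 := by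
    have h2 : P.coroot p.1 = ((affineEval P p (basePoint b))⁻¹ * affineEval P q (basePoint b)) •
        P.coroot q.1 := by
      rw [mul_smul, ← h0, inv_smul_smul₀ (ne_of_gt h)]
    rcases coroot_eq_or_eq_neg h2 with h3 | h3
    · exact h3
    · exfalso
      have h4 : (affineEval P p (basePoint b) + affineEval P q (basePoint b)) • P.coroot q.1 = 0 := by
        rw [add_smul, ← h0, h3]
        simp
      rw [smul_eq_zero] at h4
      rcases h4 with h4 | h4
      · unfold IsPosAffine at h h'
        linarith
      · exact P.flip.ne_zero q.1 h4
  apply eq_of_affineEval_eq (P := P)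
  intro x
  have := key x
  rw [h1] at this
  exact smul_left_injective ℝ (P.flip.ne_zero q.1) this

theorem pairing_affineNodeRoot_nonpos (b : P.Base) {a a' : AffineNode b} (h : a ≠ a') :
    P.pairing (affineNodeRoot b a).1 (affineNodeRoot b a').1 ≤ 0 := by
  rcases a with _ | k <;> rcases a' with _ | l
  · exact absurd rfl h
  · simpa [affineNodeRoot] using pairing_highestRoot_nonneg b l
  · simpa [affineNodeRoot] using pairing_highestRoot_nonneg' b k
  · exact pairing_nonpos b fun he ↦ h (by rw [he])

/-- A simple affine reflection permutes the positive affine roots other than its own root. -/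
theorem isPosAffine_simple {b : P.Base} {p : ι × ℤ} {a : AffineNode b} (h : IsPosAffine b p)
    (hne : p ≠ affineNodeRoot b a) : 0 < affineEval P p ((simple b a).1 (basePoint b)) := by
  set r := affineNodeRoot b a with hr
  -- The midpoint of the base point and its mirror image lies on the wall of `a`. The other simple
  -- affine roots stay positive there because their pairings with the coroot of `a` are nonpositive.
  set y : N := basePoint b - ((1 / 2 : ℝ) * affineEval P r (basePoint b)) • P.coroot r.1 with hy
  have hy0 : affineEval P r y = 0 := by
    rw [hy, affineEval_sub, map_smul, P.root'_coroot_eq_pairing, P.pairing_same, smul_eq_mul]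
    ring
  have hya : ∀ a', a' ≠ a → 0 < affineEval P (affineNodeRoot b a') y := by
    intro a' ha'
    rw [hy, affineEval_sub, map_smul, P.root'_coroot_eq_pairing, smul_eq_mul]
    have h1 := affineEval_basePoint_pos b a'
    have h2 := pairing_affineNodeRoot_nonpos b ha'
    have h3 : 0 < affineEval P r (basePoint b) := affineEval_basePoint_pos b a
    rw [← hr] at h2
    nlinarith
  have hyn : ∀ a', 0 ≤ affineEval P (affineNodeRoot b a') y := by
    intro a'
    rcases eq_or_ne a' a with rfl | h'
    · exact hy0.ge
    · exact (hya a' h').le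
  have hsy : (simple b a).1 y = y := by
    rw [isReflectionIn_simple b a y, ← hr, hy0]
    simp
  set q := affineAct b (simple b a) p with hq
  have hqy : affineEval P q y = affineEval P p y := by
    have := affineEval_affineAct b (simple b a) p y
    rwa [hsy] at this
  have hqx : affineEval P p ((simple b a).1 (basePoint b)) = affineEval P q (basePoint b) := by
    rw [hq, affineEval_affineAct', simple_inv]
  -- If only the coefficient of `a` is nonzero, reducedness forces `p` to be the root of `a`.
  -- Otherwise `p` is positive at `y`, where it agrees with its image `q`, and so `q` cannot be
  -- negative.
  by_cases hz : ∀ a', a' ≠ a → affineCoeff b p a' = 0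
  · exfalso
    have h1 : ∀ x, affineEval P p x = affineCoeff b p a * affineEval P r x := by
      intro x
      rw [affineEval_eq_sum b, Finset.sum_eq_single a]
      · intro a' _ ha'
        rw [hz a' ha']
        simp
      · simp
    have h2 := h1 0
    simp only [affineEval, map_zero, zero_add] at h2
    have h3 : P.root p.1 = (affineCoeff b p a : ℝ) • P.root r.1 := by
      apply P.toPerfPair.injective
      ext x
      have := h1 x
      simp only [affineEval, mul_add, ← h2, add_left_inj] at this
      simpa [RootPairing.root'] using this
    have h4 : (0 : ℝ) ≤ affineCoeff b p a := by exact_mod_cast h.coeff_nonneg a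
    rcases root_eq_or_eq_neg h3 with h5 | h5
    · have h6 : (affineCoeff b p a : ℝ) = 1 := by
        rw [h5] at h3
        have : (1 : ℝ) • P.root r.1 = (affineCoeff b p a : ℝ) • P.root r.1 := by rwa [one_smul]
        exact (smul_left_injective ℝ (P.ne_zero r.1) this).symm
      apply hne
      apply eq_of_affineEval_eq (P := P)
      intro x
      rw [h1, h6, one_mul]
    · rw [h5] at h3
      have : (-1 : ℝ) • P.root r.1 = (affineCoeff b p a : ℝ) • P.root r.1 := by
        rwa [neg_one_smul]
      have := smul_left_injective ℝ (P.ne_zero r.1) this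
      linarith
  · push Not at hz
    obtain ⟨a', ha', hne'⟩ := hz
    have h1 : 0 < affineEval P p y :=
      affineEval_pos_of_coeff h.coeff_nonneg hyn ⟨a', hne', (hya a' ha').ne'⟩
    rw [hqx]
    by_contra hneg
    have h2 : ∀ a, affineCoeff b q a ≤ 0 := by
      rcases affineCoeff_nonneg_or_nonpos b q with h' | h'
      · exact absurd (isPosAffine_of_coeff_nonneg h') hneg
      · exact h'
    have h3 := affineEval_nonpos_of_coeff h2 hyn
    rw [hqy] at h3
    linarith

end

end LimitWeakOrder

/-! ### Walks of alcoves, reducedness, and inversion sets of periodic words. -/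

namespace LimitWeakOrder

open RootPairing

noncomputable section

set_option linter.unusedSectionVars false

variable {ι M N : Type*} [AddCommGroup M] [Module ℝ M] [AddCommGroup N] [Module ℝ N]
  {P : RootPairing ι ℝ M N} [P.IsRootSystem] [Fintype ι] [P.IsIrreducible] [P.IsCrystallographic]
  [P.IsReduced]

/-! ### Inversions along a word -/

theorem wordPrefix_succ {b : P.Base} (w : ℕ → AffineNode b) (k : ℕ) :
    wordPrefix w (k + 1) = wordPrefix w k ++ [w k] := by
  simp [wordPrefix, List.range_succ]

theorem length_wordPrefix {b : P.Base} (w : ℕ → AffineNode b) (k : ℕ) :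
    (wordPrefix w k).length = k := by
  simp [wordPrefix]

theorem wordPrefix_add {b : P.Base} (w : ℕ → AffineNode b) (j k : ℕ) :
    wordPrefix w (j + k) = wordPrefix w j ++ wordPrefix (fun m ↦ w (j + m)) k := by
  simp [wordPrefix, List.range_add, Function.comp_def]

theorem wordPrefix_getD {b : P.Base} (l : List (AffineNode b)) :
    wordPrefix (fun m ↦ l.getD m none) l.length = l := by
  apply List.ext_getElem
  · simp [wordPrefix]
  · intro n h1 h2
    simp [wordPrefix, h2]

/-- The element represented by the prefix of length `k` of an infinite word. -/
def prefixProd (b : P.Base) (w : ℕ → AffineNode b) (k : ℕ) : affineWeylGroup b :=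
  wordProd b (wordPrefix w k)

theorem prefixProd_zero (b : P.Base) (w : ℕ → AffineNode b) : prefixProd b w 0 = 1 := rfl

theorem prefixProd_succ (b : P.Base) (w : ℕ → AffineNode b) (k : ℕ) :
    prefixProd b w (k + 1) = prefixProd b w k * simple b (w k) := by
  rw [prefixProd, wordPrefix_succ, wordProd_append, wordProd_singleton, prefixProd]

/-- The affine root attached to the `k`-th letter of an infinite word. -/
def stepRoot (b : P.Base) (w : ℕ → AffineNode b) (k : ℕ) : ι × ℤ :=
  affineAct b (prefixProd b w k) (affineNodeRoot b (w k))

theorem affineEval_stepRoot_pos (b : P.Base) (w : ℕ → AffineNode b) (k : ℕ) :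
    0 < affineEval P (stepRoot b w k) ((prefixProd b w k).1 (basePoint b)) := by
  rw [stepRoot, affineEval_affineAct]
  exact affineEval_basePoint_pos b _

theorem affineEval_stepRoot_neg (b : P.Base) (w : ℕ → AffineNode b) (k : ℕ) :
    affineEval P (stepRoot b w k) ((prefixProd b w (k + 1)).1 (basePoint b)) < 0 := by
  rw [stepRoot, prefixProd_succ, coe_mul_apply, affineEval_affineAct,
    isReflectionIn_simple b _ _, affineEval_sub, map_smul, P.root'_coroot_eq_pairing,
    P.pairing_same, smul_eq_mul]
  have := affineEval_basePoint_pos b (w k)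
  linarith

/-- Passing from one alcove to the next crosses a single hyperplane, that of the step root. -/
theorem affineEval_prefixProd_succ_pos {b : P.Base} {w : ℕ → AffineNode b} {k : ℕ} {p : ι × ℤ}
    (h : 0 < affineEval P p ((prefixProd b w k).1 (basePoint b))) (hne : p ≠ stepRoot b w k) :
    0 < affineEval P p ((prefixProd b w (k + 1)).1 (basePoint b)) := by
  have h1 : IsPosAffine b (affineAct b (prefixProd b w k)⁻¹ p) := by
    rw [IsPosAffine, affineEval_affineAct', inv_inv]
    exact h
  have h2 := isPosAffine_simple (a := w k) h1 fun h' ↦ hne (by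
    rw [stepRoot, ← h', affineAct_affineAct_inv])
  rwa [affineEval_affineAct', inv_inv, ← coe_mul_apply, ← prefixProd_succ] at h2

theorem exists_stepRoot_eq {b : P.Base} {w : ℕ → AffineNode b} {p : ι × ℤ} (h : IsPosAffine b p)
    {k : ℕ} (hk : affineEval P p ((prefixProd b w k).1 (basePoint b)) < 0) :
    ∃ i < k, p = stepRoot b w i := by
  induction k with
  | zero => exact absurd hk (not_lt.2 h.le)
  | succ k ih =>
    by_cases h1 : p = stepRoot b w k
    · exact ⟨k, k.lt_succ_self, h1⟩
    · by_cases h2 : affineEval P p ((prefixProd b w k).1 (basePoint b)) < 0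
      · obtain ⟨i, hi, rfl⟩ := ih h2
        exact ⟨i, hi.trans k.lt_succ_self, rfl⟩
      · have h3 : 0 < affineEval P p ((prefixProd b w k).1 (basePoint b)) := by
          have h4 : IsPosAffine b (affineAct b (prefixProd b w k)⁻¹ p) := by
            by_contra h5
            rw [not_isPosAffine_iff, affineEval_affineAct', inv_inv] at h5
            exact h2 h5
          rwa [IsPosAffine, affineEval_affineAct', inv_inv] at h4
        exact absurd hk (not_lt.2 (affineEval_prefixProd_succ_pos h3 h1).le)

theorem isReflectionIn_stepRoot (b : P.Base) (w : ℕ → AffineNode b) (k : ℕ) :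
    IsReflectionIn (prefixProd b w k * simple b (w k) * (prefixProd b w k)⁻¹) (stepRoot b w k) :=
  (isReflectionIn_simple b (w k)).conj _

theorem exists_word_between (b : P.Base) (w : ℕ → AffineNode b) (j m : ℕ) :
    ∃ l : List (AffineNode b), l.length = m ∧
      prefixProd b w (j + m) = prefixProd b w j * wordProd b l :=
  ⟨wordPrefix (fun m ↦ w (j + m)) m, length_wordPrefix _ _, by
    rw [prefixProd, wordPrefix_add, wordProd_append, prefixProd]⟩

/-- A negative step root means that its hyperplane was crossed before, at some `j < i`. The two
reflections coincide, so letters `j` and `i` can be deleted and the word was not reduced. -/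
theorem isPosAffine_stepRoot {b : P.Base} {w : ℕ → AffineNode b} {k : ℕ}
    (h : IsReducedWord b (wordPrefix w k)) {i : ℕ} (hi : i < k) :
    IsPosAffine b (stepRoot b w i) := by
  by_contra hneg
  have h1 : affineEval P (affineNeg P (stepRoot b w i)) ((prefixProd b w i).1 (basePoint b)) < 0 := by
    rw [affineEval_neg]
    have := affineEval_stepRoot_pos b w i
    linarith
  obtain ⟨j, hj, hij⟩ := exists_stepRoot_eq (isPosAffine_affineNeg.2 hneg) h1
  have h2 := (isReflectionIn_stepRoot b w i).neg
  rw [hij] at h2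
  have h3 := h2.unique (isReflectionIn_stepRoot b w j)
  obtain ⟨m, rfl⟩ := Nat.exists_eq_add_of_lt hj
  obtain ⟨m', rfl⟩ := Nat.exists_eq_add_of_lt hi
  obtain ⟨l, hl, hl'⟩ := exists_word_between b w (j + 1) m
  obtain ⟨l', hm, hm'⟩ := exists_word_between b w (j + m + 1 + 1) m'
  have e1 : prefixProd b w (j + m + 1 + 1) = prefixProd b w j * wordProd b l := by
    rw [prefixProd_succ]
    have e2 : prefixProd b w (j + m + 1) * simple b (w (j + m + 1)) =
        (prefixProd b w j * simple b (w j) * (prefixProd b w j)⁻¹) * prefixProd b w (j + m + 1) := by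
      rw [← h3]
      group
    rw [e2, show j + m + 1 = j + 1 + m by ring, hl', prefixProd_succ]
    have e3 := simple_mul_self b (w j)
    calc _ = prefixProd b w j * (simple b (w j) * simple b (w j)) * wordProd b l := by group
      _ = _ := by rw [e3]; group
  have e4 : wordProd b (wordPrefix w j ++ l ++ l') =
      wordProd b (wordPrefix w (j + m + 1 + m' + 1)) := by
    rw [wordProd_append, wordProd_append]
    change prefixProd b w j * _ * _ = prefixProd b w _
    rw [show j + m + 1 + m' + 1 = j + m + 1 + 1 + m' by ring, hm', e1]
  have := h _ e4
  simp only [List.length_append, length_wordPrefix, hl, hm] at this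
  omega

/-- Crossing the same hyperplane back would make a later step root the negative of an earlier one,
but both are positive. -/
theorem affineEval_stepRoot_neg_of_lt {b : P.Base} {w : ℕ → AffineNode b} {k : ℕ}
    (h : ∀ i < k, IsPosAffine b (stepRoot b w i)) {i j : ℕ} (hij : i < j) (hj : j ≤ k) :
    affineEval P (stepRoot b w i) ((prefixProd b w j).1 (basePoint b)) < 0 := by
  induction j, hij using Nat.le_induction with
  | base => exact affineEval_stepRoot_neg b w i
  | succ j hij ih =>
    have h1 := ih (by omega)
    have h2 : 0 < affineEval P (affineNeg P (stepRoot b w i))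
        ((prefixProd b w j).1 (basePoint b)) := by
      rw [affineEval_neg]
      linarith
    have h3 := affineEval_prefixProd_succ_pos h2 fun h' ↦ by
      have h4 := h j (by omega)
      rw [← h', isPosAffine_affineNeg] at h4
      exact h4 (h i (by omega))
    rw [affineEval_neg] at h3
    linarith

/-- The `k` step roots are distinct and separate the base point from its image, so any word for the
same element must cross all of them. -/
theorem isReducedWord_of_forall_isPosAffine {b : P.Base} {w : ℕ → AffineNode b} {k : ℕ}
    (h : ∀ i < k, IsPosAffine b (stepRoot b w i)) : IsReducedWord b (wordPrefix w k) := by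
  classical
  intro l hl
  rw [length_wordPrefix]
  set w' : ℕ → AffineNode b := fun m ↦ l.getD m none with hw'
  have hpre : wordPrefix w' l.length = l := wordPrefix_getD l
  have hprod : prefixProd b w' l.length = prefixProd b w k := by
    rw [prefixProd, hpre, hl, prefixProd]
  have hinj : Set.InjOn (stepRoot b w) (Finset.range k) := by
    have key : ∀ i j, i < j → j < k → stepRoot b w i ≠ stepRoot b w j := by
      intro i j hij hj he
      have h1 := affineEval_stepRoot_neg_of_lt h hij hj.le
      rw [he] at h1
      exact lt_asymm h1 (affineEval_stepRoot_pos b w j)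
    intro i hi j hj hij
    rw [Finset.coe_range, Set.mem_Iio] at hi hj
    rcases lt_trichotomy i j with h1 | h1 | h1
    · exact absurd hij (key i j h1 hj)
    · exact h1
    · exact absurd hij.symm (key j i h1 hi)
  have hsub : (Finset.range k).image (stepRoot b w) ⊆
      (Finset.range l.length).image (stepRoot b w') := by
    intro p hp
    rw [Finset.mem_image] at hp ⊢
    obtain ⟨i, hi, rfl⟩ := hp
    rw [Finset.mem_range] at hi
    have h1 := affineEval_stepRoot_neg_of_lt h hi le_rfl
    rw [← hprod] at h1
    obtain ⟨j, hj, hij⟩ := exists_stepRoot_eq (h i hi) h1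
    exact ⟨j, Finset.mem_range.2 hj, hij.symm⟩
  have h1 := Finset.card_le_card hsub
  rw [Finset.card_image_of_injOn hinj, Finset.card_range] at h1
  exact h1.trans (Finset.card_image_le.trans (by simp))

theorem InfiniteReducedWord.isPosAffine {b : P.Base} (w : InfiniteReducedWord b) (k : ℕ) :
    IsPosAffine b (stepRoot b w.1 k) :=
  isPosAffine_stepRoot (w.2 (k + 1)) k.lt_succ_self

theorem mem_inversionSet_iff {b : P.Base} (w : InfiniteReducedWord b) (t : affineWeylGroup b) :
    t ∈ inversionSet w ↔ ∃ p ∈ Set.range (stepRoot b w.1), IsReflectionIn t p := by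
  constructor
  · rintro ⟨k, rfl⟩
    exact ⟨_, ⟨k, rfl⟩, isReflectionIn_stepRoot b w.1 k⟩
  · rintro ⟨_, ⟨k, rfl⟩, h⟩
    exact ⟨k, (isReflectionIn_stepRoot b w.1 k).unique h⟩

theorem inversionSet_eq_iff {b : P.Base} (w w' : InfiniteReducedWord b) :
    inversionSet w = inversionSet w' ↔
      Set.range (stepRoot b w.1) = Set.range (stepRoot b w'.1) := by
  constructor
  · have key : ∀ w w' : InfiniteReducedWord b, inversionSet w = inversionSet w' →
        Set.range (stepRoot b w.1) ⊆ Set.range (stepRoot b w'.1) := by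
      rintro w w' h _ ⟨k, rfl⟩
      have h1 := isReflectionIn_stepRoot b w.1 k
      have h2 := (mem_inversionSet_iff w _).2 ⟨_, ⟨k, rfl⟩, h1⟩
      rw [h, mem_inversionSet_iff] at h2
      obtain ⟨_, ⟨j, rfl⟩, h3⟩ := h2
      exact ⟨j, h3.unique_root h1 (w'.isPosAffine j) (w.isPosAffine k)⟩
    exact fun h ↦ (key w w' h).antisymm (key w' w h.symm)
  · intro h
    ext t
    rw [mem_inversionSet_iff, mem_inversionSet_iff, h]

theorem mk_eq_mk_iff {b : P.Base} (w w' : InfiniteReducedWord b) :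
    LimitElement.mk w = LimitElement.mk w' ↔
      Set.range (stepRoot b w.1) = Set.range (stepRoot b w'.1) := by
  rw [← inversionSet_eq_iff]
  exact Quotient.eq

/-! ### Periodic words -/

section Periodic

variable {b : P.Base} {l : List (AffineNode b)} {w : ℕ → AffineNode b}

theorem length_pos_of_periodic (hw : ∀ m : ℕ, l[m % l.length]? = some (w m)) : 0 < l.length := by
  rw [List.length_pos_iff]
  rintro rfl
  simpa using hw 0

theorem wordPrefix_length_of_periodic (hw : ∀ m : ℕ, l[m % l.length]? = some (w m)) :
    wordPrefix w l.length = l := by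
  apply List.ext_getElem
  · simp [wordPrefix]
  · intro n h1 h2
    have := hw n
    rw [Nat.mod_eq_of_lt h2, List.getElem?_eq_getElem h2, Option.some_inj] at this
    simp [wordPrefix, this]

theorem prefixProd_periodic (hw : ∀ m : ℕ, l[m % l.length]? = some (w m)) (m r : ℕ) :
    prefixProd b w (m * l.length + r) = wordProd b l ^ m * prefixProd b w r := by
  have hper : ∀ m, (fun r ↦ w (m * l.length + r)) = w := by
    intro m
    funext r
    have h1 := hw (m * l.length + r)
    rw [Nat.mul_add_mod', hw r, Option.some_inj] at h1
    exact h1.symm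
  have h1 : ∀ m r, prefixProd b w (m * l.length + r) =
      prefixProd b w (m * l.length) * prefixProd b w r := by
    intro m r
    rw [prefixProd, wordPrefix_add, wordProd_append, hper m]
    rfl
  rw [h1]
  congr 1
  induction m with
  | zero => simp [prefixProd_zero]
  | succ m ih =>
    rw [add_mul, one_mul, h1, ih, pow_succ]
    congr 1
    rw [prefixProd, wordPrefix_length_of_periodic hw]

theorem apply_pow_of_translation {g : affineWeylGroup b} {n : ℕ} {μ : N}
    (hg : ∀ x, (g ^ n).1 x = x + μ) (m : ℕ) (x : N) : (g ^ (n * m)).1 x = x + (m : ℝ) • μ := by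
  induction m with
  | zero =>
    simp only [mul_zero, pow_zero, Nat.cast_zero, zero_smul, add_zero]
    rfl
  | succ m ih =>
    rw [mul_add, mul_one, pow_add, coe_mul_apply, hg]
    have h1 : (g ^ (n * m)).1 (x + μ) = (g ^ (n * m) * g ^ n).1 x := by
      rw [coe_mul_apply, hg]
    rw [h1, ← pow_add, add_comm, pow_add, coe_mul_apply, ih, hg]
    push_cast
    module

/-- The inversions of the infinite power of an element some power of which is the translation by
`μ` are determined by the signs of the roots on `μ`. -/
theorem mem_range_stepRoot_iff (hw : ∀ m : ℕ, l[m % l.length]? = some (w m))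
    (hred : ∀ k, IsReducedWord b (wordPrefix w k)) {n : ℕ} (hn : 0 < n) {μ : N}
    (hg : ∀ x, (wordProd b l ^ n).1 x = x + μ) (p : ι × ℤ) :
    p ∈ Set.range (stepRoot b w) ↔ IsPosAffine b p ∧ P.root' p.1 μ < 0 := by
  have hL := length_pos_of_periodic hw
  have hval : ∀ m : ℕ, affineEval P p ((prefixProd b w (n * m * l.length)).1 (basePoint b)) =
      affineEval P p (basePoint b) + m * P.root' p.1 μ := by
    intro m
    have := prefixProd_periodic hw (n * m) 0
    rw [add_zero, prefixProd_zero, mul_one] at this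
    rw [this, apply_pow_of_translation hg, affineEval_add, map_smul, smul_eq_mul]
  constructor
  · rintro ⟨k, rfl⟩
    have hpos : IsPosAffine b (stepRoot b w k) := isPosAffine_stepRoot (hred (k + 1)) k.lt_succ_self
    refine ⟨hpos, ?_⟩
    -- After `n * (k + 1)` periods, which is later than `k`, the base point is shifted by `(k + 1)
    -- μ`; the root is negative there although positive at the start.
    have h1 := affineEval_stepRoot_neg_of_lt (w := w) (k := n * (k + 1) * l.length) (i := k)
      (fun i _ ↦ isPosAffine_stepRoot (hred (i + 1)) i.lt_succ_self) (by
        calc k < 1 * (k + 1) * 1 := by omega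
          _ ≤ n * (k + 1) * l.length := by gcongr <;> omega) le_rfl
    rw [hval] at h1
    by_contra! h2
    unfold IsPosAffine at hpos
    have : 0 ≤ ((k + 1 : ℕ) : ℝ) * P.root' (stepRoot b w k).1 μ := by positivity
    linarith
  · rintro ⟨hpos, hneg⟩
    obtain ⟨m, hm⟩ := exists_nat_gt (affineEval P p (basePoint b) / (-P.root' p.1 μ))
    rw [div_lt_iff₀ (by linarith)] at hm
    obtain ⟨i, -, rfl⟩ := exists_stepRoot_eq (w := w) (k := n * m * l.length) hpos (by
      rw [hval]
      linarith)
    exact ⟨i, rfl⟩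

/-- The infinite power of a straight element is reduced. -/
theorem isReducedWord_of_straight (hw : ∀ m : ℕ, l[m % l.length]? = some (w m))
    (hl : IsReducedWord b l) {κ : N} (hκ : (wordProd b l).1 (basePoint b) = basePoint b + κ)
    (hκ' : (wordProd b l).1.linear κ = κ) (k : ℕ) : IsReducedWord b (wordPrefix w k) := by
  have hL := length_pos_of_periodic hw
  set g := wordProd b l with hg
  have hgv : ∀ x v, g.1 (x + v) = g.1 x + g.1.linear v := by
    intro x v
    have := g.1.map_vadd x v
    simp only [vadd_eq_add] at this
    rw [add_comm, this, add_comm]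
  have hinv : ∀ m : ℕ, ((g ^ m)⁻¹).1 (basePoint b) = basePoint b - (m : ℝ) • κ := by
    intro m
    have h1 : (g ^ m).1 (basePoint b - (m : ℝ) • κ) = basePoint b := by
      induction m with
      | zero => simp
      | succ m ih =>
        rw [pow_succ, coe_mul_apply, sub_eq_add_neg, hgv, hκ, map_neg, map_smul, hκ']
        have : basePoint b + κ + -(((m + 1 : ℕ) : ℝ) • κ) = basePoint b - (m : ℝ) • κ := by
          push_cast
          module
        rw [this, ih]
    nth_rewrite 1 [← h1]
    rw [inv_apply_apply]
  apply isReducedWord_of_forall_isPosAffine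
  intro i _
  obtain ⟨m, r, hr, rfl⟩ : ∃ m r, r < l.length ∧ i = m * l.length + r :=
    ⟨i / l.length, i % l.length, Nat.mod_lt _ hL, by rw [mul_comm]; exact (Nat.div_add_mod i _).symm⟩
  have hred : IsReducedWord b (wordPrefix w l.length) := by
    rwa [wordPrefix_length_of_periodic hw]
  have hpos := isPosAffine_stepRoot hred hr
  have hneg := affineEval_stepRoot_neg_of_lt (w := w)
    (fun i hi ↦ isPosAffine_stepRoot hred hi) hr le_rfl
  -- An inversion of `g` is positive at the base point and negative after adding `κ`, so its finite
  -- part is negative on `κ`. Its image under `g ^ m` is then even more positive at the base point.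
  rw [prefixProd, wordPrefix_length_of_periodic hw, ← hg, hκ, affineEval_add] at hneg
  have hwr : w (m * l.length + r) = w r := by
    have h1 := hw (m * l.length + r)
    rw [Nat.mul_add_mod', hw r, Option.some_inj] at h1
    exact h1.symm
  have h1 : stepRoot b w (m * l.length + r) = affineAct b (g ^ m) (stepRoot b w r) := by
    rw [stepRoot, stepRoot, prefixProd_periodic hw, affineAct_mul, hwr]
  rw [h1, IsPosAffine, affineEval_affineAct', hinv, affineEval_sub, map_smul, smul_eq_mul]
  unfold IsPosAffine at hpos
  have : (m : ℝ) * P.root' (stepRoot b w r).1 κ ≤ 0 :=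
    mul_nonpos_of_nonneg_of_nonpos (Nat.cast_nonneg m) (by linarith)
  linarith

/-- The infinite power of a nontrivial straight element. -/
theorem exists_isInfinitePower_of_straight (g : affineWeylGroup b) {κ : N}
    (hκ : g.1 (basePoint b) = basePoint b + κ) (hκ' : g.1.linear κ = κ) (h0 : κ ≠ 0) :
    ∃ L, IsInfinitePower g L := by
  obtain ⟨l, hl, rfl⟩ := exists_reducedWord b g
  have hL : 0 < l.length := by
    rw [List.length_pos_iff]
    rintro rfl
    apply h0
    have : basePoint b = basePoint b + κ := hκ
    simpa using this
  have hw : ∀ m : ℕ, l[m % l.length]? = some (l[m % l.length]'(Nat.mod_lt _ hL)) := fun m ↦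
    List.getElem?_eq_getElem _
  exact ⟨_, l, ⟨_, isReducedWord_of_straight hw hl hκ hκ'⟩, hl, rfl, hw, rfl⟩

/-- Infinite powers of two elements having translations as powers agree if and only if the two
translations lie in the relative interior of the same cone of the Coxeter fan. -/
theorem isInfinitePower_eq_iff {g h : affineWeylGroup b} {L L' : LimitElement b}
    (hL : IsInfinitePower g L) (hL' : IsInfinitePower h L') {m n : ℕ} (hm : 0 < m) (hn : 0 < n)
    {μ ν : N} (hμ : ∀ x, (g ^ m).1 x = x + μ) (hν : ∀ x, (h ^ n).1 x = x + ν) :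
    L = L' ↔ ∀ i, P.root' i μ < 0 ↔ P.root' i ν < 0 := by
  obtain ⟨l, w, -, rfl, hw, rfl⟩ := hL
  obtain ⟨l', w', -, rfl, hw', rfl⟩ := hL'
  rw [mk_eq_mk_iff, Set.ext_iff]
  simp only [mem_range_stepRoot_iff hw w.2 hm hμ, mem_range_stepRoot_iff hw' w'.2 hn hν]
  constructor
  · intro h i
    -- With constant term 1 every finite root gives a positive affine root, so the inversion set
    -- detects the sign for each `i`.
    have h1 : IsPosAffine b (i, (1 : ℤ)) := by
      apply isPosAffine_of_coeff_nonneg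
      rintro (_ | k)
      · simp [affineCoeff]
      · have := neg_highestRoot_le_rootCoeff b i k
        simp only [affineCoeff, one_mul]
        linarith
    have := h (i, 1)
    simpa [h1] using this
  · intro h p
    rw [h]

end Periodic

end

end LimitWeakOrder

/-! ### Conjugacy of Coxeter elements of a forest. -/

namespace LimitWeakOrder

open RootPairing

noncomputable section

set_option linter.unusedSectionVars false

/-! ### Products over words in elements commuting along a forest -/

/-- The equivalence relation on words generated by the exchange of consecutive letters related by
`r` and by cyclic rotation. -/
inductive CyclicCommEquiv {α : Type*} (r : α → α → Prop) : List α → List α → Prop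
  | refl (l) : CyclicCommEquiv r l l
  | symm {l l'} : CyclicCommEquiv r l l' → CyclicCommEquiv r l' l
  | trans {l l' l''} : CyclicCommEquiv r l l' → CyclicCommEquiv r l' l'' → CyclicCommEquiv r l l''
  | swap (s t x y) : r x y → CyclicCommEquiv r (s ++ x :: y :: t) (s ++ y :: x :: t)
  | rotate (x t) : CyclicCommEquiv r (x :: t) (t ++ [x])

namespace CyclicCommEquiv

variable {α : Type*} {r : α → α → Prop}

theorem perm {l l' : List α} (h : CyclicCommEquiv r l l') : l.Perm l' := by
  induction h with
  | refl l => exact .refl l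
  | symm _ ih => exact ih.symm
  | trans _ _ ih ih' => exact ih.trans ih'
  | swap s t x y _ => exact (List.Perm.swap y x t).append_left s
  | rotate x t => exact (List.perm_append_singleton x t).symm

theorem isConj {G : Type*} [Group G] (f : α → G) {l l' : List α}
    (h : CyclicCommEquiv (fun x y ↦ Commute (f x) (f y)) l l') :
    IsConj (l.map f).prod (l'.map f).prod := by
  induction h with
  | refl l => exact .refl _
  | symm _ ih => exact ih.symm
  | trans _ _ ih ih' => exact ih.trans ih'
  | swap s t x y hxy =>
    have h : (List.map f (s ++ x :: y :: t)).prod = (List.map f (s ++ y :: x :: t)).prod := by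
      simp only [List.map_append, List.map_cons, List.prod_append, List.prod_cons]
      rw [← mul_assoc (f x), hxy.eq, mul_assoc]
    rw [h]
  | rotate x t =>
    refine isConj_iff.2 ⟨(f x)⁻¹, ?_⟩
    simp

theorem rotate_append (s t : List α) : CyclicCommEquiv r (s ++ t) (t ++ s) := by
  induction s generalizing t with
  | nil => simpa using .refl t
  | cons x s ih =>
    refine (rotate x (s ++ t)).trans ?_
    have := ih (t ++ [x])
    simpa using this

theorem move (s t t' : List α) (v : α) (h : ∀ x ∈ t, r v x) :
    CyclicCommEquiv r (s ++ v :: (t ++ t')) (s ++ (t ++ v :: t')) := by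
  induction t generalizing s with
  | nil => exact .refl _
  | cons x t ih =>
    refine (swap s (t ++ t') v x (h x (by simp))).trans ?_
    have := ih (s ++ [x]) fun y hy ↦ h y (by simp [hy])
    simpa using this

/-- Adding a letter which is related to all the others but one. -/
theorem cons {v u : α} {m m' : List α}
    (h : CyclicCommEquiv r m m') (hm : m.Nodup) (hu : ∀ x ∈ m, x ≠ u → r v x) :
    CyclicCommEquiv r (v :: m) (v :: m') := by
  induction h with
  | refl l => exact .refl _
  | symm h ih =>
    exact (ih (h.perm.nodup_iff.2 hm) fun x hx ↦ hu x (h.perm.mem_iff.1 hx)).symm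
  | trans h h' ih ih' =>
    exact (ih hm hu).trans (ih' (h.perm.nodup_iff.1 hm) fun x hx ↦ hu x (h.perm.mem_iff.2 hx))
  | swap s t x y hxy => exact swap (v :: s) t x y hxy
  | rotate x t =>
    -- The letter `u` cannot be passed by `v` directly: `v` is rotated to the end, then `u` is, and
    -- `v` comes back to the front through `t` alone.
    by_cases hx : x = u
    · subst hx
      have h1 : CyclicCommEquiv r (v :: x :: t) ((x :: t) ++ [v]) := rotate v (x :: t)
      have h2 : CyclicCommEquiv r (v :: (t ++ [x])) (t ++ v :: [x]) := by
        refine move [] t [x] v fun y hy ↦ hu y (by simp [hy]) ?_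
        rintro rfl
        exact (List.nodup_cons.1 hm).1 hy
      have h3 : CyclicCommEquiv r (x :: (t ++ [v])) (t ++ v :: [x]) := by
        have := rotate (r := r) x (t ++ [v])
        simpa using this
      exact h1.trans (h3.trans h2.symm)
    · have h1 : CyclicCommEquiv r (v :: x :: t) (x :: v :: t) :=
        swap [] t v x (hu x (by simp) hx)
      exact h1.trans (rotate x (v :: t))

/-- Induction on the length: rotate a leaf `v` to the front of both words, relate the remainders,
and put `v` back, which is possible since it fails to commute with at most one letter. -/
theorem of_perm
    (hforest : ∀ l : List α, l ≠ [] → ∃ v ∈ l, ∃ u, ∀ x ∈ l, x ≠ v → x ≠ u → r v x)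
    (l l' : List α) (hl : l.Nodup) (h : l.Perm l') : CyclicCommEquiv r l l' := by
  induction hn : l.length generalizing l l' with
  | zero =>
    rw [List.length_eq_zero_iff] at hn
    subst hn
    rw [List.nil_perm.1 h]
    exact .refl _
  | succ n ih =>
    obtain ⟨v, hv, u, hu⟩ := hforest l (by rintro rfl; simp at hn)
    have hv' := h.mem_iff.1 hv
    obtain ⟨s, t, rfl⟩ := List.append_of_mem hv
    obtain ⟨s', t', rfl⟩ := List.append_of_mem hv'
    have h1 : CyclicCommEquiv r (s ++ v :: t) (v :: (t ++ s)) := rotate_append s (v :: t)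
    have h2 : CyclicCommEquiv r (s' ++ v :: t') (v :: (t' ++ s')) := rotate_append s' (v :: t')
    have h3 : (t ++ s).Perm (t' ++ s') :=
      (List.perm_cons v).1 (h1.perm.symm.trans (h.trans h2.perm))
    have h4 := (h1.perm.nodup_iff.1 hl)
    rw [List.nodup_cons] at h4
    have h5 : CyclicCommEquiv r (t ++ s) (t' ++ s') := ih _ _ h4.2 h3 (by
      have := h1.perm.length_eq
      rw [hn] at this
      simpa using this.symm)
    refine h1.trans ((cons (u := u) h5 h4.2 fun x hx hxu ↦ ?_).trans h2.symm)
    refine hu x (h1.perm.mem_iff.2 (List.mem_cons_of_mem v hx)) ?_ hxu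
    rintro rfl
    exact h4.1 hx

end CyclicCommEquiv

variable {ι M N : Type*} [AddCommGroup M] [Module ℝ M] [AddCommGroup N] [Module ℝ N]
  {P : RootPairing ι ℝ M N} [P.IsRootSystem] [Fintype ι] [P.IsIrreducible] [P.IsCrystallographic]

theorem commute_simple (b : P.Base) {a a' : AffineNode b}
    (h : P.pairing (affineNodeRoot b a).1 (affineNodeRoot b a').1 = 0) :
    Commute (simple b a) (simple b a') := by
  have h' := pairing_zero_symm h
  apply Subtype.ext
  apply AffineEquiv.ext
  intro x
  change (simple b a).1 ((simple b a').1 x) = (simple b a').1 ((simple b a).1 x)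
  rw [isReflectionIn_simple b a ((simple b a').1 x), isReflectionIn_simple b a' ((simple b a).1 x),
    isReflectionIn_simple b a' x, isReflectionIn_simple b a x, affineEval_sub, affineEval_sub, map_smul, map_smul,
    P.root'_coroot_eq_pairing, P.root'_coroot_eq_pairing, h, h']
  simp only [smul_zero, sub_zero]
  abel

variable [P.IsReduced]

/-- Outside type `A`, the affine Dynkin diagram is a tree, so that all Coxeter elements are
conjugate. -/
theorem IsCoxeterElement.isConj {b : P.Base} (hA : ¬ IsTypeA b) {c c' : affineWeylGroup b}
    (hc : IsCoxeterElement b c) (hc' : IsCoxeterElement b c') : IsConj c c' := by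
  classical
  obtain ⟨l, hl, hl', rfl⟩ := hc
  obtain ⟨m, hm, hm', rfl⟩ := hc'
  obtain ⟨j, hj, -⟩ := exists_unique_affine_neighbor b hA
  apply CyclicCommEquiv.isConj
  refine CyclicCommEquiv.of_perm (fun s hs ↦ ?_) l m hl
    ((List.perm_ext_iff_of_nodup hl hm).2 fun a ↦ by simp [hl', hm'])
  -- The affine node, when present, is a leaf attached to `j`; otherwise a leaf of the finite forest
  -- is used.
  by_cases hn : none ∈ s
  · refine ⟨none, hn, some j, fun x hx hx1 hx2 ↦ ?_⟩
    rcases x with _ | k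
    · exact absurd rfl hx1
    · apply commute_simple
      have := hj k fun h ↦ hx2 (by rw [h])
      simpa [affineNodeRoot] using this
  · obtain ⟨v, hv, u, hu⟩ := exists_leaf b (Finset.univ.filter fun k ↦ some k ∈ s) (by
      obtain ⟨a, ha⟩ := List.exists_mem_of_ne_nil s hs
      rcases a with _ | k
      · exact absurd ha hn
      · exact ⟨k, by simpa using ha⟩)
    refine ⟨some v, by simpa using hv, some u, fun x hx hx1 hx2 ↦ ?_⟩
    rcases x with _ | k
    · exact absurd hx hn
    · apply commute_simple
      by_contra h
      apply hx2
      rw [hu k (by simpa using hx)]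
      rw [dynkinGraph_adj]
      exact ⟨fun h' ↦ hx1 (by rw [h']), h⟩

end

end LimitWeakOrder

/-! ### The finite Weyl group, translations, and dominant points. -/

namespace LimitWeakOrder

open RootPairing

noncomputable section

set_option linter.unusedSectionVars false

variable {ι M N : Type*} [AddCommGroup M] [Module ℝ M] [AddCommGroup N] [Module ℝ N]
  {P : RootPairing ι ℝ M N} [P.IsRootSystem] [Fintype ι] [P.IsCrystallographic]
  [P.IsReduced] [P.IsIrreducible]

/-! ### The finite Weyl group -/

theorem coreflection_mem_finiteWeylGroup (i : ι) : P.coreflection i ∈ finiteWeylGroup P :=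
  Subgroup.subset_closure ⟨i, rfl⟩

theorem exists_coroot_image {u : N ≃ₗ[ℝ] N} (hu : u ∈ finiteWeylGroup P) (i : ι) :
    ∃ j, u (P.coroot i) = P.coroot j ∧ ∀ x, P.root' j (u x) = P.root' i x := by
  induction hu using Subgroup.closure_induction generalizing i with
  | mem u hu =>
    obtain ⟨k, rfl⟩ := hu
    refine ⟨P.reflectionPerm k i, by rw [P.coroot_reflectionPerm], fun x ↦ ?_⟩
    have h1 : ∀ x, P.root' (P.reflectionPerm k i) x =
        P.root' i x - P.pairing i k * P.root' k x := by
      intro x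
      simp [RootPairing.root', P.root_reflectionPerm, P.reflection_apply,
        P.root_coroot_eq_pairing]
    rw [P.coreflection_apply]
    change P.root' _ (x - P.root' k x • _) = _
    rw [h1]
    simp only [map_sub, map_smul, P.root'_coroot_eq_pairing, P.pairing_same, smul_eq_mul]
    ring
  | one => exact ⟨i, rfl, fun x ↦ rfl⟩
  | mul u v _ _ hu hv =>
    obtain ⟨j, hj, hj'⟩ := hv i
    obtain ⟨k, hk, hk'⟩ := hu j
    exact ⟨k, by rw [LinearEquiv.mul_apply, hj, hk], fun x ↦ by
      rw [LinearEquiv.mul_apply, hk', hj']⟩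
  | inv u _ hu =>
    choose σ hσ hσ' using hu
    have h3 : ∀ x, u (u⁻¹ x) = x := LinearEquiv.apply_symm_apply u
    have h4 : ∀ x, u⁻¹ (u x) = x := LinearEquiv.symm_apply_apply u
    have hinj : Function.Injective σ := by
      intro j k hjk
      apply P.coroot.injective
      apply u.injective
      rw [hσ, hσ, hjk]
    obtain ⟨j, rfl⟩ := (Finite.injective_iff_surjective.1 hinj) i
    exact ⟨j, by rw [← hσ, h4], fun x ↦ by rw [← hσ' j, h3]⟩

theorem apply_mem_corootLattice {u : N ≃ₗ[ℝ] N} (hu : u ∈ finiteWeylGroup P) {x : N}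
    (hx : x ∈ corootLattice P) : u x ∈ corootLattice P := by
  induction hx using AddSubgroup.closure_induction with
  | mem x hx =>
    obtain ⟨i, rfl⟩ := hx
    obtain ⟨j, hj, -⟩ := exists_coroot_image hu i
    rw [hj]
    exact AddSubgroup.subset_closure ⟨j, rfl⟩
  | zero => rw [map_zero]; exact zero_mem _
  | add x y _ _ hx hy => rw [map_add]; exact add_mem hx hy
  | neg x _ hx => rw [map_neg]; exact neg_mem hx

theorem corootForm_apply_apply_of_mem {u : N ≃ₗ[ℝ] N} (hu : u ∈ finiteWeylGroup P) (x y : N) :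
    P.CorootForm (u x) (u y) = P.CorootForm x y := by
  induction hu using Subgroup.closure_induction generalizing x y with
  | mem u hu =>
    obtain ⟨k, rfl⟩ := hu
    exact corootForm_coreflection k x y
  | one => rfl
  | mul u v _ _ hu hv => rw [LinearEquiv.mul_apply, LinearEquiv.mul_apply, hu, hv]
  | inv u _ hu =>
    have h3 : ∀ x, u (u⁻¹ x) = x := LinearEquiv.apply_symm_apply u
    rw [← hu, h3, h3]

theorem exists_pow_eq_one_of_mem {u : N ≃ₗ[ℝ] N} (hu : u ∈ finiteWeylGroup P) :
    ∃ n : ℕ, 0 < n ∧ u ^ n = 1 :=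
  exists_pow_eq_one P.coroot IsRootSystem.span_coroot_eq_top u fun i ↦
    let ⟨j, hj, _⟩ := exists_coroot_image hu i; ⟨j, hj⟩

/-- Points of the coroot space are determined by the values of the simple roots. -/
theorem eq_of_root'_eq (b : P.Base) {x y : N} (h : ∀ k : b.support, P.root' k x = P.root' k y) :
    x = y := by
  apply P.flip.toPerfPair.injective
  apply b.toWeightBasis.ext
  intro k
  rw [b.toWeightBasis_apply]
  exact h k

/-! ### The finite Weyl group and the translations inside the affine Weyl group -/

theorem linear_mem_finiteWeylGroup {b : P.Base} (g : affineWeylGroup b) :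
    g.1.linear ∈ finiteWeylGroup P := by
  obtain ⟨l, rfl⟩ := exists_wordProd b g
  induction l with
  | nil => exact one_mem _
  | cons a l ih =>
    have h : (wordProd b (a :: l)).1.linear =
        P.coreflection (affineNodeRoot b a).1 * (wordProd b l).1.linear := by
      ext x
      rw [wordProd_cons]
      exact simpleAffineReflection_linear b a _
    rw [h]
    exact mul_mem (coreflection_mem_finiteWeylGroup _) ih

theorem apply_add {b : P.Base} (g : affineWeylGroup b) (x v : N) :
    g.1 (x + v) = g.1 x + g.1.linear v := by
  have := g.1.map_vadd x v
  simp only [vadd_eq_add] at this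
  rw [add_comm, this, add_comm]

theorem exists_affine_coreflection (b : P.Base) (i : ι) :
    ∃ g : affineWeylGroup b, ∀ x, g.1 x = P.coreflection i x := by
  refine b.induction_reflect i (p := fun i ↦ ∃ g : affineWeylGroup b,
    ∀ x, g.1 x = P.coreflection i x) ?_ ?_ ?_
  · rintro i ⟨g, hg⟩
    refine ⟨g, fun x ↦ ?_⟩
    rw [hg, P.coreflection_apply, P.coreflection_apply, coroot_reflectionPerm_self]
    have := root'_reflectionPerm_self (P := P) i x
    simp only [RootPairing.root'] at this ⊢
    simp
  · intro k hk
    exact ⟨simple b (some ⟨k, hk⟩), fun x ↦ rfl⟩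
  · rintro i k ⟨g, hg⟩ hk
    set s := simple b (some ⟨k, hk⟩) with hs
    have hs' : ∀ x, s.1 x = P.coreflection k x := fun x ↦ rfl
    refine ⟨s * g * s, fun x ↦ ?_⟩
    rw [coe_mul_apply, coe_mul_apply, hs', hs', hg]
    have := P.flip.reflection_reflectionPerm (i := i) (j := k)
    exact (LinearEquiv.congr_fun this x).symm

theorem exists_affine_of_mem (b : P.Base) {u : N ≃ₗ[ℝ] N} (hu : u ∈ finiteWeylGroup P) :
    ∃ g : affineWeylGroup b, ∀ x, g.1 x = u x := by
  induction hu using Subgroup.closure_induction with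
  | mem u hu =>
    obtain ⟨k, rfl⟩ := hu
    exact exists_affine_coreflection b k
  | one => exact ⟨1, fun x ↦ rfl⟩
  | mul u v _ _ hu hv =>
    obtain ⟨g, hg⟩ := hu
    obtain ⟨h, hh⟩ := hv
    exact ⟨g * h, fun x ↦ by rw [coe_mul_apply, hh, hg]; rfl⟩
  | inv u _ hu =>
    obtain ⟨g, hg⟩ := hu
    refine ⟨g⁻¹, fun x ↦ ?_⟩
    have h3 : u (u⁻¹ x) = x := LinearEquiv.apply_symm_apply u x
    conv_lhs => rw [← h3, ← hg, inv_apply_apply]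

/-- The translations belonging to the affine Weyl group. -/
def translationLattice (b : P.Base) : AddSubgroup N where
  carrier := {v | ∃ g : affineWeylGroup b, ∀ x, g.1 x = x + v}
  zero_mem' := ⟨1, fun x ↦ (add_zero x).symm⟩
  add_mem' := by
    rintro v v' ⟨g, hg⟩ ⟨g', hg'⟩
    exact ⟨g * g', fun x ↦ by rw [coe_mul_apply, hg', hg]; abel⟩
  neg_mem' := by
    rintro v ⟨g, hg⟩
    refine ⟨g⁻¹, fun x ↦ ?_⟩
    have : g.1 (x + -v) = x := by rw [hg]; abel
    conv_lhs => rw [← this, inv_apply_apply]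

theorem apply_mem_translationLattice {b : P.Base} {u : N ≃ₗ[ℝ] N} (hu : u ∈ finiteWeylGroup P)
    {v : N} (hv : v ∈ translationLattice b) : u v ∈ translationLattice b := by
  obtain ⟨g, hg⟩ := hv
  obtain ⟨h, hh⟩ := exists_affine_of_mem b hu
  refine ⟨h * g * h⁻¹, fun x ↦ ?_⟩
  rw [coe_mul_apply, coe_mul_apply, hg, hh, map_add, ← hh, apply_inv_apply]

/-- The product of `s_0` and the linear reflection in `ξ` is this translation. -/
theorem coroot_highestRoot_mem (b : P.Base) :
    P.coroot (highestRoot b) ∈ translationLattice b := by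
  obtain ⟨g, hg⟩ := exists_affine_coreflection b (highestRoot b)
  refine ⟨simple b none * g, fun x ↦ ?_⟩
  rw [coe_mul_apply, hg, add_comm]
  have : ∀ y, (simple b none).1 y = P.coroot (highestRoot b) + P.coreflection (highestRoot b) y :=
    fun y ↦ rfl
  rw [this]
  congr 1
  exact P.coreflection_same _ x

/-- By irreducibility the orbit of `ξ^∨` spans the space, so `α_i` cannot vanish on all of it. -/
theorem exists_weyl_pairing_ne_zero (b : P.Base) (i : ι) :
    ∃ u ∈ finiteWeylGroup P, P.root' i (u (P.coroot (highestRoot b))) ≠ 0 := by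
  by_contra! h
  set q : Submodule ℝ N := Submodule.span ℝ
    {x | ∃ u ∈ finiteWeylGroup P, x = u (P.coroot (highestRoot b))} with hq
  have h1 : q = ⊤ := by
    apply IsIrreducible.eq_top_of_invtSubmodule_coreflection (P := P)
    · intro k
      rw [Module.End.mem_invtSubmodule, hq, Submodule.span_le]
      rintro _ ⟨u, hu, rfl⟩
      exact Submodule.subset_span ⟨P.coreflection k * u,
        mul_mem (coreflection_mem_finiteWeylGroup k) hu, rfl⟩
    · intro h0
      have h2 : P.coroot (highestRoot b) ∈ q := Submodule.subset_span ⟨1, one_mem _, rfl⟩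
      rw [h0, Submodule.mem_bot] at h2
      exact P.flip.ne_zero (highestRoot b) h2
  have h2 : q ≤ LinearMap.ker (P.root' i) := by
    rw [hq, Submodule.span_le]
    rintro _ ⟨u, hu, rfl⟩
    exact h u hu
  rw [h1] at h2
  have h3 : P.root' i (P.coroot i) = 0 := h2 (Submodule.mem_top (x := P.coroot i))
  rw [P.root'_coroot_eq_pairing, P.pairing_same] at h3
  norm_num at h3

/-- Take a conjugate `α` of `ξ^∨` on which `α_i` does not vanish. Either `α_i^∨ = ±α`, or the
pairing is `±1` and `α_i^∨` is, up to sign, the difference of the two translations `α` and `s_i α`.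
-/
theorem corootLattice_le_translationLattice (b : P.Base) :
    corootLattice P ≤ translationLattice b := by
  rw [corootLattice, AddSubgroup.closure_le]
  rintro _ ⟨i, rfl⟩
  obtain ⟨u, hu, hne⟩ := exists_weyl_pairing_ne_zero b i
  set α := u (P.coroot (highestRoot b)) with hα
  have hαL : α ∈ translationLattice b := apply_mem_translationLattice hu (coroot_highestRoot_mem b)
  obtain ⟨j, hj, hj'⟩ := exists_coroot_image (inv_mem hu) i
  have h1 : P.root' i α = P.pairing j (highestRoot b) := by
    rw [← hj' α, hα, ← P.root'_coroot_eq_pairing]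
    congr 1
    exact LinearEquiv.symm_apply_apply u _
  have h2 : u (P.coroot j) = P.coroot i := by
    rw [← hj]
    exact LinearEquiv.apply_symm_apply u _
  by_cases hξ : j = highestRoot b
  · rw [← h2, hξ]
    exact hαL
  by_cases hξ' : P.root j = - P.root (highestRoot b)
  · have h3 : j = P.reflectionPerm (highestRoot b) (highestRoot b) := by
      apply P.root.injective
      rw [hξ', P.root_reflectionPerm, P.reflection_apply_self]
    have h4 : P.coroot i = - α := by
      rw [← h2, h3, coroot_reflectionPerm_self, map_neg]
    rw [h4]
    exact neg_mem hαL
  have h5 := pairing_highestRoot_le_one b hξ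
  have h6 := neg_one_le_pairing_highestRoot b hξ'
  obtain ⟨z, hz⟩ := exists_pairing_eq_int (P := P) j (highestRoot b)
  have h7 : P.coreflection i α ∈ translationLattice b :=
    apply_mem_translationLattice (coreflection_mem_finiteWeylGroup i) hαL
  have h8 : P.coreflection i α = α - P.root' i α • P.coroot i := P.coreflection_apply i α
  rw [h1] at h8 hne
  rw [hz] at h5 h6 h8 hne
  have h9 : z = 1 ∨ z = -1 := by
    have a1 : z ≤ 1 := by exact_mod_cast h5
    have a2 : -1 ≤ z := by exact_mod_cast h6
    have a3 : z ≠ 0 := by exact_mod_cast hne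
    omega
  rw [h8] at h7
  rcases h9 with rfl | rfl
  · have := sub_mem hαL h7
    simpa using this
  · have := sub_mem h7 hαL
    simpa using this

/-- Two dominant points in the same orbit of the finite Weyl group agree. -/
theorem wordProd_apply_eq_of_dominant (b : P.Base) {x : N} (hx : ∀ k : b.support, 0 ≤ P.root' k x)
    (l : List (AffineNode b)) (hl : IsReducedWord b l) (h0 : (wordProd b l).1 0 = 0)
    (hy : ∀ k : b.support, 0 ≤ P.root' k ((wordProd b l).1 x)) : (wordProd b l).1 x = x := by
  induction l with
  | nil => rfl
  | cons a l ih =>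
    have hl' : IsReducedWord b l := by
      intro m hm
      have := hl (a :: m) (by rw [wordProd_cons, wordProd_cons, hm])
      simpa using this
    set g := wordProd b (a :: l) with hg
    -- The first letter of a reduced word is crossed and never recrossed, so the pullback `q` of its
    -- root is negative. As `g` fixes 0, `q` keeps the constant term, which excludes the affine
    -- node.
    have hneg : affineEval P (affineNodeRoot b a) (g.1 (basePoint b)) < 0 := by
      set w : ℕ → AffineNode b := fun m ↦ (a :: l).getD m none with hw
      have hpre : wordPrefix w (a :: l).length = a :: l := wordPrefix_getD (a :: l)
      have h1 := affineEval_stepRoot_neg_of_lt (w := w) (k := (a :: l).length) (i := 0)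
        (fun i hi ↦ isPosAffine_stepRoot (by rw [hpre]; exact hl) hi) (by simp) le_rfl
      rw [prefixProd, hpre, stepRoot, prefixProd_zero, affineAct_one] at h1
      exact h1
    set q := affineAct b g⁻¹ (affineNodeRoot b a) with hq
    have hqe : ∀ y, affineEval P q y = affineEval P (affineNodeRoot b a) (g.1 y) := by
      intro y
      rw [hq, affineEval_affineAct', inv_inv]
    have hq0 : (q.2 : ℝ) = affineEval P (affineNodeRoot b a) 0 := by
      have := hqe 0
      rw [h0] at this
      rw [← this]
      simp [affineEval]
    have hqneg : ¬ IsPosAffine b q := by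
      rw [not_isPosAffine_iff, hqe]
      exact hneg
    have hcoeff : ∀ a, affineCoeff b q a ≤ 0 := by
      rcases affineCoeff_nonneg_or_nonpos b q with h | h
      · exact absurd (isPosAffine_of_coeff_nonneg h) hqneg
      · exact h
    rcases a with _ | k
    · exfalso
      have h1 := hcoeff none
      rw [affineEval_none, map_zero, sub_zero] at hq0
      have h2 : q.2 = 1 := by exact_mod_cast hq0
      simp only [affineCoeff] at h1
      omega
    · rw [affineEval_some, map_zero] at hq0
      have h2 : q.2 = 0 := by exact_mod_cast hq0
      have h3 : P.root' k (g.1 x) ≤ 0 := by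
        have h4 := hqe x
        rw [affineEval_some, affineEval, hq0, add_zero, root'_eq_sum b] at h4
        rw [← h4]
        refine Finset.sum_nonpos fun m _ ↦ mul_nonpos_of_nonpos_of_nonneg ?_ (hx m)
        have := hcoeff (some m)
        simp only [affineCoeff, h2, zero_mul, zero_add] at this
        exact_mod_cast this
      -- The image lies on the wall of `s_k`, so the first letter can be dropped without moving it.
      have h4 : P.root' k (g.1 x) = 0 := le_antisymm h3 (hy k)
      have h5 : ∀ y, (wordProd b l).1 y = (simple b (some k)).1 (g.1 y) := by
        intro y
        rw [hg, wordProd_cons, ← coe_mul_apply, ← mul_assoc, simple_mul_self, one_mul]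
      have h6 : (wordProd b l).1 x = g.1 x := by
        rw [h5, isReflectionIn_simple b (some k), affineEval_some, h4, zero_smul, sub_zero]
      rw [← h6]
      refine ih hl' ?_ ?_
      · rw [h5, h0]
        exact map_zero (P.coreflection k)
      · rw [h6]
        exact hy

theorem apply_eq_of_dominant (b : P.Base) {u : N ≃ₗ[ℝ] N} (hu : u ∈ finiteWeylGroup P) {x : N}
    (hx : ∀ k : b.support, 0 ≤ P.root' k x) (hy : ∀ k : b.support, 0 ≤ P.root' k (u x)) :
    u x = x := by
  obtain ⟨g, hg⟩ := exists_affine_of_mem b hu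
  obtain ⟨l, hl, rfl⟩ := exists_reducedWord b g
  rw [← hg]
  exact wordProd_apply_eq_of_dominant b hx l hl (by rw [hg, map_zero])
    (by simpa only [hg] using hy)

end

end LimitWeakOrder

/-! ### Powers of Coxeter elements and a straight Coxeter element. -/

namespace LimitWeakOrder

open RootPairing

noncomputable section

set_option linter.unusedSectionVars false

variable {ι M N : Type*} [AddCommGroup M] [Module ℝ M] [AddCommGroup N] [Module ℝ N]
  {P : RootPairing ι ℝ M N} [P.IsRootSystem] [Fintype ι] [P.IsCrystallographic]
  [P.IsReduced] [P.IsIrreducible]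

/-! ### Products of distinct simple reflections -/

theorem wordProd_map_some (b : P.Base) (l : List b.support) (x : N) :
    (wordProd b (l.map some)).1 x = coreflectionProd b l x := by
  induction l with
  | nil => rfl
  | cons k l ih =>
    rw [List.map_cons, wordProd_cons, coe_mul_apply, ih, coreflectionProd_cons]
    rfl

theorem wordProd_none_cons (b : P.Base) (l : List b.support) (x : N) :
    (wordProd b (none :: l.map some)).1 x = P.coroot (highestRoot b) +
      P.coreflection (highestRoot b) (coreflectionProd b l x) := by
  rw [wordProd_cons, coe_mul_apply, wordProd_map_some]
  rfl

theorem isCoxeterElement_wordProd (b : P.Base) {l : List b.support} (hl : l.Nodup)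
    (hl' : ∀ k, k ∈ l) : IsCoxeterElement b (wordProd b (none :: l.map some)) := by
  refine ⟨_, ?_, ?_, rfl⟩
  · rw [List.nodup_cons]
    exact ⟨by simp, hl.map (Option.some_injective _)⟩
  · rintro (_ | k)
    · simp
    · simp [hl' k]

/-- The coordinates with respect to the basis of simple coroots. -/
def corootCoord (b : P.Base) (i : b.support) : N →ₗ[ℝ] ℝ :=
  b.toCoweightBasis.coord i

theorem corootCoord_coroot (b : P.Base) [DecidableEq b.support] (i k : b.support) :
    corootCoord b i (P.coroot k) = if k = i then 1 else 0 := by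
  have h : b.toCoweightBasis k = P.coroot k := b.toCoweightBasis_apply k
  rw [corootCoord, ← h, Module.Basis.coord_apply, Module.Basis.repr_self, Finsupp.single_apply]

theorem corootCoord_coreflectionProd (b : P.Base) {i : b.support} {l : List b.support}
    (h : i ∉ l) (x : N) : corootCoord b i (coreflectionProd b l x) = corootCoord b i x := by
  classical
  induction l with
  | nil => rfl
  | cons k l ih =>
    rw [List.mem_cons, not_or] at h
    rw [coreflectionProd_cons, LinearEquiv.mul_apply, P.coreflection_apply, map_sub, ih h.2,
      map_smul, corootCoord_coroot, if_neg (Ne.symm h.1)]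
    simp

/-- A point fixed by a product of distinct simple reflections is fixed by each of them. -/
theorem root'_eq_zero_of_coreflectionProd_eq (b : P.Base) {l : List b.support} (hl : l.Nodup)
    {x : N} (h : coreflectionProd b l x = x) : ∀ k ∈ l, P.root' k x = 0 := by
  classical
  induction l with
  | nil => simp
  | cons k l ih =>
    rw [List.nodup_cons] at hl
    have h1 : coreflectionProd b l x = P.coreflection k x := by
      conv_rhs => rw [← h, coreflectionProd_cons, LinearEquiv.mul_apply]
      exact (P.coreflection_same k _).symm
    have h2 : P.root' k x = 0 := by
      -- The reflections in `l` leave the `α_k^∨`-coordinate unchanged; comparing it in `h1`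
      -- isolates `⟨α_k, x⟩`.
      have h3 := corootCoord_coreflectionProd b hl.1 x
      rw [h1, P.coreflection_apply, map_sub, map_smul, corootCoord_coroot, if_pos rfl] at h3
      have h4 : P.root' k x • (1 : ℝ) = 0 := by
        change corootCoord b k x - P.root' k x • (1 : ℝ) = _ at h3
        linarith
      simpa using h4
    have h5 : coreflectionProd b l x = x := by
      rw [h1, P.coreflection_apply]
      change x - P.root' k x • _ = x
      rw [h2]
      simp
    intro k' hk'
    rcases List.mem_cons.1 hk' with rfl | hk'
    · exact h2
    · exact ih hl.2 h5 k' hk'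

theorem eq_smul_fundamentalCoweight (b : P.Base) {i : b.support} {x : N}
    (h : ∀ k : b.support, k ≠ i → P.root' k x = 0) :
    x = P.root' i x • fundamentalCoweight b i := by
  classical
  apply eq_of_root'_eq b
  intro k
  rw [map_smul, root'_fundamentalCoweight]
  by_cases hk : i = k
  · subst hk
    simp
  · rw [h k (Ne.symm hk), if_neg hk]
    simp

/-- The orbit sum of a simple coroot under the product of the other simple reflections is a
positive multiple of a fundamental coweight. -/
theorem exists_orbit_sum_eq (b : P.Base) {i : b.support} {l : List b.support} (hl : l.Nodup)
    (hi : ∀ k, k ∈ l ↔ k ≠ i) :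
    ∃ n : ℕ, 0 < n ∧ coreflectionProd b l ^ n = 1 ∧ ∃ a : ℝ, 0 < a ∧
      ∑ k ∈ Finset.range n, (coreflectionProd b l ^ k) (P.coroot i) =
        a • fundamentalCoweight b i := by
  classical
  set v := coreflectionProd b l with hv
  have hvW : v ∈ finiteWeylGroup P := coreflectionProd_mem b l
  obtain ⟨n, hn, hvn⟩ := exists_pow_eq_one_of_mem hvW
  set μ := ∑ k ∈ Finset.range n, (v ^ k) (P.coroot i) with hμ
  have hfix : v μ = μ := by
    have h1 : v μ = ∑ k ∈ Finset.range n, (v ^ (k + 1)) (P.coroot i) := by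
      rw [hμ, map_sum]
      refine Finset.sum_congr rfl fun k _ ↦ ?_
      rw [pow_succ', LinearEquiv.mul_apply]
    have h2 := Finset.sum_range_succ' (fun k ↦ (v ^ k) (P.coroot i)) n
    have h3 := Finset.sum_range_succ (fun k ↦ (v ^ k) (P.coroot i)) n
    rw [h2, hvn, pow_zero] at h3
    rw [h1]
    exact add_right_cancel h3
  have hfix' : ∀ k : ℕ, (v ^ k) μ = μ := by
    intro k
    induction k with
    | zero => rfl
    | succ k ih => rw [pow_succ, LinearEquiv.mul_apply, hfix, ih]
  -- Since `v` omits `s_i`, each term keeps `α_i^∨`-coordinate 1, so the orbit sum is nonzero.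
  have hcoord : corootCoord b i μ = n := by
    have h1 : ∀ k : ℕ, corootCoord b i ((v ^ k) (P.coroot i)) = 1 := by
      intro k
      induction k with
      | zero => simpa using corootCoord_coroot b i i
      | succ k ih =>
        rw [pow_succ', LinearEquiv.mul_apply, hv,
          corootCoord_coreflectionProd b (by rw [hi]; simp), ← hv, ih]
    rw [hμ, map_sum, Finset.sum_congr rfl fun k _ ↦ h1 k]
    simp
  have hμ0 : μ ≠ 0 := by
    intro h0
    rw [h0, map_zero] at hcoord
    exact hn.ne (by exact_mod_cast hcoord)
  have hmul := eq_smul_fundamentalCoweight b (i := i) (x := μ) fun k hk ↦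
    root'_eq_zero_of_coreflectionProd_eq b hl hfix k ((hi k).2 hk)
  refine ⟨n, hn, hvn, P.root' i μ, ?_, hmul⟩
  -- As `v` fixes `μ`, all terms of the orbit have the same product with `μ`; positivity of `(μ, μ)`
  -- then gives the sign of `⟨α_i, μ⟩`.
  have h1 : P.CorootForm μ μ = n * P.CorootForm (P.coroot i) μ := by
    have h0 : ∀ y, P.CorootForm μ y =
        ∑ k ∈ Finset.range n, P.CorootForm ((v ^ k) (P.coroot i)) y := by
      intro y
      rw [hμ, map_sum, LinearMap.sum_apply]
    rw [h0 μ, Finset.sum_congr rfl fun k _ ↦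
      show P.CorootForm ((v ^ k) (P.coroot i)) μ = P.CorootForm (P.coroot i) μ by
        conv_lhs => rw [← hfix' k]
        exact corootForm_apply_apply_of_mem (pow_mem hvW k) _ _]
    simp
  have h2 := two_mul_corootForm_coroot (P := P) i μ
  have h3 := corootForm_pos (P := P) hμ0
  have h4 := corootForm_pos (P := P) (P.flip.ne_zero (i : ι) : P.coroot i ≠ 0)
  have h5 : (0 : ℝ) < n := by exact_mod_cast hn
  rw [h1] at h3
  have h6 := pos_of_mul_pos_right h3 h5.le
  have h7 : 0 < P.root' i μ * P.CorootForm (P.coroot i) (P.coroot i) := by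
    rw [← h2]
    linarith
  exact pos_of_mul_pos_left h7 h4.le

/-! ### Powers of Coxeter elements -/

theorem exists_coreflectionProd_toList_eq (b : P.Base) {X : Finset b.support}
    (hX : (dynkinGraph b).IsIndepSet (X : Set b.support)) {i : b.support} (hi : i ∈ X) :
    ∃ l : List b.support, l.Nodup ∧ (∀ k, k ∈ l ↔ k ∈ X ∧ k ≠ i) ∧
      coreflectionProd b X.toList = P.coreflection i * coreflectionProd b l := by
  classical
  refine ⟨(X.erase i).toList, (X.erase i).nodup_toList, fun k ↦ by simp [and_comm], ?_⟩
  rw [← coreflectionProd_cons]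
  ext x
  rw [coreflectionProd_toList_apply b X hX, coreflectionProd_apply, List.map_cons, List.sum_cons,
    Finset.sum_map_toList, Finset.add_sum_erase X (fun k : b.support ↦ P.root' k x • P.coroot k) hi]
  · exact List.nodup_cons.2 ⟨by simp, (X.erase i).nodup_toList⟩
  · intro k hk k' hk'
    refine pairing_eq_zero_of_isIndepSet hX ?_ ?_
    · rcases List.mem_cons.1 hk with rfl | h
      · exact hi
      · exact Finset.mem_of_mem_erase (Finset.mem_toList.1 h)
    · rcases List.mem_cons.1 hk' with rfl | h
      · exact hi
      · exact Finset.mem_of_mem_erase (Finset.mem_toList.1 h)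

namespace Bipartition

variable {b : P.Base} (B : Bipartition b)

/-- Some bipartite product of all the simple reflections is turned by conjugation with an
alternating product into the reflection in a prescribed node, followed by the others. -/
theorem exists_coreflectionProd_conj (m : ℕ) (i : b.support) :
    ∃ l l' : List b.support, l.Nodup ∧ (∀ k, k ∈ l) ∧ l'.Nodup ∧ (∀ k, k ∈ l' ↔ k ≠ i) ∧
      B.coAlternatingProd m * coreflectionProd b l =
        P.coreflection i * coreflectionProd b l' * B.coAlternatingProd m := by
  have hdisj : ∀ k, k ∈ B.F → k ∉ B.U := fun k h h' ↦ (B.mem_U_iff k).1 h' h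
  have hFU : (B.F.toList ++ B.U.toList).Nodup ∧ ∀ k, k ∈ B.F.toList ++ B.U.toList := by
    refine ⟨List.nodup_append.2 ⟨B.F.nodup_toList, B.U.nodup_toList, ?_⟩, fun k ↦ ?_⟩
    · rintro k hk _ hk' rfl
      exact hdisj k (by simpa using hk) (by simpa using hk')
    · simpa using B.cover k
  have hUF : (B.U.toList ++ B.F.toList).Nodup ∧ ∀ k, k ∈ B.U.toList ++ B.F.toList :=
    ⟨List.nodup_append_comm.1 hFU.1, fun k ↦ by simpa using (B.cover k).symm⟩
  have eFU : coreflectionProd b (B.F.toList ++ B.U.toList) = B.coF * B.coU :=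
    coreflectionProd_append b _ _
  have eUF : coreflectionProd b (B.U.toList ++ B.F.toList) = B.coU * B.coF :=
    coreflectionProd_append b _ _
  obtain ⟨h1, h2⟩ := B.coAlternatingProd_conj m
  -- An alternating product of even length commutes with `s_F s_U` and one of odd length inverts it;
  -- the order of the factors in `l` is chosen by this parity.
  have hcF : ∃ l : List b.support, l.Nodup ∧ (∀ k, k ∈ l) ∧
      B.coAlternatingProd m * coreflectionProd b l = B.coF * B.coU * B.coAlternatingProd m := by
    by_cases hm : Even m
    · exact ⟨_, hFU.1, hFU.2, by rw [eFU, h1, if_pos hm]⟩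
    · exact ⟨_, hUF.1, hUF.2, by rw [eUF, h2, if_neg hm]⟩
  have hcU : ∃ l : List b.support, l.Nodup ∧ (∀ k, k ∈ l) ∧
      B.coAlternatingProd m * coreflectionProd b l = B.coU * B.coF * B.coAlternatingProd m := by
    by_cases hm : Even m
    · exact ⟨_, hUF.1, hUF.2, by rw [eUF, h2, if_pos hm]⟩
    · exact ⟨_, hFU.1, hFU.2, by rw [eFU, h1, if_neg hm]⟩
  rcases B.cover i with hi | hi
  · obtain ⟨l, hl, hl', hc⟩ := hcF
    obtain ⟨s, hs, hs', he⟩ := exists_coreflectionProd_toList_eq b B.indep_F hi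
    refine ⟨l, s ++ B.U.toList, hl, hl', ?_, fun k ↦ ?_, ?_⟩
    · refine List.nodup_append.2 ⟨hs, B.U.nodup_toList, ?_⟩
      rintro k hk _ hk' rfl
      exact hdisj k ((hs' k).1 hk).1 (by simpa using hk')
    · rw [List.mem_append, hs', Finset.mem_toList]
      have := B.mem_U_iff k
      by_cases h : k = i
      · subst h
        simp [hi, this]
      · simp [h, this, em]
    · rw [hc, coreflectionProd_append, ← mul_assoc, ← he]
      rfl
  · obtain ⟨l, hl, hl', hc⟩ := hcU
    obtain ⟨s, hs, hs', he⟩ := exists_coreflectionProd_toList_eq b B.indep_U hi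
    refine ⟨l, s ++ B.F.toList, hl, hl', ?_, fun k ↦ ?_, ?_⟩
    · refine List.nodup_append.2 ⟨hs, B.F.nodup_toList, ?_⟩
      rintro k hk _ hk' rfl
      exact hdisj k (by simpa using hk') ((hs' k).1 hk).1
    · rw [List.mem_append, hs', Finset.mem_toList]
      have := B.mem_U_iff k
      by_cases h : k = i
      · subst h
        have h' := this.1 hi
        simp [h']
      · simp [h, this, em']
    · rw [hc, coreflectionProd_append, ← mul_assoc, ← he]
      rfl

/-- If an alternating product maps the highest root to `α_i`, then every Coxeter element has a
power which is the translation by a positive multiple of a conjugate of `ω_i^∨`. -/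
theorem exists_pow_coxeterElement (hA : ¬ IsTypeA b) {m : ℕ} {i : b.support}
    (hm : B.alternatingProd m (P.root (highestRoot b)) = P.root i) {c : affineWeylGroup b}
    (hc : IsCoxeterElement b c) :
    ∃ n : ℕ, 0 < n ∧ ∃ a : ℝ, 0 < a ∧ ∃ u ∈ finiteWeylGroup P,
      ∀ x, (c ^ n).1 x = x + u (a • fundamentalCoweight b i) := by
  obtain ⟨l, l', hl, hlm, hl', hlm', hz⟩ := B.exists_coreflectionProd_conj m i
  set z := B.coAlternatingProd m with hzdef
  have hzξ : z (P.coroot (highestRoot b)) = P.coroot i := B.coroot_of_root hm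
  have hzroot : ∀ y, P.root' i (z y) = P.root' (highestRoot b) y := by
    intro y
    have := (B.compatible_alternatingProd m).pairing_eq (P.root (highestRoot b)) y
    rw [hm] at this
    exact this
  have hzW : z ∈ finiteWeylGroup P := B.coAlternatingProd_mem m
  set d := wordProd b (none :: l.map some) with hd
  obtain ⟨n, hn, hvn, a, ha, hsum⟩ := exists_orbit_sum_eq b hl' hlm'
  set v := coreflectionProd b l' with hv
  -- Conjugation by `z` turns the linear part of `s_0` into `s_i`, which cancels the leading `s_i`
  -- of the conjugated finite product.
  have hstep : ∀ x, z (d.1 x) = v (z x) + P.coroot i := by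
    intro x
    have h1 := LinearEquiv.congr_fun hz x
    simp only [LinearEquiv.mul_apply] at h1
    have h2 : ∀ y, z (P.coreflection (highestRoot b) y) = P.coreflection i (z y) := by
      intro y
      rw [P.coreflection_apply, P.coreflection_apply, map_sub, map_smul, hzξ]
      congr 2
      exact (hzroot y).symm
    rw [hd, wordProd_none_cons, map_add, hzξ, h2, h1, add_comm]
    congr 1
    exact P.coreflection_same i _
  have hpow : ∀ (k : ℕ) x, z ((d ^ k).1 x) =
      (v ^ k) (z x) + ∑ j ∈ Finset.range k, (v ^ j) (P.coroot i) := by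
    intro k
    induction k with
    | zero => intro x; simp
    | succ k ih =>
      intro x
      rw [pow_succ, coe_mul_apply, ih, hstep, map_add, Finset.sum_range_succ, pow_succ v,
        LinearEquiv.mul_apply]
      abel
  have hdn : ∀ x, (d ^ n).1 x = x + z⁻¹ (a • fundamentalCoweight b i) := by
    intro x
    apply z.injective
    have h3 : ∀ y, z (z⁻¹ y) = y := LinearEquiv.apply_symm_apply z
    rw [hpow, hsum, hvn, map_add, h3]
    rfl
  obtain ⟨g, hg⟩ := isConj_iff.1 ((isCoxeterElement_wordProd b hl hlm).isConj hA hc)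
  refine ⟨n, hn, a, ha, g.1.linear * z⁻¹, mul_mem (linear_mem_finiteWeylGroup g) (inv_mem hzW),
    fun x ↦ ?_⟩
  rw [← hg, conj_pow, coe_mul_apply, coe_mul_apply, hdn, apply_add, apply_inv_apply]
  rfl

end Bipartition

/-! ### A straight Coxeter element -/

/-- The affine node joins the part `Y`, to which it is orthogonal, giving a bipartite affine Coxeter
element. With `ξ^∨ = s + t` split along `X` and `Y`, the comark-proportional values at the base
point make its displacement a multiple of `s`, and the linear part maps `s ↦ -s ↦ -(ξ^∨ + t) ↦ ξ^∨ -
t = s`. -/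
theorem exists_straight_of_bipartition (b : P.Base) (X Y : Finset b.support)
    (hX : (dynkinGraph b).IsIndepSet (X : Set b.support))
    (hY : (dynkinGraph b).IsIndepSet (Y : Set b.support)) (hXY : Disjoint X Y)
    (hcover : ∀ k, k ∈ X ∨ k ∈ Y) (h : ∀ k ∈ Y, P.pairing (highestRoot b) k = 0) :
    ∃ c : affineWeylGroup b, IsCoxeterElement b c ∧ ∃ κ : N, κ ≠ 0 ∧
      c.1 (basePoint b) = basePoint b + κ ∧ c.1.linear κ = κ := by
  classical
  set ξ := highestRoot b with hξ
  set s := ∑ k ∈ X, (comark b k : ℝ) • P.coroot k with hs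
  set t := ∑ k ∈ Y, (comark b k : ℝ) • P.coroot k with ht
  have hst : P.coroot ξ = s + t := by
    rw [hs, ht, ← Finset.sum_union hXY, coroot_highestRoot_eq_sum b]
    congr 1
    symm
    rw [Finset.eq_univ_iff_forall]
    intro k
    rw [Finset.mem_union]
    exact hcover k
  have hself : ∀ T : Finset b.support, (dynkinGraph b).IsIndepSet (T : Set b.support) → ∀ k ∈ T,
      P.root' k (∑ k ∈ T, (comark b k : ℝ) • P.coroot k) = 2 * comark b k := by
    intro T hT k hk
    simp only [map_sum, map_smul, P.root'_coroot_eq_pairing, smul_eq_mul]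
    rw [Finset.sum_eq_single_of_mem k hk, P.pairing_same, mul_comm]
    intro k' hk' hne
    rw [pairing_eq_zero_of_isIndepSet hT hk hk' hne.symm, mul_zero]
  have hsX : coreflectionProd b X.toList s = - s := by
    rw [coreflectionProd_toList_apply b X hX, Finset.sum_congr rfl fun k hk ↦ by
      rw [hself X hX k hk, mul_smul], ← Finset.smul_sum, ← hs]
    module
  have htY : coreflectionProd b Y.toList t = - t := by
    rw [coreflectionProd_toList_apply b Y hY, Finset.sum_congr rfl fun k hk ↦ by
      rw [hself Y hY k hk, mul_smul], ← Finset.smul_sum, ← ht]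
    module
  have hξY : coreflectionProd b Y.toList (P.coroot ξ) = P.coroot ξ := by
    rw [coreflectionProd_toList_apply b Y hY, Finset.sum_eq_zero, sub_zero]
    intro k hk
    rw [P.root'_coroot_eq_pairing, pairing_zero_symm (h k hk), zero_smul]
  have hbase : ∀ T : Finset b.support, (dynkinGraph b).IsIndepSet (T : Set b.support) →
      coreflectionProd b T.toList (basePoint b) = basePoint b -
        baseScale b • ∑ k ∈ T, (comark b k : ℝ) • P.coroot k := by
    intro T hT
    rw [coreflectionProd_toList_apply b T hT, Finset.smul_sum]
    simp only [root'_basePoint, mul_smul]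
  have htξ : P.root' ξ t = 0 := by
    rw [ht]
    simp only [map_sum, map_smul, P.root'_coroot_eq_pairing, smul_eq_mul]
    exact Finset.sum_eq_zero fun k hk ↦ by rw [h k hk, mul_zero]
  have hbξ : P.root' ξ (basePoint b) = 1 - baseScale b := by
    have := affineEval_basePoint b none
    rw [affineEval_none] at this
    simp only [affineComark] at this
    linarith
  have hsξ : P.root' ξ s = 2 := by
    have h1 : s = P.coroot ξ - t := by rw [hst]; abel
    rw [h1, map_sub, htξ, P.root'_coroot_eq_pairing, P.pairing_same, sub_zero]
  have hrefl : ∀ y, P.coreflection ξ y = y - P.root' ξ y • P.coroot ξ := fun y ↦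
    P.coreflection_apply ξ y
  have hsY : coreflectionProd b Y.toList s = P.coroot ξ + t := by
    have h1 : s = P.coroot ξ - t := by rw [hst]; abel
    rw [h1, map_sub, hξY, htY]
    abel
  have hc : ∀ y, (wordProd b (none :: (Y.toList ++ X.toList).map some)).1 y = P.coroot ξ +
      P.coreflection ξ (coreflectionProd b Y.toList (coreflectionProd b X.toList y)) := by
    intro y
    rw [wordProd_none_cons, coreflectionProd_append]
    rfl
  refine ⟨wordProd b (none :: (Y.toList ++ X.toList).map some),
    isCoxeterElement_wordProd b (List.nodup_append.2 ⟨Y.nodup_toList, X.nodup_toList, ?_⟩)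
      (fun k ↦ by simpa using (hcover k).symm), (2 * baseScale b) • s, ?_, ?_, ?_⟩
  · rintro k hk _ hk' rfl
    exact Finset.disjoint_left.1 hXY (by simpa using hk') (by simpa using hk)
  · intro h0
    have h1 := congr_arg (P.root' ξ) h0
    rw [map_smul, hsξ, map_zero, smul_eq_mul] at h1
    have := baseScale_pos b
    linarith
  · rw [hc, hbase X hX, map_sub, map_smul, hbase Y hY, ← hs, hsY, ← ht, hrefl]
    simp only [map_sub, map_add, map_smul, hbξ, htξ, P.root'_coroot_eq_pairing, P.pairing_same,
      smul_eq_mul]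
    rw [hst]
    module
  · have h1 : ∀ v, (wordProd b (none :: (Y.toList ++ X.toList).map some)).1.linear v =
        P.coreflection ξ (coreflectionProd b Y.toList (coreflectionProd b X.toList v)) := by
      intro v
      have h2 := apply_add (wordProd b (none :: (Y.toList ++ X.toList).map some)) 0 v
      rw [hc, hc, zero_add, map_zero, map_zero, map_zero, add_zero] at h2
      exact (add_left_cancel h2).symm
    rw [map_smul, h1, hsX, map_neg, hsY, hrefl]
    simp only [map_neg, map_add, htξ, P.root'_coroot_eq_pairing, P.pairing_same]
    rw [hst]
    module

theorem exists_straight_coxeterElement (b : P.Base) (hA : ¬ IsTypeA b) :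
    ∃ c : affineWeylGroup b, IsCoxeterElement b c ∧ ∃ κ : N, κ ≠ 0 ∧
      c.1 (basePoint b) = basePoint b + κ ∧ c.1.linear κ = κ := by
  obtain ⟨B⟩ := nonempty_bipartition b
  obtain ⟨j, hj, -⟩ := exists_unique_affine_neighbor b hA
  rcases B.cover j with h | h
  · refine exists_straight_of_bipartition b B.F B.U B.indep_F B.indep_U B.disjoint B.cover
      fun k hk ↦ hj k ?_
    rintro rfl
    exact (B.mem_U_iff k).1 hk h
  · refine exists_straight_of_bipartition b B.U B.F B.indep_U B.indep_F B.disjoint.symm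
      (fun k ↦ (B.cover k).symm) fun k hk ↦ hj k ?_
    rintro rfl
    exact (B.mem_U_iff k).1 h hk

end

end LimitWeakOrder

/-! ### Identification of the Coxeter node. -/

namespace LimitWeakOrder

open RootPairing

noncomputable section

set_option linter.unusedSectionVars false

variable {ι M N : Type*} [AddCommGroup M] [Module ℝ M] [AddCommGroup N] [Module ℝ N]
  {P : RootPairing ι ℝ M N} [P.IsRootSystem] [Fintype ι] [P.IsCrystallographic]
  [P.IsReduced] [P.IsIrreducible]

/-! ### Coxeter nodes -/

theorem coweightIndex_pos (b : P.Base) (i : b.support) : 0 < coweightIndex b i := by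
  classical
  exact (Nat.find_spec (exists_smul_mem_corootLattice b i)).1

theorem coweightIndex_smul_mem (b : P.Base) (i : b.support) :
    coweightIndex b i • fundamentalCoweight b i ∈ corootLattice P := by
  classical
  exact (Nat.find_spec (exists_smul_mem_corootLattice b i)).2

theorem root'_fundamentalCoweight_nonneg (b : P.Base) (i k : b.support) :
    0 ≤ P.root' k (fundamentalCoweight b i) := by
  classical
  rw [root'_fundamentalCoweight]
  split_ifs <;> norm_num

/-- Conjugates of fundamental coweights on which the same roots are negative come from the same
node. -/
theorem eq_of_root'_neg_iff (b : P.Base) {i j : b.support} {u w : N ≃ₗ[ℝ] N}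
    (hu : u ∈ finiteWeylGroup P) (hw : w ∈ finiteWeylGroup P) {a a' : ℝ} (ha : 0 < a)
    (ha' : 0 < a') (h : ∀ k, P.root' k (u (a • fundamentalCoweight b i)) < 0 ↔
      P.root' k (w (a' • fundamentalCoweight b j)) < 0) : i = j := by
  classical
  set v := w⁻¹ * u with hv
  have hvW : v ∈ finiteWeylGroup P := mul_mem (inv_mem hw) hu
  have hwv : ∀ x, w (v x) = u x := fun x ↦ LinearEquiv.apply_symm_apply w _
  have h1 : ∀ k, P.root' k (v (a • fundamentalCoweight b i)) < 0 ↔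
      P.root' k (a' • fundamentalCoweight b j) < 0 := by
    intro k
    obtain ⟨k', -, hk'⟩ := exists_coroot_image hw k
    rw [← hk', ← hk', hwv]
    exact h k'
  have hsign : ∀ k : b.support, 0 ≤ P.root' k (a' • fundamentalCoweight b j) := by
    intro k
    rw [map_smul, smul_eq_mul]
    exact mul_nonneg ha'.le (root'_fundamentalCoweight_nonneg b j k)
  have hdom : ∀ k : b.support, 0 ≤ P.root' k (v (a • fundamentalCoweight b i)) := fun k ↦
    not_lt.1 fun h' ↦ not_le.2 ((h1 k).1 h') (hsign k)
  have hdom' : ∀ k : b.support, 0 ≤ P.root' k (a • fundamentalCoweight b i) := by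
    intro k
    rw [map_smul, smul_eq_mul]
    exact mul_nonneg ha.le (root'_fundamentalCoweight_nonneg b i k)
  rw [apply_eq_of_dominant b hvW hdom' hdom] at h1
  -- After passing to the dominant representative, the root `-α_i` is negative on `ω_i^∨` but
  -- vanishes on `ω_j^∨` for `j ≠ i`.
  have h2 := h1 (P.reflectionPerm i i)
  rw [root'_reflectionPerm_self, root'_reflectionPerm_self, map_smul, map_smul,
    root'_fundamentalCoweight, root'_fundamentalCoweight, if_pos rfl] at h2
  by_contra hij
  rw [if_neg (Ne.symm hij)] at h2
  simp only [smul_eq_mul, mul_one, mul_zero, neg_zero, lt_self_iff_false, iff_false] at h2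
  linarith

/-- If all Coxeter elements have powers which are translations by conjugates of positive multiples
of `ω_i^∨`, then `α_i` is the only Coxeter node. -/
theorem isCoxeterNode_iff (b : P.Base) (hA : ¬ IsTypeA b) {i : b.support}
    (h : ∀ c, IsCoxeterElement b c → ∃ n : ℕ, 0 < n ∧ ∃ a : ℝ, 0 < a ∧ ∃ u ∈ finiteWeylGroup P,
      ∀ x, (c ^ n).1 x = x + u (a • fundamentalCoweight b i)) (j : b.support) :
    IsCoxeterNode b j ↔ j = i := by
  have hpos : ∀ j, (0 : ℝ) < coweightIndex b j := fun j ↦ by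
    exact_mod_cast coweightIndex_pos b j
  have hcast : ∀ j, coweightIndex b j • fundamentalCoweight b j =
      (coweightIndex b j : ℝ) • fundamentalCoweight b j := fun j ↦
    (Nat.cast_smul_eq_nsmul ℝ _ _).symm
  constructor
  · rintro ⟨c, hc, w, hw, t, ht, L, hcL, htL⟩
    obtain ⟨n, hn, a, ha, u, hu, hx⟩ := h c hc
    have ht1 : ∀ x, (t ^ 1).1 x = x + w ((coweightIndex b j : ℝ) • fundamentalCoweight b j) := by
      intro x
      rw [pow_one, ht, ← hcast, add_comm]
      rfl
    have h1 := (isInfinitePower_eq_iff hcL htL hn one_pos hx ht1).1 rfl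
    exact (eq_of_root'_neg_iff b hu hw ha (hpos j) h1).symm
  · rintro rfl
    obtain ⟨c, hc, κ, hκ, hκ1, hκ2⟩ := exists_straight_coxeterElement b hA
    obtain ⟨n, hn, a, ha, u, hu, hx⟩ := h c hc
    obtain ⟨L, hcL⟩ := exists_isInfinitePower_of_straight c hκ1 hκ2 hκ
    set ν := u (coweightIndex b j • fundamentalCoweight b j) with hν
    obtain ⟨t, ht⟩ := corootLattice_le_translationLattice b
      (apply_mem_corootLattice hu (coweightIndex_smul_mem b j))
    have ht' : t.1 = AffineEquiv.constVAdd ℝ N ν := by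
      apply AffineEquiv.ext
      intro x
      rw [ht, add_comm]
      rfl
    have hν0 : ν ≠ 0 := by
      classical
      rw [hν, hcast, map_ne_zero_iff u u.injective]
      intro h0
      have h1 := congr_arg (P.root' j) h0
      rw [map_smul, root'_fundamentalCoweight, if_pos rfl, map_zero, smul_eq_mul, mul_one] at h1
      exact (hpos j).ne' h1
    -- A translation is straight: its linear part is the identity.
    obtain ⟨L', htL⟩ := exists_isInfinitePower_of_straight t (ht (basePoint b))
      (by rw [ht']; rfl) hν0
    have ht1 : ∀ x, (t ^ 1).1 x = x + ν := by
      intro x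
      rw [pow_one]
      exact ht x
    have hLL : L = L' := by
      refine (isInfinitePower_eq_iff hcL htL hn one_pos hx ht1).2 fun k ↦ ?_
      rw [hν, hcast]
      simp only [map_smul, smul_eq_mul]
      have hneg : ∀ c : ℝ, 0 < c → ∀ y : ℝ, c * y < 0 ↔ y < 0 := fun c hc y ↦
        ⟨fun h ↦ neg_of_mul_neg_right h hc.le, fun h ↦ mul_neg_of_pos_of_neg hc h⟩
      rw [hneg a ha, hneg _ (hpos j)]
    exact ⟨c, hc, u, hu, t, ht', L, hcL, hLL ▸ htL⟩

end

end LimitWeakOrder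

theorem theorem4p4 {ι M N : Type*} [Fintype ι] [AddCommGroup M] [Module ℝ M] [AddCommGroup N]
    [Module ℝ N] (P : RootPairing ι ℝ M N) [P.IsRootSystem] [P.IsCrystallographic] [P.IsReduced]
    [P.IsIrreducible] (b : P.Base) (hA : ¬ LimitWeakOrder.IsTypeA b) :
    Nonempty (LimitWeakOrder.Bipartition b) ∧
      ∀ (B : LimitWeakOrder.Bipartition b) (i : b.support),
        [LimitWeakOrder.IsCoxeterNode b i,
          LimitWeakOrder.IsHeavyNode b i,
          ∃ m : ℕ, B.alternatingProd m (P.root (LimitWeakOrder.highestRoot b)) =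
            P.root i].TFAE := by
  refine ⟨LimitWeakOrder.nonempty_bipartition b, fun B i ↦ ?_⟩
  have hcox : ∀ {m : ℕ} {i : b.support},
      B.alternatingProd m (P.root (LimitWeakOrder.highestRoot b)) = P.root i →
      ∀ j, LimitWeakOrder.IsCoxeterNode b j ↔ j = i := fun hm ↦
    LimitWeakOrder.isCoxeterNode_iff b hA fun _ hc ↦ B.exists_pow_coxeterElement hA hm hc
  -- One simple root in the alternating orbit suffices: it is the only Coxeter node and the only
  -- heavy node.
  obtain ⟨m, i₀, hm⟩ := B.exists_alternatingProd_highestRoot_eq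
  tfae_have 3 → 1 := fun ⟨_, h⟩ ↦ (hcox h i).2 rfl
  tfae_have 1 → 3 := fun h ↦ ⟨m, by rw [(hcox hm i).1 h, hm]⟩
  tfae_have 3 → 2 := fun ⟨_, h⟩ ↦ B.isHeavyNode_of_alternatingProd hA h
  tfae_have 2 → 3 := fun h ↦ ⟨m, by rw [h.unique (B.isHeavyNode_of_alternatingProd hA hm), hm]⟩
  tfae_finish
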